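/- **Theorem 1.** Let $H_n$ denote the (physicists') Hermite polynomial. Let $\beta>0$, $n\in\{0,1,2,\dots\}$, $N=2n+1$. For every integer $p\ge1$, $$H_n(\sqrt N\cosh\beta)=\frac{2^n\,n!\,e^{N(e^{-2\beta}+2\beta+2)/4}}{\sqrt{2\pi\sinh\beta}\,N^{(n+1)/2}}\left\{\sum_{j=0}^{p-1}\frac{A_j(\coth\beta)}{N^j}+\varepsilon_p(N,\beta)\right\},\qquad |\varepsilon_p(N,\beta)|\le\frac{\widetilde C_p}{N^p},$$ with $$\widetilde C_p=|A_p(\coth\beta)|+\frac{\sqrt{\sinh\beta}}{2\pi^{3/2}}\,\frac{C_{p+1}\,\Gamma(p+3/2)}{N},$$ $$C_{p+1}=\frac{2^{p+9/2}}{\pi^{p+3/2}}+\frac{1}{\pi p\,2^{p-5/2}(\cosh\beta)^{p+1/2}}+\frac{2}{\tanh\beta}\left\{\frac{4\pi\sqrt{\cosh\beta}}{[\sinh(2\beta)/2-\beta]^{p+3/2}}+\frac{2^{-p}\pi}{3e^{(2p+5/2)\beta}}\right\}.$$ In particular, $\widetilde C_p\to|A_p(\coth\beta)|$ as $N\to+\infty$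 with $\beta,p$ fixed. The coefficients $A_j(\coth\beta)$ are given by the following absolutely convergent contour integrals. Let $f(z)=z^2-2z\cosh\beta+\tfrac12\ln z$ (principal logarithm), $t_\pm=e^{\pm\beta}/2$, and let $t_c>t_+$ be the root of $f(t)=f(t_-)$ in $(t_+,\infty)$. There is exactly one holomorphic function $w$ on $\mathbb C\setminus((-\infty,0]\cup[t_c,\infty))$ with $w(z)^2=f(z)-f(t_-)$ and $w'(t_-)=-i\sqrt{e^{2\beta}-1}$, and for every $\delta\in(0,t_-)$ and $j\ge0$ $$A_j(\coth\beta)=-\frac{\sqrt{\sinh\beta}\,\Gamma(j+1/2)}{2\pi^{3/2}}\int_{\Gamma_0\cup\Gamma_+}\frac{z^{-1/2}}{w(z)^{2j+1}}\,dz .$$ Here $\Gamma_0$ consists of the half line $\{\lambda+i\delta:\lambda<0\}$, the arc $\{\delta e^{i\theta}:|\theta|\le\pi/2\}$ and the half line $\{\lambda-i\delta:\lambda<0\}$, traversed clockwise around $(-\infty,0]$, and $\Gamma_+=\{r_+(\theta)e^{i\theta}:|\theta|<\pi/2\}$, $\theta$ increasing, where $r_+(0)=t_+$ and $r_+(\theta)=\bigl(\cosh\beta+\sqrt{\cosh^2\beta-\theta/\tan\theta}\bigr)/(2\cos\theta)$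 for $\theta\neq0$. Moreover $A_j(t)$ is a polynomial in $t$ of degree exactly $3j$ with rational coefficients, and it can be computed recursively: $$A_j(t)=\frac{(-1)^j}{\sqrt\pi}\Bigl(\frac{1+t}{2}\Bigr)^j\int_0^{\infty}e^{-s}s^{j-1/2}P_{2j}((1+t)s)\,ds,$$ where $P_0(t)=1$ and $P_j(t)=\dfrac1{2^j}\dbinom{2j}{j}-\displaystyle\sum_{k=1}^{j}\frac{2^k}{k+2}\int_0^tP_{j-k}(s)\,ds$ for $j\ge1$. -/

import Mathlib

open scoped Nat Topology
open MeasureTheory Filter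

noncomputable section

namespace HermiteOuter

/-- The physicists' Hermite polynomial `H_n(x)`, expressed through Mathlib's probabilists'
Hermite polynomial `He_n` by `H_n(x) = 2 ^ (n / 2) * He_n(√2 * x)`. -/
def physHermite (n : ℕ) (x : ℝ) : ℝ :=
  (√2) ^ n * Polynomial.aeval (√2 * x) (Polynomial.hermite n)

/-- The hyperbolic cotangent. -/
def coth (β : ℝ) : ℝ := Real.cosh β / Real.sinh β

/-- `N = 2 n + 1`. -/
def bigN (n : ℕ) : ℝ := 2 * (n : ℝ) + 1

/-! ### The phase function, its saddle points and the square root `w` -/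

/-- The phase function `f(z) = z ^ 2 - 2 z cosh β + (ln z) / 2`, principal logarithm. -/
def phase (β : ℝ) (z : ℂ) : ℂ :=
  z ^ 2 - 2 * z * (Real.cosh β : ℂ) + Complex.log z / 2

/-- The phase function on the positive real line. -/
def phaseReal (β : ℝ) (t : ℝ) : ℝ :=
  t ^ 2 - 2 * t * Real.cosh β + Real.log t / 2

/-- The saddle point `t₋ = exp (-β) / 2`. -/
def tMinus (β : ℝ) : ℝ := Real.exp (-β) / 2

/-- The saddle point `t₊ = exp β / 2`. -/
def tPlus (β : ℝ) : ℝ := Real.exp β / 2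

/-- The branch cut `[t_c, ∞)`, where `t_c` is the root of `f(t) = f(t₋)` that is larger than `t₊`:
as `f` increases on `(t₊, ∞)` from a value below `f(t₋)` to `∞`, the cut consists of the reals
`t > t₊` with `f(t₋) ≤ f(t)`. -/
def branchCut (β : ℝ) : Set ℂ :=
  {z | z.im = 0 ∧ tPlus β < z.re ∧ phaseReal β (tMinus β) ≤ phaseReal β z.re}

/-- The domain of `w`: the plane without `(-∞, 0]` and without `[t_c, ∞)`. -/
def wDomain (β : ℝ) : Set ℂ := Complex.slitPlane \ branchCut β

/-- `w` is the holomorphic branch of `(f(z) - f(t₋)) ^ (1 / 2)` on its domain with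
`w(z) = -i (z - t₋) (exp (2 β) - 1) ^ (1 / 2) + O((z - t₋) ^ 2)` at `t₋`. -/
def IsPhaseRoot (β : ℝ) (w : ℂ → ℂ) : Prop :=
  DifferentiableOn ℂ w (wDomain β) ∧
  (∀ z ∈ wDomain β, w z ^ 2 = phase β z - phase β (tMinus β : ℂ)) ∧
  HasDerivAt w (-Complex.I * (√(Real.exp (2 * β) - 1) : ℂ)) (tMinus β : ℂ)

/-! ### The contours -/

/-- The integrand of `∫ F dz` along the path `γ`. -/
def pathIntegrand (F : ℂ → ℂ) (γ : ℝ → ℂ) (t : ℝ) : ℂ := F (γ t) * deriv γ t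

/-- `r₊(θ)`, with `r₊(0) = t₊`. -/
def rPlus (β θ : ℝ) : ℝ :=
  if θ = 0 then tPlus β
  else (Real.cosh β + √(Real.cosh β ^ 2 - θ / Real.tan θ)) / (2 * Real.cos θ)

/-- The contour `Γ₊`, parametrized by `θ ∈ (-π/2, π/2)`. -/
def gammaPlus (β θ : ℝ) : ℂ := (rPlus β θ : ℂ) * Complex.exp ((θ : ℂ) * Complex.I)

/-- The circular arc of `Γ₀`. -/
def arc (δ θ : ℝ) : ℂ := (δ : ℂ) * Complex.exp ((θ : ℂ) * Complex.I)

/-- The half line `l + i δ`, `l < 0`; the lower half line of `Γ₀` is `halfLine (-δ)`. -/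
def halfLine (δ l : ℝ) : ℂ := (l : ℂ) + (δ : ℂ) * Complex.I

/-- `F` is absolutely integrable along `Γ₀ ∪ Γ₊`. -/
def ContourIntegrable (β δ : ℝ) (F : ℂ → ℂ) : Prop :=
  IntegrableOn (pathIntegrand F (halfLine δ)) (Set.Iio 0) ∧
  IntervalIntegrable (pathIntegrand F (arc δ)) volume (Real.pi / 2) (-(Real.pi / 2)) ∧
  IntegrableOn (pathIntegrand F (halfLine (-δ))) (Set.Iio 0) ∧
  IntegrableOn (pathIntegrand F (gammaPlus β)) (Set.Ioo (-(Real.pi / 2)) (Real.pi / 2))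

/-- `∫ F dz` over `Γ₀ ∪ Γ₊`. Here `Γ₀` is traversed clockwise: in along the upper half line, along
the arc from `i δ` to `-i δ`, out along the lower half line; `Γ₊` is traversed upwards. -/
def contourIntegral (β δ : ℝ) (F : ℂ → ℂ) : ℂ :=
  (∫ l in Set.Iio (0 : ℝ), pathIntegrand F (halfLine δ) l) +
  (∫ θ in (Real.pi / 2)..(-(Real.pi / 2)), pathIntegrand F (arc δ) θ) -
  (∫ l in Set.Iio (0 : ℝ), pathIntegrand F (halfLine (-δ)) l) +
  (∫ θ in Set.Ioo (-(Real.pi / 2)) (Real.pi / 2), pathIntegrand F (gammaPlus β) θ)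

/-- The integrand `z ^ (-1/2) / w(z) ^ (2 j + 1)`. -/
def coeffIntegrand (w : ℂ → ℂ) (j : ℕ) (z : ℂ) : ℂ :=
  z ^ (-(1 / 2) : ℂ) / w z ^ (2 * j + 1)

/-- The contour integral that defines the coefficient `A_j(coth β)`. -/
def contourCoeff (β δ : ℝ) (w : ℂ → ℂ) (j : ℕ) : ℂ :=
  -((√(Real.sinh β) * Real.Gamma ((j : ℝ) + 1 / 2) /
      (2 * Real.pi ^ (3 / 2 : ℝ)) : ℝ) : ℂ) *
    contourIntegral β δ (coeffIntegrand w j)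

/-! ### The recursive scheme for the coefficients -/

/-- `P_0 = 1` and
`P_j(t) = 2 ^ (-j) * binom (2 j) j - ∑_{k = 1}^{j} 2 ^ k / (k + 2) * ∫_0^t P_{j - k}(s) ds`
(the summation index below is `k - 1`). -/
def recP (j : ℕ) (t : ℝ) : ℝ :=
  ((2 * j).choose j : ℝ) / 2 ^ j -
    ∑ k : Fin j, (2 : ℝ) ^ ((k : ℕ) + 1) / (((k : ℕ) : ℝ) + 3) *
      ∫ s in (0 : ℝ)..t, recP (j - 1 - (k : ℕ)) s
termination_by j
decreasing_by
  have := k.isLt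
  omega

/-- The coefficient function
`A_j(t) = (-1) ^ j / √π * ((1 + t) / 2) ^ j * ∫_0^∞ e ^ (-s) s ^ (j - 1/2) P_{2j}((1 + t) s) ds`. -/
def coeffA (j : ℕ) (t : ℝ) : ℝ :=
  (-1) ^ j / √Real.pi * ((1 + t) / 2) ^ j *
    ∫ s in Set.Ioi (0 : ℝ),
      Real.exp (-s) * s ^ ((j : ℝ) - 1 / 2) * recP (2 * j) ((1 + t) * s)

/-! ### Prefactor and error constants -/

/-- `2 ^ n n! exp (N (exp (-2 β) + 2 β + 2) / 4) / (√(2 π sinh β) N ^ ((n + 1) / 2))`. -/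
def prefactor (n : ℕ) (β : ℝ) : ℝ :=
  2 ^ n * (n ! : ℝ) * Real.exp (bigN n * (Real.exp (-2 * β) + 2 * β + 2) / 4) /
    (√(2 * Real.pi * Real.sinh β) * bigN n ^ (((n : ℝ) + 1) / 2))

/-- The constant `C_{p+1}`, as a function of `p`. -/
def constC (p : ℕ) (β : ℝ) : ℝ :=
  2 ^ ((p : ℝ) + 9 / 2) / Real.pi ^ ((p : ℝ) + 3 / 2) +
  1 / (Real.pi * p * 2 ^ ((p : ℝ) - 5 / 2) * Real.cosh β ^ ((p : ℝ) + 1 / 2)) +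
  2 / Real.tanh β *
    (4 * Real.pi * √(Real.cosh β) / (Real.sinh (2 * β) / 2 - β) ^ ((p : ℝ) + 3 / 2) +
      2 ^ (-(p : ℝ)) * Real.pi / (3 * Real.exp ((2 * (p : ℝ) + 5 / 2) * β)))

/-- The constant `C̃_p`. -/
def constCtilde (p n : ℕ) (β : ℝ) : ℝ :=
  |coeffA p (coth β)| +
    √(Real.sinh β) / (2 * Real.pi ^ (3 / 2 : ℝ)) *
      (constC p β * Real.Gamma ((p : ℝ) + 3 / 2) / bigN n)

end HermiteOuter

end

noncomputable section

namespace HermiteOuter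

/-! Write `N = 2 n + 1`. The function `z ^ (-1/2) * exp (-N w(z) ^ 2)` is a constant times `z ^
(-(n+1))` times an entire exponential (`cpow_mul_exp_phaseRoot`), so its integral around the origin
is, up to constants, `H_n(√N cosh β)` (`circleIntegral_hermiteKernel`). The expansion comes from the
saddle point `t₋`, where `w` vanishes to first order.

Laplace's method is replaced by an exact device, the entire function `J = gaussTransform N`. In the
lower half plane `J(w)` is the Cauchy transform `∫ exp (-N v²) / (w - v) dv`
(`gaussTransform_eq_integral`), which expands in odd inverse powers of `w` with Gaussian moments as
coefficients and an explicit remainder (`norm_gaussTransform_sub_le`). The reflection formula `J(w)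
+ J(-w) = 2πi exp (-N w²)` (`gaussTransform_add_neg`) shows that in the upper half plane the same
expansion holds after subtracting the exponential.

Let `R(z)` be `z ^ (-1/2)` times the difference of `J(w(z))` and finitely many terms of its
expansion (`remainder`). Deforming `Γ₀ ∪ Γ₊` to a circle around `t₋`, where `z ^ (-1/2) J(w(z))` is
holomorphic, turns the integral of `R` into minus a sum of moments times residues
(`circleIntegral_remainder`). On `Γ₊` the values of `w` lie in the lower half plane and `R` is
small. On a narrow keyhole they lie in the upper half plane, off the positive axis, and `R` is small
apart from the exponential, whose integral tends to the Hermite term as the keyhole closes.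
Comparing the two evaluations gives the expansion with an explicit error
(`norm_circleIntegral_remainder_add_le`).

The geometry rests on the quotient `q(z) = (f(t₋) - f(z)) / (z - t₋)²`. Differentiating along
segments from `t₋` gives `Im z * Im q(z) < 0` off the real axis (`im_mul_im_phaseQuot_neg`). Hence
the domain of `w` is exactly the part of the slit plane where `q` avoids `(-∞, 0]`, the branch is `w
= -i (z - t₋) √q`, and the signs of the real and imaginary parts of `√q` locate the values of `w`.
On `Γ₊` the square `w²` is real and at most `f(t₊) - f(t₋)`.

The contour integrals for `A_j` are also residues at `t₋`. With `z = t₋ (1 + u)` the quotient `q` is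
a constant times `1 + (1 + coth β) ψ(u)`, `ψ = logTail` (`phaseQuot_tMinus_mul`). Euler's integral
for the power `-(j + 1/2)` of this factor reduces the residue to Laurent coefficients of `(1 + u) ^
(-1/2) exp (-ψ T)`, and the identity `exp (-ψ T) = 1 - ψ ∫₀ᵀ exp (-ψ s) ds` yields the recursion for
`P_j` (`circleIntegral_eq_recP`). The degree of `A_j` is read off from that recursion. -/

/-! ### Rational polynomials behind the recursion. -/

open Polynomial in
/-- The antiderivative of a polynomial that vanishes at `0`. -/
def polyPrimitive (q : ℚ[X]) : ℚ[X] :=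
  ∑ k ∈ Finset.range (q.natDegree + 1), C (q.coeff k / (k + 1)) * X ^ (k + 1)

open Polynomial in
lemma coeff_polyPrimitive_succ (q : ℚ[X]) (k : ℕ) :
    (polyPrimitive q).coeff (k + 1) = q.coeff k / (k + 1) := by
  simp only [polyPrimitive, finsetSum_coeff, coeff_C_mul, coeff_X_pow, add_left_inj]
  by_cases h : k ≤ q.natDegree
  · simp [Finset.sum_ite_eq, h]
  · simp [h, coeff_eq_zero_of_natDegree_lt (not_le.1 h)]

open Polynomial in
lemma natDegree_polyPrimitive_le (q : ℚ[X]) :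
    (polyPrimitive q).natDegree ≤ q.natDegree + 1 := by
  refine natDegree_sum_le_of_forall_le _ _ fun k hk => ?_
  refine (natDegree_C_mul_X_pow_le _ _).trans ?_
  have := Finset.mem_range.1 hk
  omega

open Polynomial in
lemma integral_aeval (q : ℚ[X]) (t : ℝ) :
    ∫ s in (0 : ℝ)..t, aeval s q = aeval t (polyPrimitive q) := by
  have h : ∀ s : ℝ, aeval s q = ∑ k ∈ Finset.range (q.natDegree + 1), (q.coeff k : ℝ) * s ^ k := by
    intro s
    rw [aeval_eq_sum_range]
    simp [Algebra.smul_def]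
  simp_rw [h, polyPrimitive, map_sum]
  rw [intervalIntegral.integral_finsetSum
    (fun k _ => (by fun_prop : Continuous fun s : ℝ => (q.coeff k : ℝ) * s ^ k).intervalIntegrable _ _)]
  refine Finset.sum_congr rfl fun k _ => ?_
  simp
  ring

open Polynomial in
/-- `recP j` is given by a rational polynomial of degree `j`. -/
lemma exists_polynomial_recP (j : ℕ) : ∃ q : ℚ[X], q.natDegree ≤ j ∧ q.coeff j ≠ 0 ∧
    ∀ t : ℝ, recP j t = aeval t q := by
  induction j using Nat.strong_induction_on with
  | _ j ih =>
  choose! Q hdeg hlead hQ using ih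
  refine ⟨C (((2 * j).choose j : ℚ) / 2 ^ j) -
    ∑ k : Fin j, C ((2 : ℚ) ^ ((k : ℕ) + 1) / (((k : ℕ) : ℚ) + 3)) *
      polyPrimitive (Q (j - 1 - k)), ?_, ?_, ?_⟩
  · refine (natDegree_sub_le _ _).trans (max_le (by simp) ?_)
    refine natDegree_sum_le_of_forall_le _ _ fun k _ => ?_
    refine (natDegree_C_mul_le _ _).trans ((natDegree_polyPrimitive_le _).trans ?_)
    have := hdeg (j - 1 - k) (by omega)
    omega
  · rcases j with _ | j
    · simp
    -- Only the first summand reaches degree `j + 1`: it integrates `Q j`, while the later ones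
    -- integrate polynomials of lower degree. The leading coefficient is thus a nonzero multiple of
    -- that of `Q j`.
    · rw [coeff_sub, coeff_C, if_neg (by omega), finsetSum_coeff, Fin.sum_univ_succ]
      simp only [coeff_C_mul, coeff_polyPrimitive_succ]
      rw [Finset.sum_eq_zero]
      · have h0 : (Q j).coeff j ≠ 0 := hlead j (by omega)
        simp [h0]
        positivity
      · intro k _
        have := hdeg (j + 1 - 1 - (k.succ : Fin (j + 1))) (by omega)
        rw [coeff_eq_zero_of_natDegree_lt (n := j)]
        · simp
        · have := k.isLt
          simp only [Fin.val_succ] at *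
          omega
  · intro t
    rw [recP]
    simp only [map_sub, map_sum, map_mul, aeval_C]
    congr 1
    · simp
    · refine Finset.sum_congr rfl fun k _ => ?_
      rw [← integral_aeval]
      simp_rw [hQ (j - 1 - k) (by omega)]
      simp

lemma integral_exp_mul_rpow (j k : ℕ) :
    ∫ s in Set.Ioi (0 : ℝ), Real.exp (-s) * s ^ ((j : ℝ) - 1 / 2) * s ^ k =
      Real.Gamma (((j + k : ℕ) : ℝ) + 1 / 2) := by
  rw [Real.Gamma_eq_integral (by positivity)]
  refine setIntegral_congr_fun measurableSet_Ioi fun s hs => ?_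
  have hs : 0 < s := hs
  rw [← Real.rpow_natCast s k, mul_assoc, ← Real.rpow_add hs]
  push_cast
  ring_nf

lemma integrableOn_exp_mul_rpow (j k : ℕ) :
    IntegrableOn (fun s : ℝ => Real.exp (-s) * s ^ ((j : ℝ) - 1 / 2) * s ^ k) (Set.Ioi 0) := by
  refine (Real.GammaIntegral_convergent
    (s := ((j + k : ℕ) : ℝ) + 1 / 2) (by positivity)).congr_fun (fun s hs => ?_) measurableSet_Ioi
  have hs : 0 < s := hs
  rw [← Real.rpow_natCast s k, mul_assoc, ← Real.rpow_add hs]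
  push_cast
  ring_nf

open Polynomial in
/-- The coefficient function is a rational polynomial of exact degree `3 * j`. -/
lemma exists_polynomial_coeffA (j : ℕ) : ∃ q : ℚ[X], q.degree = ((3 * j : ℕ) : WithBot ℕ) ∧
    ∀ t : ℝ, coeffA j t = aeval t q := by
  obtain ⟨Q, hdeg, hlead, hQ⟩ := exists_polynomial_recP (2 * j)
  -- `g m` is `Γ(m + 1/2) / √π`, a rational number, so the factor `1 / √π` in `coeffA` cancels. At
  -- `m = 0` the truncated subtraction gives `0‼ = 1`, the right value.
  set g : ℕ → ℚ := fun m => ((2 * m - 1)‼ : ℚ) / 2 ^ m with hg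
  have hgpos : ∀ m, 0 < g m := fun m => by
    have : 0 < (2 * m - 1)‼ := Nat.doubleFactorial_pos _
    simp only [hg]
    positivity
  have hgG : ∀ m : ℕ, Real.Gamma ((m : ℝ) + 1 / 2) = √Real.pi * (g m : ℝ) := fun m => by
    rw [Real.Gamma_nat_add_half]
    simp [hg]
    ring
  set R : ℚ[X] := ∑ k ∈ Finset.range (2 * j + 1), C (Q.coeff k * g (j + k)) * X ^ k with hR
  have hRc : R.coeff (2 * j) = Q.coeff (2 * j) * g (j + 2 * j) := by
    rw [hR, finsetSum_coeff]
    simp only [coeff_C_mul, coeff_X_pow]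
    simp
  have hRdeg : R.natDegree = 2 * j := by
    refine le_antisymm ?_ (le_natDegree_of_ne_zero ?_)
    · refine natDegree_sum_le_of_forall_le _ _ fun k hk => ?_
      refine (natDegree_C_mul_X_pow_le _ _).trans ?_
      have := Finset.mem_range.1 hk
      omega
    · rw [hRc]
      exact mul_ne_zero hlead (hgpos _).ne'
  have hR0 : R ≠ 0 := by
    intro h
    rw [h, coeff_zero] at hRc
    exact mul_ne_zero hlead (hgpos _).ne' hRc.symm
  -- Everything depends on `1 + t`: the factor `(1 + t) ^ j` and the integrated polynomial, of
  -- degree `2 j` in `1 + t`, give degree `3 j` after the shift.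
  refine ⟨(C ((-1) ^ j / 2 ^ j) * (X ^ j * R)).comp (X + C 1), ?_, fun t => ?_⟩
  · rw [degree_eq_natDegree, natDegree_comp, natDegree_X_add_C, mul_one, natDegree_C_mul,
      natDegree_mul (by simp) hR0, natDegree_X_pow, hRdeg]
    · congr 1; ring
    · exact div_ne_zero (pow_ne_zero _ (by norm_num)) (by positivity)
    · rw [Ne, comp_eq_zero_iff, not_or]
      refine ⟨mul_ne_zero ?_ (mul_ne_zero (by simp) hR0), ?_⟩
      · exact C_ne_zero.2 (div_ne_zero (pow_ne_zero _ (by norm_num)) (by positivity))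
      · intro h
        have := congrArg natDegree h.2
        rw [natDegree_X_add_C, natDegree_C] at this
        omega
  · have hev : ∀ s : ℝ, recP (2 * j) ((1 + t) * s) =
        ∑ k ∈ Finset.range (2 * j + 1), (Q.coeff k : ℝ) * (1 + t) ^ k * s ^ k := fun s => by
      rw [hQ, aeval_eq_sum_range' (n := 2 * j + 1) (by omega)]
      refine Finset.sum_congr rfl fun k _ => ?_
      rw [Algebra.smul_def, mul_pow]
      simp [mul_assoc]
    rw [coeffA]
    simp_rw [hev, Finset.mul_sum]
    rw [integral_finsetSum]
    · have : ∀ k : ℕ, ∫ s in Set.Ioi (0 : ℝ), Real.exp (-s) * s ^ ((j : ℝ) - 1 / 2) *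
          ((Q.coeff k : ℝ) * (1 + t) ^ k * s ^ k) =
          (Q.coeff k : ℝ) * (1 + t) ^ k * (√Real.pi * g (j + k)) := fun k => by
        rw [← hgG, ← integral_exp_mul_rpow, ← integral_const_mul]
        congr 1; ext s; ring
      simp_rw [this]
      have hpi : √Real.pi ≠ 0 := (Real.sqrt_pos.2 Real.pi_pos).ne'
      rw [aeval_comp]
      simp only [map_mul, map_pow, map_sum, aeval_C, aeval_X, map_add, hR, Finset.mul_sum]
      refine Finset.sum_congr rfl fun k _ => ?_
      simp only [div_pow, map_div₀, map_pow, map_neg, map_one, map_ofNat, eq_ratCast]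
      field_simp
      ring
    · intro k _
      have := (integrableOn_exp_mul_rpow j k).const_mul ((Q.coeff k : ℝ) * (1 + t) ^ k)
      refine this.congr (ae_of_all _ fun s => ?_)
      simp only
      ring

/-! ### Primitives on star-shaped domains and integrals along paths. -/

/-- A holomorphic function on an open star-shaped set has a primitive. -/
lemma exists_primitive_of_starConvex {S : Set ℂ} {a : ℂ} {F : ℂ → ℂ} (hS : IsOpen S)
    (hstar : StarConvex ℝ a S) (hF : DifferentiableOn ℂ F S) :
    ∃ G : ℂ → ℂ, ∀ z ∈ S, HasDerivAt G (F z) z := by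
  refine ⟨fun z => (z - a) * ∫ t in (0 : ℝ)..1, F (a + t * (z - a)), fun z₀ hz₀ => ?_⟩
  have hmem : ∀ t ∈ Set.Icc (0 : ℝ) 1, a + (t : ℂ) * (z₀ - a) ∈ S := fun t ht => by
    have := hstar.add_smul_sub_mem hz₀ ht.1 ht.2
    simpa using this
  have hF' : ContinuousOn (deriv F) S := (hF.deriv hS).continuousOn
  have hdF : ∀ z ∈ S, HasDerivAt F (deriv F z) z := fun z hz =>
    (hF.differentiableAt (hS.mem_nhds hz)).hasDerivAt
  set K : Set ℂ := (fun t : ℝ => a + (t : ℂ) * (z₀ - a)) '' Set.Icc 0 1 with hK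
  have hKc : IsCompact K := isCompact_Icc.image (by fun_prop)
  have hKS : K ⊆ S := by
    rintro _ ⟨t, ht, rfl⟩
    exact hmem t ht
  -- A closed neighbourhood of the whole segment stays in `S`. The bound on `deriv F` there
  -- dominates the derivative under the integral sign for all end points near `z₀`.
  obtain ⟨ε, hε, hεS⟩ := hKc.exists_cthickening_subset_open hS hKS
  obtain ⟨B, hB⟩ := hKc.cthickening.exists_bound_of_continuousOn (hF'.mono hεS)
  have hnear : ∀ z ∈ Metric.ball z₀ ε, ∀ t ∈ Set.Icc (0 : ℝ) 1,
      a + (t : ℂ) * (z - a) ∈ Metric.cthickening ε K := by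
    intro z hz t ht
    refine Metric.mem_cthickening_of_dist_le _ (a + (t : ℂ) * (z₀ - a)) _ _ ⟨t, ht, rfl⟩ ?_
    rw [dist_eq_norm, show a + (t : ℂ) * (z - a) - (a + t * (z₀ - a)) = t * (z - z₀) by ring,
      norm_mul, Complex.norm_real, Real.norm_of_nonneg ht.1]
    have := mem_ball_iff_norm.1 hz
    nlinarith [ht.2, norm_nonneg (z - z₀), ht.1]
  have hIoc : Set.uIoc (0 : ℝ) 1 ⊆ Set.Icc 0 1 := by
    rw [Set.uIoc_of_le zero_le_one]; exact Set.Ioc_subset_Icc_self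
  have hcont : ∀ z ∈ Metric.ball z₀ ε,
      ContinuousOn (fun t : ℝ => F (a + t * (z - a))) (Set.Icc 0 1) := fun z hz =>
    hF.continuousOn.comp (by fun_prop) fun t ht => hεS (hnear z hz t ht)
  have hz₀b : z₀ ∈ Metric.ball z₀ ε := Metric.mem_ball_self hε
  have hcont' : ContinuousOn (fun t : ℝ => (t : ℂ) * deriv F (a + t * (z₀ - a)))
      (Set.Icc 0 1) :=
    (by fun_prop : ContinuousOn (fun t : ℝ => (t : ℂ)) _).mul
      (hF'.comp (by fun_prop) hmem)
  have hint : IntervalIntegrable (fun t : ℝ => F (a + t * (z₀ - a))) volume 0 1 :=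
    (hcont z₀ hz₀b).intervalIntegrable_of_Icc zero_le_one
  have hint' : IntervalIntegrable (fun t : ℝ => (t : ℂ) * deriv F (a + t * (z₀ - a))) volume 0 1 :=
    hcont'.intervalIntegrable_of_Icc zero_le_one
  have hD : HasDerivAt (fun z => ∫ t in (0 : ℝ)..1, F (a + t * (z - a)))
      (∫ t in (0 : ℝ)..1, (t : ℂ) * deriv F (a + t * (z₀ - a))) z₀ := by
    refine (intervalIntegral.hasDerivAt_integral_of_dominated_loc_of_deriv_le
      (F' := fun z (t : ℝ) => (t : ℂ) * deriv F (a + t * (z - a)))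
      (bound := fun _ => B) (Metric.ball_mem_nhds z₀ hε) ?_ hint ?_ ?_ ?_ ?_).2
    · filter_upwards [Metric.ball_mem_nhds z₀ hε] with z hz
      exact ((hcont z hz).mono hIoc).aestronglyMeasurable measurableSet_uIoc
    · exact (hcont'.mono hIoc).aestronglyMeasurable measurableSet_uIoc
    · refine ae_of_all _ fun t ht z hz => ?_
      have ht := hIoc ht
      rw [norm_mul, Complex.norm_real, Real.norm_of_nonneg ht.1]
      have := hB _ (hnear z hz t ht)
      nlinarith [norm_nonneg (deriv F (a + t * (z - a))), ht.1, ht.2]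
    · exact intervalIntegrable_const
    · refine ae_of_all _ fun t ht z hz => ?_
      have h1 := hdF _ (hεS (hnear z hz t (hIoc ht)))
      have h2 : HasDerivAt (fun z : ℂ => a + (t : ℂ) * (z - a)) t z := by
        simpa using (((hasDerivAt_id z).sub_const a).const_mul (t : ℂ)).const_add a
      simpa [mul_comm, Function.comp_def] using h1.comp z h2
  -- The integrand, which the product rule produces when the candidate primitive is differentiated,
  -- is the derivative of `t * F (a + t * (z₀ - a))` in `t`.
  have hFTC : ∫ t in (0 : ℝ)..1, (F (a + t * (z₀ - a)) +
      (z₀ - a) * ((t : ℂ) * deriv F (a + t * (z₀ - a)))) = F z₀ := by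
    have h := intervalIntegral.integral_eq_sub_of_hasDerivAt (a := (0 : ℝ)) (b := 1)
      (f := fun t : ℝ => (t : ℂ) * F (a + t * (z₀ - a)))
      (f' := fun t : ℝ => F (a + t * (z₀ - a)) +
        (z₀ - a) * ((t : ℂ) * deriv F (a + t * (z₀ - a)))) (fun t ht => ?_)
      (hint.add (hint'.const_mul _))
    · rw [h]; simp
    · rw [Set.uIcc_of_le zero_le_one] at ht
      have h1 := hdF _ (hmem t ht)
      have h2 : HasDerivAt (fun t : ℝ => a + (t : ℂ) * (z₀ - a)) (z₀ - a) t := by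
        simpa using ((Complex.ofRealCLM.hasDerivAt (x := t)).mul_const (z₀ - a)).const_add a
      have h3 := (Complex.ofRealCLM.hasDerivAt (x := t)).mul (h1.comp t h2)
      refine h3.congr_deriv ?_
      simp
      ring
  have := ((hasDerivAt_id z₀).sub_const a).mul hD
  refine this.congr_deriv ?_
  rw [← hFTC, intervalIntegral.integral_add hint (hint'.const_mul _),
    intervalIntegral.integral_const_mul]
  simp

/-- The fundamental theorem of calculus along a path that is differentiable off a countable set. -/
lemma integral_pathIntegrand {F G : ℂ → ℂ} {γ γ' : ℝ → ℂ} {s : Set ℝ} {p q : ℝ}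
    (hs : s.Countable) (hγ : ContinuousOn γ (Set.uIcc p q))
    (hγ' : ∀ t ∈ Set.Ioo (min p q) (max p q) \ s, HasDerivAt γ (γ' t) t)
    (hG : ∀ t ∈ Set.uIcc p q, HasDerivAt G (F (γ t)) (γ t))
    (hint : IntervalIntegrable (fun t => F (γ t) * γ' t) volume p q) :
    ∫ t in p..q, F (γ t) * γ' t = G (γ q) - G (γ p) := by
  refine integral_eq_of_hasDerivAt_off_countable (fun t => G (γ t)) _ hs ?_ ?_ hint
  · intro t ht
    exact (hG t ht).continuousAt.comp_continuousWithinAt (hγ t ht)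
  · intro t ht
    exact (hG t (Set.Ioo_subset_Icc_self ht.1)).comp t (hγ' t ht)

/-- If `G₂` is a primitive of `F` on the right half and `G₁` one on the left half of a circle, the
integral of `F` over the circle is the difference of the jumps of `G₂ - G₁`. -/
lemma circleIntegral_eq_of_primitives {F G₁ G₂ : ℂ → ℂ} {c : ℂ} {ρ : ℝ} (hρ : 0 ≤ ρ)
    (hF : ContinuousOn F (Metric.sphere c ρ))
    (hG₂ : ∀ z ∈ Metric.sphere c ρ, c.re ≤ z.re → HasDerivAt G₂ (F z) z)
    (hG₁ : ∀ z ∈ Metric.sphere c ρ, z.re ≤ c.re → HasDerivAt G₁ (F z) z) :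
    (∮ z in C(c, ρ), F z) = (G₂ (c + ρ * Complex.I) - G₁ (c + ρ * Complex.I)) -
      (G₂ (c - ρ * Complex.I) - G₁ (c - ρ * Complex.I)) := by
  have hpi := Real.pi_pos
  set γ := circleMap c ρ with hγ
  set γ' : ℝ → ℂ := fun t => circleMap 0 ρ t * Complex.I with hγ'
  have hmem : ∀ t, γ t ∈ Metric.sphere c ρ := fun t => circleMap_mem_sphere c hρ t
  have hcont : Continuous (fun t => F (γ t) * γ' t) := by
    refine Continuous.mul ?_ (by fun_prop)
    exact hF.comp_continuous (continuous_circleMap c ρ) hmem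
  have hre : ∀ t, (γ t).re = c.re + ρ * Real.cos t := fun t => by
    simp [hγ, circleMap, Complex.exp_ofReal_mul_I_re]
  have key : ∀ (G : ℂ → ℂ) (p q : ℝ), (∀ t ∈ Set.uIcc p q, HasDerivAt G (F (γ t)) (γ t)) →
      ∫ t in p..q, F (γ t) * γ' t = G (γ q) - G (γ p) := fun G p q h =>
    integral_pathIntegrand (s := ∅) Set.countable_empty (continuous_circleMap c ρ).continuousOn
      (fun t _ => hasDerivAt_circleMap c ρ t) h (hcont.intervalIntegrable _ _)
  have h1 := key G₂ 0 (Real.pi / 2) fun t ht => hG₂ _ (hmem t) <| by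
    rw [Set.uIcc_of_le (by positivity)] at ht
    have := Real.cos_nonneg_of_mem_Icc (x := t) ⟨by linarith [ht.1], ht.2⟩
    rw [hre]; nlinarith
  have h2 := key G₁ (Real.pi / 2) (3 * Real.pi / 2) fun t ht => hG₁ _ (hmem t) <| by
    rw [Set.uIcc_of_le (by linarith)] at ht
    have := Real.cos_nonpos_of_pi_div_two_le_of_le (x := t) ht.1 (by linarith [ht.2])
    rw [hre]; nlinarith
  have h3 := key G₂ (3 * Real.pi / 2) (2 * Real.pi) fun t ht => hG₂ _ (hmem t) <| by
    rw [Set.uIcc_of_le (by linarith)] at ht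
    have := Real.cos_nonneg_of_mem_Icc (x := t - 2 * Real.pi)
      ⟨by linarith [ht.1], by linarith [ht.2]⟩
    rw [Real.cos_sub_two_pi] at this
    rw [hre]; nlinarith
  have e0 : γ (2 * Real.pi) = γ 0 := by simp [hγ, circleMap]
  have e1 : γ (Real.pi / 2) = c + ρ * Complex.I := by
    simp [hγ, circleMap, Complex.exp_pi_div_two_mul_I]
  have e2 : γ (3 * Real.pi / 2) = c - ρ * Complex.I := by
    have : Complex.exp (3 * Real.pi / 2 * Complex.I) = -Complex.I := by
      rw [show (3 * Real.pi / 2 * Complex.I : ℂ) = Real.pi * Complex.I + Real.pi / 2 * Complex.I by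
        ring, Complex.exp_add, Complex.exp_pi_mul_I, Complex.exp_pi_div_two_mul_I]
      ring
    simp [hγ, circleMap, this]
    ring
  rw [circleIntegral]
  simp only [smul_eq_mul, deriv_circleMap]
  have : ∀ t, circleMap 0 ρ t * Complex.I * F (circleMap c ρ t) = F (γ t) * γ' t := fun t => by
    simp only [hγ, hγ']; ring
  simp_rw [this]
  rw [← intervalIntegral.integral_add_adjacent_intervals (hcont.intervalIntegrable 0 (Real.pi / 2))
    (hcont.intervalIntegrable _ _), ← intervalIntegral.integral_add_adjacent_intervals
    (hcont.intervalIntegrable (Real.pi / 2) (3 * Real.pi / 2)) (hcont.intervalIntegrable _ _),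
    h1, h2, h3, e0, e1, e2]
  ring

/-! ### Saddle points -/

lemma tMinus_pos (β : ℝ) : 0 < tMinus β := by unfold tMinus; positivity
lemma tPlus_pos (β : ℝ) : 0 < tPlus β := by unfold tPlus; positivity

lemma tMinus_mul_tPlus (β : ℝ) : tMinus β * tPlus β = 1 / 4 := by
  have : Real.exp (-β) * Real.exp β = 1 := by rw [← Real.exp_add]; simp
  unfold tMinus tPlus
  linear_combination this / 4

lemma tMinus_add_tPlus (β : ℝ) : tMinus β + tPlus β = Real.cosh β := by
  rw [Real.cosh_eq]; unfold tMinus tPlus; ring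

lemma tMinus_lt_tPlus {β : ℝ} (hβ : 0 < β) : tMinus β < tPlus β := by
  have : Real.exp (-β) < Real.exp β := Real.exp_lt_exp.2 (by linarith)
  unfold tMinus tPlus; linarith

lemma tMinus_lt_half {β : ℝ} (hβ : 0 < β) : tMinus β < 1 / 2 := by
  have : Real.exp (-β) < 1 := Real.exp_lt_one_iff.2 (by linarith)
  unfold tMinus; linarith

lemma half_lt_tPlus {β : ℝ} (hβ : 0 < β) : 1 / 2 < tPlus β := by
  have : 1 < Real.exp β := Real.one_lt_exp_iff.2 hβ
  unfold tPlus; linarith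

/-- The derivative is `2 z - 2 cosh β + 1 / (2 z)`, and `t₋`, `t₊` have sum `cosh β` and product
`1/4`. -/
lemma hasDerivAt_phase (β : ℝ) {z : ℂ} (hz : z ∈ Complex.slitPlane) :
    HasDerivAt (phase β) (2 * (z - tMinus β) * (z - tPlus β) / z) z := by
  have hz0 : z ≠ 0 := Complex.slitPlane_ne_zero hz
  have h := (((hasDerivAt_id z).pow 2).sub
    (((hasDerivAt_id z).const_mul 2).mul_const (Real.cosh β : ℂ))).add
    ((Complex.hasDerivAt_log hz).div_const 2)
  refine h.congr_deriv ?_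
  have h1 : (tMinus β : ℂ) * tPlus β = 1 / 4 := by
    rw [← Complex.ofReal_mul, tMinus_mul_tPlus]; norm_num
  have h2 : (tMinus β : ℂ) + tPlus β = Real.cosh β := by
    rw [← Complex.ofReal_add, tMinus_add_tPlus]
  rw [← h2]
  simp only [id]
  field_simp
  linear_combination -4 * h1

lemma differentiableOn_phase (β : ℝ) : DifferentiableOn ℂ (phase β) Complex.slitPlane :=
  fun _ hz => (hasDerivAt_phase β hz).differentiableAt.differentiableWithinAt

lemma phase_ofReal (β : ℝ) {t : ℝ} (ht : 0 ≤ t) : phase β (t : ℂ) = (phaseReal β t : ℂ) := by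
  simp [phase, phaseReal, Complex.ofReal_log ht]

lemma hasDerivAt_phaseReal (β : ℝ) {t : ℝ} (ht : 0 < t) :
    HasDerivAt (phaseReal β) (2 * (t - tMinus β) * (t - tPlus β) / t) t := by
  have h := (((hasDerivAt_id t).pow 2).sub
    (((hasDerivAt_id t).const_mul 2).mul_const (Real.cosh β))).add
    ((Real.hasDerivAt_log ht.ne').div_const 2)
  refine h.congr_deriv ?_
  rw [← tMinus_add_tPlus]
  simp only [id]
  field_simp
  linear_combination -4 * tMinus_mul_tPlus β

lemma continuousOn_phaseReal (β : ℝ) : ContinuousOn (phaseReal β) (Set.Ioi 0) :=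
  fun _ ht => (hasDerivAt_phaseReal β ht).continuousAt.continuousWithinAt

/-- On the positive axis the derivative has the sign of `(t - t₋) (t - t₊)`. This comparison and the
next two show that the points with `f(t) ≥ f(t₋)` are `t₋` and a ray beyond `t₊`. -/
lemma phaseReal_lt_of_lt_tMinus {β t : ℝ} (hβ : 0 < β) (ht : 0 < t) (h : t < tMinus β) :
    phaseReal β t < phaseReal β (tMinus β) := by
  have hm : StrictMonoOn (phaseReal β) (Set.Icc t (tMinus β)) := by
    refine strictMonoOn_of_deriv_pos (convex_Icc _ _)
      ((continuousOn_phaseReal β).mono fun x hx => ht.trans_le hx.1) fun x hx => ?_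
    rw [interior_Icc] at hx
    have hx0 : 0 < x := ht.trans hx.1
    rw [(hasDerivAt_phaseReal β hx0).deriv]
    have := tMinus_lt_tPlus hβ
    have h1 : x - tMinus β < 0 := by linarith [hx.2]
    have h2 : x - tPlus β < 0 := by linarith [hx.2]
    have := mul_pos_of_neg_of_neg h1 h2
    exact div_pos (by linarith) hx0
  exact hm ⟨le_rfl, h.le⟩ ⟨h.le, le_rfl⟩ h

lemma phaseReal_lt_of_mem_Ioc {β t : ℝ} (h : tMinus β < t) (h' : t ≤ tPlus β) :
    phaseReal β t < phaseReal β (tMinus β) := by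
  have hc := tMinus_pos β
  have hm : StrictAntiOn (phaseReal β) (Set.Icc (tMinus β) (tPlus β)) := by
    refine strictAntiOn_of_deriv_neg (convex_Icc _ _)
      ((continuousOn_phaseReal β).mono fun x hx => hc.trans_le hx.1) fun x hx => ?_
    rw [interior_Icc] at hx
    have hx0 : 0 < x := hc.trans hx.1
    rw [(hasDerivAt_phaseReal β hx0).deriv]
    have h1 : 0 < x - tMinus β := by linarith [hx.1]
    have h2 : x - tPlus β < 0 := by linarith [hx.2]
    have := mul_neg_of_pos_of_neg h1 h2
    exact div_neg_of_neg_of_pos (by linarith) hx0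
  exact hm ⟨le_rfl, h.le.trans h'⟩ ⟨h.le, h'⟩ h

lemma phaseReal_le_of_tPlus_le {β s t : ℝ} (hβ : 0 < β) (hs : tPlus β ≤ s) (h : s ≤ t) :
    phaseReal β s ≤ phaseReal β t := by
  have hc := tPlus_pos β
  have hm : MonotoneOn (phaseReal β) (Set.Ici (tPlus β)) := by
    refine monotoneOn_of_deriv_nonneg (convex_Ici _)
      ((continuousOn_phaseReal β).mono fun x hx => hc.trans_le hx)
      (fun x hx => ?_) fun x hx => ?_
    all_goals
      rw [interior_Ici] at hx
      have hx : tPlus β < x := hx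
      have hx0 : 0 < x := hc.trans hx
    · exact (hasDerivAt_phaseReal β hx0).differentiableAt.differentiableWithinAt
    · rw [(hasDerivAt_phaseReal β hx0).deriv]
      have := tMinus_lt_tPlus hβ
      have h1 : 0 < x - tMinus β := by linarith
      have h2 : 0 < x - tPlus β := by linarith
      positivity
  exact hm hs (hs.trans h) h

/-! ### The quotient `(f(t₋) - f(z)) / (z - t₋)²` -/

/-- The holomorphic extension of `(f(t₋) - f(z)) / (z - t₋)²` to `t₋`. -/
def phaseQuot (β : ℝ) (z : ℂ) : ℂ :=
  -dslope (dslope (phase β) (tMinus β : ℂ)) (tMinus β : ℂ) z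

lemma ofReal_mem_slitPlane {t : ℝ} (ht : 0 < t) : (t : ℂ) ∈ Complex.slitPlane :=
  Or.inl (by simpa using ht)

lemma tMinus_mem_slitPlane (β : ℝ) : (tMinus β : ℂ) ∈ Complex.slitPlane :=
  ofReal_mem_slitPlane (tMinus_pos β)

lemma slitPlane_mem_nhds_tMinus (β : ℝ) : Complex.slitPlane ∈ 𝓝 (tMinus β : ℂ) :=
  Complex.isOpen_slitPlane.mem_nhds (tMinus_mem_slitPlane β)

lemma differentiableOn_phaseQuot (β : ℝ) :
    DifferentiableOn ℂ (phaseQuot β) Complex.slitPlane := by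
  have hc := slitPlane_mem_nhds_tMinus β
  exact ((Complex.differentiableOn_dslope hc).2
    ((Complex.differentiableOn_dslope hc).2 (differentiableOn_phase β))).neg

/-- The first slope vanishes at `t₋` because `t₋` is a critical point, so both divisions are exact.
The identity is algebraic and needs no condition on `z`. -/
lemma phaseQuot_mul (β : ℝ) (z : ℂ) :
    (z - tMinus β) ^ 2 * phaseQuot β z = phase β (tMinus β : ℂ) - phase β z := by
  have h1 := sub_smul_dslope (phase β) (tMinus β : ℂ) z
  have h2 := sub_smul_dslope (dslope (phase β) (tMinus β : ℂ)) (tMinus β : ℂ) z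
  have h3 : dslope (phase β) (tMinus β : ℂ) (tMinus β : ℂ) = 0 := by
    rw [dslope_same, (hasDerivAt_phase β (tMinus_mem_slitPlane β)).deriv]
    simp
  rw [h3, sub_zero] at h2
  simp only [smul_eq_mul] at h1 h2
  rw [phaseQuot]
  linear_combination -h1 - (z - tMinus β) * h2

/-- Differentiating `(z - t₋)² q(z) = f(t₋) - f(z)` away from `t₋`, dividing by `z - t₋` and letting
`z` tend to `t₋` gives `-2 q(t₋) = 2 (t₋ - t₊) / t₋`. No second derivative of `f` has to be
computed. -/
lemma phaseQuot_tMinus (β : ℝ) :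
    phaseQuot β (tMinus β : ℂ) = ((Real.exp (2 * β) - 1 : ℝ) : ℂ) := by
  set c : ℂ := (tMinus β : ℂ) with hc
  have hq := differentiableOn_phaseQuot β
  have hqa := hq.analyticOnNhd Complex.isOpen_slitPlane
  have hcs := tMinus_mem_slitPlane β
  have hev : ∀ᶠ z in 𝓝[≠] c, -2 * phaseQuot β z - (z - c) * deriv (phaseQuot β) z =
      2 * (z - tPlus β) / z := by
    filter_upwards [self_mem_nhdsWithin,
      mem_nhdsWithin_of_mem_nhds (slitPlane_mem_nhds_tMinus β)] with z hz hzs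
    have hne : z - c ≠ 0 := sub_ne_zero.2 hz
    have hd1 : HasDerivAt (fun z => (z - c) ^ 2 * phaseQuot β z)
        (2 * (z - c) * phaseQuot β z + (z - c) ^ 2 * deriv (phaseQuot β) z) z := by
      have := (((hasDerivAt_id z).sub_const c).pow 2).mul
        (hqa z hzs).differentiableAt.hasDerivAt
      refine this.congr_deriv ?_
      simp
    have hd2 := (hasDerivAt_phase β hzs).const_sub (phase β c)
    have he : (fun z => (z - c) ^ 2 * phaseQuot β z) = fun z => phase β c - phase β z :=
      funext fun z => phaseQuot_mul β z
    rw [he] at hd1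
    have := hd1.unique hd2
    have hz0 := Complex.slitPlane_ne_zero hzs
    field_simp at this ⊢
    refine mul_left_cancel₀ hne ?_
    linear_combination -this
  have hcont1 : Tendsto (fun z => -2 * phaseQuot β z - (z - c) * deriv (phaseQuot β) z) (𝓝[≠] c)
      (𝓝 (-2 * phaseQuot β c - (c - c) * deriv (phaseQuot β) c)) := by
    have h1 : ContinuousAt (phaseQuot β) c := (hqa c hcs).continuousAt
    have h2 : ContinuousAt (deriv (phaseQuot β)) c := (hqa c hcs).deriv.continuousAt
    have : ContinuousAt (fun z => -2 * phaseQuot β z - (z - c) * deriv (phaseQuot β) z) c := by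
      fun_prop
    exact this.tendsto.mono_left nhdsWithin_le_nhds
  have hc0 : c ≠ 0 := Complex.slitPlane_ne_zero hcs
  have hcont2 : Tendsto (fun z : ℂ => 2 * (z - tPlus β) / z) (𝓝[≠] c)
      (𝓝 (2 * (c - tPlus β) / c)) := by
    have : ContinuousAt (fun z : ℂ => 2 * (z - tPlus β) / z) c := by fun_prop (disch := assumption)
    exact this.tendsto.mono_left nhdsWithin_le_nhds
  have h := tendsto_nhds_unique (hcont1.congr' hev) hcont2
  have h4 : (tPlus β : ℂ) = Real.exp (2 * β) * c := by
    rw [hc, ← Complex.ofReal_mul]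
    congr 1
    unfold tPlus tMinus
    rw [mul_div_assoc', ← Real.exp_add]
    ring_nf
  rw [h4] at h
  field_simp at h
  push_cast at h ⊢
  linear_combination (-1 / 2) * h

/-- Put `ζ = z - t₋`. Along the segment `t₋ + t ζ` the derivative of `f / ζ²` is `2 t (1 - t₊ / (t₋
+ t ζ))`, whose imaginary part has the sign of `Im z`. Integrating from `t = 0` gives `-q(z)` an
imaginary part of that sign. Hence `q` takes no real values off the real axis. -/
lemma im_mul_im_phaseQuot_neg (β : ℝ) {z : ℂ} (hz : z.im ≠ 0) :
    z.im * (phaseQuot β z).im < 0 := by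
  set c : ℝ := tMinus β with hc
  have hcpos : 0 < c := tMinus_pos β
  set ζ : ℂ := z - c with hζ
  have hζim : ζ.im = z.im := by simp [hζ]
  have hζ0 : ζ ≠ 0 := fun h => hz (by rw [← hζim, h, Complex.zero_im])
  have hmem : ∀ t ∈ Set.Icc (0 : ℝ) 1, (c : ℂ) + t * ζ ∈ Complex.slitPlane := fun t ht => by
    rcases ht.1.eq_or_lt with h | h
    · rw [← h]; simpa using tMinus_mem_slitPlane β
    · refine Or.inr ?_
      simpa [hζim] using ⟨h.ne', hz⟩
  set k : ℝ → ℝ := fun t => z.im * ((phase β (c + t * ζ) - phase β c) / ζ ^ 2).im with hk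
  have hkd : ∀ t ∈ Set.Icc (0 : ℝ) 1, HasDerivAt k
      (2 * t ^ 2 * tPlus β * z.im ^ 2 / Complex.normSq (c + t * ζ)) t := fun t ht => by
    have hp := hasDerivAt_phase β (hmem t ht)
    have h2 : HasDerivAt (fun t : ℝ => (c : ℂ) + (t : ℂ) * ζ) ζ t := by
      simpa using ((Complex.ofRealCLM.hasDerivAt (x := t)).mul_const ζ).const_add (c : ℂ)
    have h3 := ((hp.comp t h2).sub_const (phase β c)).div_const (ζ ^ 2)
    have h4 := (Complex.imCLM.hasFDerivAt.comp_hasDerivAt t h3).const_mul z.im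
    refine h4.congr_deriv ?_
    have hw0 : (c : ℂ) + t * ζ ≠ 0 := Complex.slitPlane_ne_zero (hmem t ht)
    have e : 2 * ((c : ℂ) + t * ζ - tMinus β) * (c + t * ζ - tPlus β) / (c + t * ζ) * ζ / ζ ^ 2 =
        ((2 * t : ℝ) : ℂ) * (1 - (tPlus β : ℂ) * (c + t * ζ)⁻¹) := by
      rw [← hc]
      push_cast
      field_simp
      ring
    rw [e]
    simp only [Complex.imCLM_apply, Complex.im_ofReal_mul, Complex.sub_im, Complex.one_im,
      Complex.inv_im, Complex.add_im, Complex.ofReal_im, hζim]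
    ring
  have hmono : StrictMonoOn k (Set.Icc 0 1) := by
    refine strictMonoOn_of_deriv_pos (convex_Icc _ _)
      (fun t ht => (hkd t ht).continuousAt.continuousWithinAt) fun t ht => ?_
    rw [interior_Icc] at ht
    have ht' := Set.Ioo_subset_Icc_self ht
    rw [(hkd t ht').deriv]
    have := Complex.normSq_pos.2 (Complex.slitPlane_ne_zero (hmem t ht'))
    have := tPlus_pos β
    have := ht.1
    positivity
  have h := hmono (by simp) (by simp) zero_lt_one
  have e1 : phaseQuot β z = -((phase β (c + (1 : ℝ) * ζ) - phase β c) / ζ ^ 2) := by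
    have := phaseQuot_mul β z
    rw [show (c : ℂ) + (1 : ℝ) * ζ = z by simp [hζ], eq_neg_iff_add_eq_zero]
    field_simp
    rw [hζ]
    linear_combination this
  rw [e1, Complex.neg_im]
  have h0 : k 0 = 0 := by simp [hk]
  rw [h0] at h
  simp only [hk] at h
  linarith

lemma phaseQuot_ofReal {β t : ℝ} (ht : 0 < t) (htc : t ≠ tMinus β) :
    phaseQuot β (t : ℂ) =
      (((phaseReal β (tMinus β) - phaseReal β t) / (t - tMinus β) ^ 2 : ℝ) : ℂ) := by
  have := phaseQuot_mul β (t : ℂ)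
  rw [phase_ofReal β (tMinus_pos β).le, phase_ofReal β ht.le] at this
  have hne : (t : ℂ) - tMinus β ≠ 0 := by
    rw [← Complex.ofReal_sub]
    exact_mod_cast sub_ne_zero.2 htc
  push_cast
  field_simp
  linear_combination this

/-! ### The domain of the root -/

lemma mem_wDomain_of_im_ne_zero {β : ℝ} {z : ℂ} (hz : z.im ≠ 0) : z ∈ wDomain β :=
  ⟨Or.inr hz, fun h => hz h.1⟩

lemma ofReal_mem_wDomain {β t : ℝ} (ht : 0 < t) (h : t ≤ tPlus β) : (t : ℂ) ∈ wDomain β :=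
  ⟨ofReal_mem_slitPlane ht, fun h' => by
    have := h'.2.1
    rw [Complex.ofReal_re] at this
    linarith⟩

lemma tMinus_mem_wDomain {β : ℝ} (hβ : 0 < β) : (tMinus β : ℂ) ∈ wDomain β :=
  ofReal_mem_wDomain (tMinus_pos β) (tMinus_lt_tPlus hβ).le

/-- Off the real axis `q` is not real; on the positive axis `q` is positive exactly where `f(t) <
f(t₋)`, or at `t = t₋`. So the prescribed domain is where the principal square root of `q` is
holomorphic, and openness follows as well. -/
lemma wDomain_eq {β : ℝ} (hβ : 0 < β) :
    wDomain β = Complex.slitPlane ∩ phaseQuot β ⁻¹' Complex.slitPlane := by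
  ext z
  refine and_congr_right fun hz => ?_
  rw [Set.mem_preimage]
  by_cases him : z.im = 0
  · obtain ⟨t, rfl⟩ : ∃ t : ℝ, z = t := ⟨z.re, by apply Complex.ext <;> simp [him]⟩
    have ht : 0 < t := by simpa [Complex.mem_slitPlane_iff] using hz
    rcases eq_or_ne t (tMinus β) with rfl | htc
    · rw [phaseQuot_tMinus]
      have h1 : (1 : ℝ) < Real.exp (2 * β) := Real.one_lt_exp_iff.2 (by linarith)
      refine iff_of_true (fun h' => ?_) (ofReal_mem_slitPlane (by linarith))
      have := h'.2.1
      rw [Complex.ofReal_re] at this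
      linarith [tMinus_lt_tPlus hβ]
    · rw [phaseQuot_ofReal ht htc]
      have hsq : 0 < (t - tMinus β) ^ 2 := by
        have := sub_ne_zero.2 htc
        positivity
      constructor
      · intro h
        refine ofReal_mem_slitPlane (div_pos (sub_pos.2 ?_) hsq)
        rcases lt_or_gt_of_ne htc with h1 | h1
        · exact phaseReal_lt_of_lt_tMinus hβ ht h1
        · rcases le_or_gt t (tPlus β) with h2 | h2
          · exact phaseReal_lt_of_mem_Ioc h1 h2
          · by_contra h3
            exact h ⟨by simp, by simpa using h2, by simpa using h3⟩
      · intro h h'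
        have h2 := h'.2.2
        rw [Complex.ofReal_re] at h2
        have h3 : 0 < (phaseReal β (tMinus β) - phaseReal β t) / (t - tMinus β) ^ 2 := by
          simpa [Complex.mem_slitPlane_iff, ← Complex.ofReal_sub, ← Complex.ofReal_pow,
            ← Complex.ofReal_div] using h
        have := (div_pos_iff_of_pos_right hsq).1 h3
        linarith
  · refine iff_of_true (fun h => him h.1) (Or.inr fun h => ?_)
    have := im_mul_im_phaseQuot_neg β him
    rw [h] at this
    simp at this

lemma isOpen_wDomain {β : ℝ} (hβ : 0 < β) : IsOpen (wDomain β) := by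
  rw [wDomain_eq hβ]
  exact (differentiableOn_phaseQuot β).continuousOn.isOpen_inter_preimage
    Complex.isOpen_slitPlane Complex.isOpen_slitPlane

lemma phaseQuot_mem_slitPlane {β : ℝ} (hβ : 0 < β) {z : ℂ} (hz : z ∈ wDomain β) :
    phaseQuot β z ∈ Complex.slitPlane := by
  rw [wDomain_eq hβ] at hz
  exact hz.2

/-- A segment from a real point to a nonreal one meets the real axis only at its start. Between real
points it avoids the cut because `f` is nondecreasing beyond `t₊`: a cut point would force the
larger end point into the cut. -/
lemma starConvex_wDomain {β x : ℝ} (hβ : 0 < β) (hx : (x : ℂ) ∈ wDomain β) :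
    StarConvex ℝ (x : ℂ) (wDomain β) := by
  have hx0 : 0 < x := by simpa [Complex.mem_slitPlane_iff] using hx.1
  intro z hz a b ha hb hab
  have him : (a • (x : ℂ) + b • z).im = b * z.im := by simp
  have hre : (a • (x : ℂ) + b • z).re = a * x + b * z.re := by simp
  by_cases hb0 : b * z.im = 0
  · rcases mul_eq_zero.1 hb0 with h | h
    · have : a = 1 := by linarith
      rw [h, this]
      simpa using hx
    · obtain ⟨t, rfl⟩ : ∃ t : ℝ, z = t := ⟨z.re, by apply Complex.ext <;> simp [h]⟩
      have ht : 0 < t := by simpa [Complex.mem_slitPlane_iff] using hz.1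
      simp only [Complex.ofReal_re] at hre
      have hpos : 0 < a * x + b * t := by
        rcases ha.eq_or_lt with h1 | h1
        · have : b = 1 := by linarith
          rw [this, ← h1]; linarith
        · have := mul_pos h1 hx0
          have := mul_nonneg hb ht.le
          linarith
      refine ⟨Or.inl (by rw [hre]; exact hpos), fun h' => ?_⟩
      have h1 := h'.2.1
      have h2 := h'.2.2
      rw [hre] at h1 h2
      rcases le_total x t with hxt | hxt
      · have h3 : a * x + b * t ≤ t := by
          have : b = 1 - a := by linarith
          rw [this]; nlinarith
        have h4 := phaseReal_le_of_tPlus_le hβ h1.le h3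
        exact hz.2 ⟨by simp, by simpa using h1.trans_le h3, by simpa using h2.trans h4⟩
      · have h3 : a * x + b * t ≤ x := by
          have : a = 1 - b := by linarith
          rw [this]; nlinarith
        have h4 := phaseReal_le_of_tPlus_le hβ h1.le h3
        exact hx.2 ⟨by simp, by simpa using h1.trans_le h3, by simpa using h2.trans h4⟩
  · exact mem_wDomain_of_im_ne_zero (by rw [him]; exact hb0)

/-! ### The branch `w` -/

lemma re_sqrt_pos {z : ℂ} (hz : z ∈ Complex.slitPlane) : 0 < (Complex.sqrt z).re := by
  rw [Complex.sqrt, Complex.cpow_inv_two_re]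
  refine Real.sqrt_pos.2 ?_
  have h1 := Complex.abs_re_le_norm z
  have h2 := neg_abs_le z.re
  rcases Complex.mem_slitPlane_iff.1 hz with h | h
  · have := norm_nonneg z
    linarith
  · have := Complex.abs_re_lt_norm.2 h
    linarith

lemma sqrt_ofReal {a : ℝ} (h : 0 ≤ a) : Complex.sqrt (a : ℂ) = (√a : ℂ) := by
  apply Complex.ext
  · rw [Complex.re_sqrt_ofReal, Complex.ofReal_re]
  · rw [Complex.sqrt, Complex.cpow_inv_two_im_eq_sqrt (by simp)]
    simp [abs_of_nonneg h]

lemma sqrt_sq (z : ℂ) : Complex.sqrt z ^ 2 = z := by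
  rw [Complex.sqrt]
  exact_mod_cast Complex.cpow_nat_inv_pow z two_ne_zero

/-- The branch of `(f(z) - f(t₋)) ^ (1 / 2)` on `wDomain β`. -/
def phaseRoot (β : ℝ) (z : ℂ) : ℂ := -Complex.I * (z - tMinus β) * Complex.sqrt (phaseQuot β z)

lemma phaseRoot_sq (β : ℝ) (z : ℂ) : phaseRoot β z ^ 2 = phase β z - phase β (tMinus β : ℂ) := by
  have h := phaseQuot_mul β z
  rw [phaseRoot, mul_pow, mul_pow, sqrt_sq, neg_sq, Complex.I_sq]
  linear_combination -h

lemma differentiableOn_sqrt_phaseQuot {β : ℝ} (hβ : 0 < β) :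
    DifferentiableOn ℂ (fun z => Complex.sqrt (phaseQuot β z)) (wDomain β) :=
  Complex.differentiableOn_sqrt.comp
    ((differentiableOn_phaseQuot β).mono fun _ hz => hz.1)
    fun _ hz => phaseQuot_mem_slitPlane hβ hz

lemma differentiableOn_phaseRoot {β : ℝ} (hβ : 0 < β) :
    DifferentiableOn ℂ (phaseRoot β) (wDomain β) :=
  (by fun_prop : DifferentiableOn ℂ (fun z : ℂ => -Complex.I * (z - tMinus β)) (wDomain β)).mul
    (differentiableOn_sqrt_phaseQuot hβ)

lemma sqrt_phaseQuot_tMinus {β : ℝ} (hβ : 0 < β) :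
    Complex.sqrt (phaseQuot β (tMinus β : ℂ)) = (√(Real.exp (2 * β) - 1) : ℂ) := by
  have h1 : (1 : ℝ) < Real.exp (2 * β) := Real.one_lt_exp_iff.2 (by linarith)
  rw [phaseQuot_tMinus, sqrt_ofReal (by linarith)]

lemma isPhaseRoot_phaseRoot {β : ℝ} (hβ : 0 < β) : IsPhaseRoot β (phaseRoot β) := by
  refine ⟨differentiableOn_phaseRoot hβ, fun z _ => phaseRoot_sq β z, ?_⟩
  have hc := tMinus_mem_wDomain hβ
  have hd := ((differentiableOn_sqrt_phaseQuot hβ).differentiableAt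
    ((isOpen_wDomain hβ).mem_nhds hc)).hasDerivAt
  have := (((hasDerivAt_id (tMinus β : ℂ)).sub_const (tMinus β : ℂ)).const_mul (-Complex.I)).mul hd
  refine this.congr_deriv ?_
  simp only [id, sub_self, mul_one, mul_zero, zero_mul, add_zero]
  rw [sqrt_phaseQuot_tMinus hβ]

/-- Every admissible root agrees with `phaseRoot`. -/
lemma IsPhaseRoot.eqOn_phaseRoot {β : ℝ} (hβ : 0 < β) {w : ℂ → ℂ} (hw : IsPhaseRoot β w) :
    Set.EqOn w (phaseRoot β) (wDomain β) := by
  obtain ⟨hd, hsq, hder⟩ := hw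
  have hc := tMinus_mem_wDomain hβ
  have hnhds := (isOpen_wDomain hβ).mem_nhds hc
  have hwc : w (tMinus β : ℂ) = 0 := by
    have := hsq _ hc
    rw [sub_self] at this
    exact pow_eq_zero_iff two_ne_zero |>.1 this
  have hwz : ∀ z, (z - tMinus β) * dslope w (tMinus β : ℂ) z = w z := fun z => by
    have := sub_smul_dslope w (tMinus β : ℂ) z
    rwa [hwc, sub_zero, smul_eq_mul] at this
  have hcc : dslope w (tMinus β : ℂ) (tMinus β : ℂ) =
      -Complex.I * (√(Real.exp (2 * β) - 1) : ℂ) := by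
    rw [dslope_same, hder.deriv]
  -- Dividing by the simple zero at `t₋` makes the comparison possible: two continuous functions on
  -- a connected set have equal squares, one has no zero, and the prescribed derivative makes them
  -- agree at `t₋`.
  have key : Set.EqOn (dslope w (tMinus β : ℂ))
      (fun z => -Complex.I * Complex.sqrt (phaseQuot β z)) (wDomain β) := by
    refine IsPreconnected.eq_of_sq_eq ?_ ?_ ?_ ?_ ?_ hc ?_
    · exact ((starConvex_wDomain hβ hc).isPathConnected hc).isConnected.isPreconnected
    · exact ((Complex.differentiableOn_dslope hnhds).2 hd).continuousOn
    · exact (differentiableOn_sqrt_phaseQuot hβ).continuousOn.const_smul (-Complex.I)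
    · intro z hz
      simp only [Pi.pow_apply]
      rw [mul_pow, sqrt_sq, neg_sq, Complex.I_sq]
      rcases eq_or_ne z (tMinus β : ℂ) with rfl | hzc
      · rw [hcc, phaseQuot_tMinus, mul_pow, neg_sq, Complex.I_sq, ← Complex.ofReal_pow,
          Real.sq_sqrt]
        have h1 : (1 : ℝ) < Real.exp (2 * β) := Real.one_lt_exp_iff.2 (by linarith)
        linarith
      · have h1 := hsq z hz
        rw [← hwz z] at h1
        have h2 := phaseQuot_mul β z
        refine mul_left_cancel₀ (pow_ne_zero 2 (sub_ne_zero.2 hzc)) ?_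
        linear_combination h1 + h2
    · intro z hz
      refine mul_ne_zero (neg_ne_zero.2 Complex.I_ne_zero) fun h => ?_
      have := re_sqrt_pos (phaseQuot_mem_slitPlane hβ hz)
      rw [h] at this
      simp at this
    · rw [hcc, sqrt_phaseQuot_tMinus hβ]
  intro z hz
  rw [← hwz z, key hz, phaseRoot]
  ring

lemma phaseRoot_ne_zero {β : ℝ} (hβ : 0 < β) {z : ℂ} (hz : z ∈ wDomain β)
    (hzc : z ≠ tMinus β) : phaseRoot β z ≠ 0 := by
  refine mul_ne_zero (mul_ne_zero (neg_ne_zero.2 Complex.I_ne_zero) (sub_ne_zero.2 hzc)) fun h => ?_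
  have := re_sqrt_pos (phaseQuot_mem_slitPlane hβ hz)
  rw [h] at this
  simp at this

/-! ### Location of the values of the root -/

/-- `Im q = 2 Re √q Im √q` and `Re √q > 0`, so `Im √q` inherits the sign of `Im q`. -/
lemma im_mul_im_sqrt_phaseQuot_neg {β : ℝ} (hβ : 0 < β) {z : ℂ} (hz : z.im ≠ 0) :
    z.im * (Complex.sqrt (phaseQuot β z)).im < 0 := by
  have h1 := im_mul_im_phaseQuot_neg β hz
  have h2 := re_sqrt_pos (phaseQuot_mem_slitPlane hβ (mem_wDomain_of_im_ne_zero hz))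
  have h3 := congrArg Complex.im (sqrt_sq (phaseQuot β z))
  rw [pow_two, Complex.mul_im] at h3
  rw [← h3] at h1
  by_contra h4
  push Not at h4
  nlinarith [mul_nonneg h2.le h4]

/-- `-Im w = (Re z - t₋) Re √q - Im z Im √q`, where both contributions are nonnegative and one is
positive. This puts the image of `Γ₊` into the half plane where `gaussTransform` is a Cauchy
transform. -/
lemma im_phaseRoot_neg {β : ℝ} (hβ : 0 < β) {z : ℂ} (hz : z ∈ wDomain β)
    (hre : tMinus β ≤ z.re) (hzc : z ≠ tMinus β) : (phaseRoot β z).im < 0 := by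
  have h2 := re_sqrt_pos (phaseQuot_mem_slitPlane hβ hz)
  have e : (phaseRoot β z).im = -((z.re - tMinus β) * (Complex.sqrt (phaseQuot β z)).re -
      z.im * (Complex.sqrt (phaseQuot β z)).im) := by
    simp [phaseRoot, Complex.mul_re, Complex.mul_im]
    ring
  rw [e, neg_lt_zero]
  rcases eq_or_ne z.im 0 with him | him
  · have : tMinus β ≠ z.re := fun h => hzc (by apply Complex.ext <;> simp [h, him])
    have : 0 < z.re - tMinus β := sub_pos.2 (lt_of_le_of_ne hre this)
    rw [him]
    nlinarith [mul_pos this h2]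
  · have := im_mul_im_sqrt_phaseQuot_neg hβ him
    have := mul_nonneg (sub_nonneg.2 hre) h2.le
    linarith

/-- The counterpart on the left of `t₋`: after multiplication by `Im z` the two contributions to `Re
w` are nonnegative, and the one with `(Im z)²` is positive. -/
lemma im_mul_re_phaseRoot_pos {β : ℝ} (hβ : 0 < β) {z : ℂ} (hz : z.im ≠ 0)
    (hre : z.re ≤ tMinus β) : 0 < z.im * (phaseRoot β z).re := by
  have h2 := re_sqrt_pos (phaseQuot_mem_slitPlane hβ (mem_wDomain_of_im_ne_zero hz))
  have h3 := im_mul_im_sqrt_phaseQuot_neg hβ hz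
  have e : z.im * (phaseRoot β z).re =
      (z.re - tMinus β) * (z.im * (Complex.sqrt (phaseQuot β z)).im) +
      z.im ^ 2 * (Complex.sqrt (phaseQuot β z)).re := by
    simp [phaseRoot, Complex.mul_re, Complex.mul_im]
    ring
  have : 0 < z.im ^ 2 := by positivity
  rw [e]
  nlinarith [mul_nonneg_of_nonpos_of_nonpos (sub_nonpos.2 hre) h3.le, mul_pos this h2]

/-- From `Im w² = 2 Re w Im w` and the known sign of `Re w`, the sign of `Im w` can be read off from
`w²`, which is explicit. This is how the keyhole is seen to map into the upper half plane. -/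
lemma im_phaseRoot_pos {β : ℝ} (hβ : 0 < β) {z : ℂ} (hz : z.im ≠ 0) (hre : z.re ≤ tMinus β)
    (him : 0 < z.im * (phaseRoot β z ^ 2).im) : 0 < (phaseRoot β z).im := by
  have h1 := im_mul_re_phaseRoot_pos hβ hz hre
  rw [pow_two, Complex.mul_im] at him
  by_contra h
  push Not at h
  nlinarith

lemma re_phase (β : ℝ) (z : ℂ) : (phase β z).re =
    z.re ^ 2 - z.im ^ 2 - 2 * z.re * Real.cosh β + Real.log ‖z‖ / 2 := by
  have : (Complex.log z / 2).re = Real.log ‖z‖ / 2 := by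
    rw [← Complex.log_re]; simp
  rw [phase, Complex.add_re, this, Complex.sub_re, pow_two, Complex.mul_re, Complex.re_mul_ofReal,
    Complex.mul_re]
  simp
  ring

lemma im_phase (β : ℝ) (z : ℂ) : (phase β z).im =
    2 * z.im * (z.re - Real.cosh β) + z.arg / 2 := by
  have : (Complex.log z / 2).im = z.arg / 2 := by
    rw [← Complex.log_im]; simp
  rw [phase, Complex.add_im, this, Complex.sub_im, pow_two, Complex.mul_im, Complex.im_mul_ofReal,
    Complex.mul_im]
  simp
  ring

lemma phase_tMinus (β : ℝ) : phase β (tMinus β : ℂ) = (phaseReal β (tMinus β) : ℂ) :=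
  phase_ofReal β (tMinus_pos β).le

lemma phaseReal_tMinus (β : ℝ) :
    phaseReal β (tMinus β) = -Real.exp (-2 * β) / 4 - 1 / 2 - β / 2 - Real.log 2 / 2 := by
  have h1 : Real.log (tMinus β) = -β - Real.log 2 := by
    unfold tMinus
    rw [Real.log_div (Real.exp_pos _).ne' two_ne_zero, Real.log_exp]
  have h2 : tMinus β ^ 2 = Real.exp (-2 * β) / 4 := by
    unfold tMinus
    rw [div_pow, ← Real.exp_nat_mul]
    norm_num
  rw [phaseReal, h1, ← tMinus_add_tPlus]
  linear_combination -h2 - 2 * tMinus_mul_tPlus β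

lemma re_phaseRoot_sq (β : ℝ) (z : ℂ) : (phaseRoot β z ^ 2).re =
    z.re ^ 2 - z.im ^ 2 - 2 * z.re * Real.cosh β + Real.log ‖z‖ / 2 - phaseReal β (tMinus β) := by
  rw [phaseRoot_sq, phase_tMinus, Complex.sub_re, re_phase, Complex.ofReal_re]

lemma im_phaseRoot_sq (β : ℝ) (z : ℂ) : (phaseRoot β z ^ 2).im =
    2 * z.im * (z.re - Real.cosh β) + z.arg / 2 := by
  rw [phaseRoot_sq, phase_tMinus, Complex.sub_im, im_phase, Complex.ofReal_im, sub_zero]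

/-! ### The contour `Γ₊` -/

/-- `θ / tan θ`, continuously extended by `1` to `θ = 0`. -/
def thetaCot (θ : ℝ) : ℝ := Real.cos θ / Real.sinc θ

lemma thetaCot_zero : thetaCot 0 = 1 := by simp [thetaCot]

lemma thetaCot_of_ne_zero {θ : ℝ} (h : θ ≠ 0) : thetaCot θ = θ / Real.tan θ := by
  rw [thetaCot, Real.sinc_of_ne_zero h, Real.tan_eq_sin_div_cos]
  field_simp

lemma thetaCot_of_ne_zero' {θ : ℝ} (h : θ ≠ 0) : thetaCot θ = θ * Real.cos θ / Real.sin θ := by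
  rw [thetaCot, Real.sinc_of_ne_zero h]
  field_simp

lemma thetaCot_neg (θ : ℝ) : thetaCot (-θ) = thetaCot θ := by simp [thetaCot]

lemma cos_pos_of_abs_lt {θ : ℝ} (h : |θ| < Real.pi / 2) : 0 < Real.cos θ :=
  Real.cos_pos_of_mem_Ioo (abs_lt.1 h)

lemma sinc_pos {θ : ℝ} (h : |θ| < Real.pi / 2) : 0 < Real.sinc θ := by
  have key : ∀ t : ℝ, 0 < t → t < Real.pi / 2 → 0 < Real.sinc t := fun t h0 h1 => by
    rw [Real.sinc_of_ne_zero h0.ne']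
    exact div_pos (Real.sin_pos_of_pos_of_lt_pi h0 (by linarith [Real.pi_pos])) h0
  rcases lt_trichotomy θ 0 with h0 | h0 | h0
  · rw [← Real.sinc_neg]
    exact key _ (by linarith) (by linarith [(abs_lt.1 h).1])
  · simp [h0]
  · exact key _ h0 (abs_lt.1 h).2

lemma cos_le_thetaCot {θ : ℝ} (h : |θ| < Real.pi / 2) : Real.cos θ ≤ thetaCot θ := by
  rw [thetaCot, le_div_iff₀ (sinc_pos h)]
  nlinarith [cos_pos_of_abs_lt h, Real.sinc_le_one θ]

lemma thetaCot_pos {θ : ℝ} (h : |θ| < Real.pi / 2) : 0 < thetaCot θ :=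
  (cos_pos_of_abs_lt h).trans_le (cos_le_thetaCot h)

lemma thetaCot_le_one {θ : ℝ} (h : |θ| < Real.pi / 2) : thetaCot θ ≤ 1 := by
  have key : ∀ t : ℝ, 0 < t → t < Real.pi / 2 → thetaCot t ≤ 1 := fun t h0 h1 => by
    have := Real.lt_tan h0 h1
    rw [thetaCot_of_ne_zero h0.ne', div_le_one (h0.trans this)]
    exact this.le
  rcases lt_trichotomy θ 0 with h0 | h0 | h0
  · rw [← thetaCot_neg]
    exact key _ (by linarith) (by linarith [(abs_lt.1 h).1])
  · simp [h0, thetaCot_zero]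
  · exact key _ h0 (abs_lt.1 h).2

lemma continuousAt_thetaCot {θ : ℝ} (h : |θ| < Real.pi / 2) : ContinuousAt thetaCot θ :=
  Real.continuous_cos.continuousAt.div Real.continuous_sinc.continuousAt (sinc_pos h).ne'

lemma sin_ne_zero_of_abs_lt {θ : ℝ} (h : |θ| < Real.pi / 2) (h0 : θ ≠ 0) : Real.sin θ ≠ 0 := by
  have := sinc_pos h
  rw [Real.sinc_of_ne_zero h0] at this
  intro h'
  simp [h'] at this

/-- The derivative of `-θ / tan θ`. -/
def thetaCotDeriv (θ : ℝ) : ℝ := (θ - Real.sin θ * Real.cos θ) / Real.sin θ ^ 2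

lemma hasDerivAt_thetaCot {θ : ℝ} (h : |θ| < Real.pi / 2) (h0 : θ ≠ 0) :
    HasDerivAt thetaCot (-thetaCotDeriv θ) θ := by
  have hs := sin_ne_zero_of_abs_lt h h0
  have h1 : HasDerivAt (fun t => t * Real.cos t / Real.sin t) (-thetaCotDeriv θ) θ := by
    have := ((hasDerivAt_id θ).mul (Real.hasDerivAt_cos θ)).div (Real.hasDerivAt_sin θ) hs
    refine this.congr_deriv ?_
    simp only [id, Pi.mul_apply, thetaCotDeriv]
    field_simp
    linear_combination (-θ) * Real.sin_sq_add_cos_sq θ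
  refine h1.congr_of_eventuallyEq ?_
  filter_upwards [isOpen_ne.mem_nhds h0] with t ht
  exact thetaCot_of_ne_zero' ht

lemma thetaCotDeriv_neg (θ : ℝ) : thetaCotDeriv (-θ) = -thetaCotDeriv θ := by
  simp [thetaCotDeriv]; ring

lemma thetaCotDeriv_nonneg {θ : ℝ} (h0 : 0 ≤ θ) : 0 ≤ thetaCotDeriv θ := by
  refine div_nonneg ?_ (sq_nonneg _)
  have h1 : Real.sin (2 * θ) ≤ 2 * θ := Real.sin_le (by linarith)
  rw [Real.sin_two_mul] at h1
  linarith

/-- After clearing `sin² θ` this is `θ cos² θ ≤ sin θ cos θ`, that is `θ ≤ tan θ`. It keeps the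
derivative of `Γ₊` bounded near `θ = 0`. -/
lemma thetaCotDeriv_le {θ : ℝ} (h0 : 0 < θ) (h : θ < Real.pi / 2) : thetaCotDeriv θ ≤ θ := by
  have hs : 0 < Real.sin θ := Real.sin_pos_of_pos_of_lt_pi h0 (by linarith [Real.pi_pos])
  have hc : 0 < Real.cos θ := Real.cos_pos_of_mem_Ioo ⟨by linarith, h⟩
  have ht := Real.lt_tan h0 h
  rw [Real.tan_eq_sin_div_cos, lt_div_iff₀ hc] at ht
  rw [thetaCotDeriv, div_le_iff₀ (by positivity)]
  nlinarith [Real.sin_sq_add_cos_sq θ, mul_pos hc (sub_pos.2 ht)]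

lemma abs_thetaCotDeriv_le {θ : ℝ} (h : |θ| < Real.pi / 2) (h0 : θ ≠ 0) :
    |thetaCotDeriv θ| ≤ Real.pi / 2 := by
  have key : ∀ t : ℝ, 0 < t → t < Real.pi / 2 → |thetaCotDeriv t| ≤ Real.pi / 2 :=
    fun t h0 h1 => by
      rw [abs_of_nonneg (thetaCotDeriv_nonneg h0.le)]
      exact (thetaCotDeriv_le h0 h1).trans h1.le
  rcases lt_or_gt_of_ne h0 with h0 | h0
  · have := key (-θ) (by linarith) (by linarith [(abs_lt.1 h).1])
    rwa [thetaCotDeriv_neg, abs_neg] at this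
  · exact key _ h0 (abs_lt.1 h).2

/-- `√(cosh² β - θ / tan θ)`. -/
def sPlus (β θ : ℝ) : ℝ := √(Real.cosh β ^ 2 - thetaCot θ)

/-- The real part of `Γ₊`. -/
def xPlus (β θ : ℝ) : ℝ := (Real.cosh β + sPlus β θ) / 2

lemma sinh_le_sPlus {β θ : ℝ} (h : |θ| < Real.pi / 2) :
    Real.sinh β ≤ sPlus β θ := by
  refine Real.le_sqrt_of_sq_le ?_
  have := Real.cosh_sq β
  linarith [thetaCot_le_one h]

lemma sPlus_sq {β θ : ℝ} (h : |θ| < Real.pi / 2) :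
    sPlus β θ ^ 2 = Real.cosh β ^ 2 - thetaCot θ := by
  refine Real.sq_sqrt ?_
  have := Real.cosh_sq β
  nlinarith [thetaCot_le_one h, sq_nonneg (Real.sinh β)]

lemma sPlus_le_cosh {β θ : ℝ} (h : |θ| < Real.pi / 2) : sPlus β θ ≤ Real.cosh β := by
  refine Real.sqrt_le_iff.2 ⟨(Real.cosh_pos β).le, ?_⟩
  linarith [thetaCot_pos h]

lemma sPlus_pos {β θ : ℝ} (hβ : 0 < β) (h : |θ| < Real.pi / 2) : 0 < sPlus β θ :=
  (Real.sinh_pos_iff.2 hβ).trans_le (sinh_le_sPlus h)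

lemma tPlus_le_xPlus {β θ : ℝ} (h : |θ| < Real.pi / 2) : tPlus β ≤ xPlus β θ := by
  have := sinh_le_sPlus (β := β) h
  have := Real.cosh_add_sinh β
  unfold xPlus tPlus
  linarith

lemma xPlus_pos {β θ : ℝ} (h : |θ| < Real.pi / 2) : 0 < xPlus β θ :=
  (tPlus_pos β).trans_le (tPlus_le_xPlus h)

lemma xPlus_le_cosh {β θ : ℝ} (h : |θ| < Real.pi / 2) : xPlus β θ ≤ Real.cosh β := by
  have := sPlus_le_cosh (β := β) h
  unfold xPlus
  linarith

/-- This quadratic says that `Im f = 0` at the point `x (1 + i tan θ)` of argument `θ`, the equation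
of a steepest descent path through `t₊`. -/
lemma xPlus_quadratic {β θ : ℝ} (h : |θ| < Real.pi / 2) :
    xPlus β θ ^ 2 - Real.cosh β * xPlus β θ + thetaCot θ / 4 = 0 := by
  have := sPlus_sq (β := β) h
  unfold xPlus
  linear_combination this / 4

lemma xPlus_zero {β : ℝ} (hβ : 0 < β) : xPlus β 0 = tPlus β := by
  have : sPlus β 0 = Real.sinh β := by
    rw [sPlus, thetaCot_zero, Real.cosh_sq]
    simp [(Real.sinh_pos_iff.2 hβ).le]
  rw [xPlus, this, Real.cosh_add_sinh, tPlus]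

lemma rPlus_eq {β θ : ℝ} (hβ : 0 < β) : rPlus β θ = xPlus β θ / Real.cos θ := by
  rw [rPlus]
  split_ifs with h0
  · simp [h0, xPlus_zero hβ]
  · rw [xPlus, sPlus, thetaCot_of_ne_zero h0, div_div]

lemma rPlus_pos {β θ : ℝ} (hβ : 0 < β) (h : |θ| < Real.pi / 2) : 0 < rPlus β θ := by
  rw [rPlus_eq hβ]
  exact div_pos (xPlus_pos h) (cos_pos_of_abs_lt h)

lemma norm_gammaPlus {β θ : ℝ} (hβ : 0 < β) (h : |θ| < Real.pi / 2) :
    ‖gammaPlus β θ‖ = xPlus β θ / Real.cos θ := by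
  rw [gammaPlus, norm_mul, Complex.norm_exp_ofReal_mul_I, mul_one, Complex.norm_real,
    Real.norm_of_nonneg (rPlus_pos hβ h).le, rPlus_eq hβ]

lemma re_gammaPlus {β θ : ℝ} (hβ : 0 < β) (h : |θ| < Real.pi / 2) :
    (gammaPlus β θ).re = xPlus β θ := by
  have := (cos_pos_of_abs_lt h).ne'
  rw [gammaPlus, Complex.re_ofReal_mul, Complex.exp_ofReal_mul_I_re, rPlus_eq hβ]
  field_simp

lemma im_gammaPlus {β θ : ℝ} (hβ : 0 < β) :
    (gammaPlus β θ).im = xPlus β θ * Real.tan θ := by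
  rw [gammaPlus, Complex.im_ofReal_mul, Complex.exp_ofReal_mul_I_im, rPlus_eq hβ,
    Real.tan_eq_sin_div_cos]
  ring

lemma gammaPlus_eq {β θ : ℝ} (hβ : 0 < β) (h : |θ| < Real.pi / 2) :
    gammaPlus β θ = (xPlus β θ : ℂ) * (1 + (Real.tan θ : ℂ) * Complex.I) := by
  apply Complex.ext
  · rw [re_gammaPlus hβ h]; simp
  · rw [im_gammaPlus hβ]; simp [-Complex.ofReal_tan]

lemma arg_gammaPlus {β θ : ℝ} (hβ : 0 < β) (h : |θ| < Real.pi / 2) :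
    (gammaPlus β θ).arg = θ := by
  have hh := abs_lt.1 h
  have := Real.pi_pos
  rw [gammaPlus, Complex.arg_real_mul _ (rPlus_pos hβ h), Complex.arg_exp_mul_I,
    toIocMod_eq_self]
  constructor <;> linarith

lemma gammaPlus_zero {β : ℝ} : gammaPlus β 0 = (tPlus β : ℂ) := by
  simp [gammaPlus, rPlus]

lemma im_gammaPlus_ne_zero {β θ : ℝ} (hβ : 0 < β) (h : |θ| < Real.pi / 2) (h0 : θ ≠ 0) :
    (gammaPlus β θ).im ≠ 0 := by
  rw [im_gammaPlus hβ, Real.tan_eq_sin_div_cos]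
  exact mul_ne_zero (xPlus_pos h).ne'
    (div_ne_zero (sin_ne_zero_of_abs_lt h h0) (cos_pos_of_abs_lt h).ne')

lemma gammaPlus_mem_wDomain {β θ : ℝ} (hβ : 0 < β) (h : |θ| < Real.pi / 2) :
    gammaPlus β θ ∈ wDomain β := by
  rcases eq_or_ne θ 0 with rfl | h0
  · rw [gammaPlus_zero]
    exact ofReal_mem_wDomain (tPlus_pos β) le_rfl
  · exact mem_wDomain_of_im_ne_zero (im_gammaPlus_ne_zero hβ h h0)

lemma continuousAt_xPlus {β θ : ℝ} (h : |θ| < Real.pi / 2) : ContinuousAt (xPlus β) θ := by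
  have h1 := continuousAt_thetaCot h
  unfold xPlus sPlus
  fun_prop

lemma continuousAt_gammaPlus {β θ : ℝ} (hβ : 0 < β) (h : |θ| < Real.pi / 2) :
    ContinuousAt (gammaPlus β) θ := by
  have h1 := continuousAt_xPlus (β := β) h
  have h2 : ContinuousAt (rPlus β) θ := by
    have : rPlus β = fun θ => xPlus β θ / Real.cos θ := funext fun θ => rPlus_eq hβ
    rw [this]
    exact h1.div Real.continuous_cos.continuousAt (cos_pos_of_abs_lt h).ne'
  unfold gammaPlus
  fun_prop

lemma hasDerivAt_xPlus {β θ : ℝ} (hβ : 0 < β) (h : |θ| < Real.pi / 2) (h0 : θ ≠ 0) :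
    HasDerivAt (xPlus β) (thetaCotDeriv θ / (4 * sPlus β θ)) θ := by
  have h1 := (hasDerivAt_thetaCot h h0).const_sub (Real.cosh β ^ 2)
  have hs := sPlus_pos hβ h
  have h2 : Real.cosh β ^ 2 - thetaCot θ ≠ 0 := by
    rw [← sPlus_sq h]; positivity
  have h3 := ((h1.sqrt h2).const_add (Real.cosh β)).div_const 2
  refine h3.congr_deriv ?_
  change _ / (2 * sPlus β θ) / 2 = _
  field_simp
  ring

/-- The derivative of the parametrization of `Γ₊` away from `0`. -/
def gammaPlusDeriv (β θ : ℝ) : ℂ :=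
  ((thetaCotDeriv θ / (4 * sPlus β θ) : ℝ) : ℂ) * (1 + (Real.tan θ : ℂ) * Complex.I) +
    ((xPlus β θ / Real.cos θ ^ 2 : ℝ) : ℂ) * Complex.I

lemma hasDerivAt_gammaPlus {β θ : ℝ} (hβ : 0 < β) (h : |θ| < Real.pi / 2) (h0 : θ ≠ 0) :
    HasDerivAt (gammaPlus β) (gammaPlusDeriv β θ) θ := by
  have h1 := (hasDerivAt_xPlus hβ h h0).ofReal_comp
  have h2 := (((Real.hasDerivAt_tan (cos_pos_of_abs_lt h).ne').ofReal_comp).mul_const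
    Complex.I).const_add 1
  have h3 := h1.mul h2
  have h4 : HasDerivAt (fun θ => (xPlus β θ : ℂ) * (1 + (Real.tan θ : ℂ) * Complex.I))
      (gammaPlusDeriv β θ) θ := by
    refine h3.congr_deriv ?_
    rw [gammaPlusDeriv]
    push_cast
    ring
  refine h4.congr_of_eventuallyEq ?_
  have : {t : ℝ | |t| < Real.pi / 2} ∈ 𝓝 θ :=
    (isOpen_lt continuous_abs continuous_const).mem_nhds h
  filter_upwards [this] with t ht
  exact gammaPlus_eq hβ ht

lemma norm_one_add_tan_mul_I {θ : ℝ} (h : |θ| < Real.pi / 2) :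
    ‖(1 : ℂ) + (Real.tan θ : ℂ) * Complex.I‖ = 1 / Real.cos θ := by
  have hc := cos_pos_of_abs_lt h
  have : (1 : ℂ) + (Real.tan θ : ℂ) * Complex.I =
      ((1 / Real.cos θ : ℝ) : ℂ) * Complex.exp (θ * Complex.I) := by
    apply Complex.ext
    · rw [Complex.re_ofReal_mul, Complex.exp_ofReal_mul_I_re]
      simp [hc.ne']
    · rw [Complex.im_ofReal_mul, Complex.exp_ofReal_mul_I_im, one_div_mul_eq_div,
        ← Real.tan_eq_sin_div_cos]
      simp [-Complex.ofReal_tan]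
  rw [this, norm_mul, Complex.norm_exp_ofReal_mul_I, mul_one, Complex.norm_real,
    Real.norm_of_nonneg (by positivity)]

lemma norm_gammaPlusDeriv_le {β θ : ℝ} (hβ : 0 < β) (h : |θ| < Real.pi / 2) (h0 : θ ≠ 0) :
    ‖gammaPlusDeriv β θ‖ ≤ Real.pi / (8 * Real.sinh β * Real.cos θ) +
      Real.cosh β / Real.cos θ ^ 2 := by
  have hc := cos_pos_of_abs_lt h
  have hs := Real.sinh_pos_iff.2 hβ
  have hs' := sinh_le_sPlus (β := β) h
  refine (norm_add_le _ _).trans (add_le_add ?_ ?_)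
  · rw [norm_mul, norm_one_add_tan_mul_I h, Complex.norm_real, Real.norm_eq_abs, abs_div,
      abs_of_pos (show 0 < 4 * sPlus β θ by linarith)]
    have : |thetaCotDeriv θ| / (4 * sPlus β θ) ≤ (Real.pi / 2) / (4 * Real.sinh β) :=
      div_le_div₀ (by positivity) (abs_thetaCotDeriv_le h h0) (by positivity) (by linarith)
    calc _ ≤ (Real.pi / 2) / (4 * Real.sinh β) * (1 / Real.cos θ) := by gcongr
      _ = _ := by field_simp; ring
  · rw [norm_mul, Complex.norm_I, mul_one, Complex.norm_real,
      Real.norm_of_nonneg (div_nonneg (xPlus_pos h).le (by positivity))]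
    gcongr
    exact xPlus_le_cosh h

/-- `f(t₋) - f(t₊)`. -/
def saddleGap (β : ℝ) : ℝ := Real.sinh (2 * β) / 2 - β

lemma saddleGap_pos {β : ℝ} (hβ : 0 < β) : 0 < saddleGap β := by
  have := Real.self_lt_sinh_iff.2 (show 0 < 2 * β by linarith)
  unfold saddleGap
  linarith

/-- `f(t₋) - f` on `Γ₊`. -/
def phaseDrop (β θ : ℝ) : ℝ :=
  xPlus β θ ^ 2 / Real.cos θ ^ 2 - Real.log (xPlus β θ) / 2 + Real.log (Real.cos θ) / 2 +
    thetaCot θ / 2 - (tMinus β ^ 2 - Real.log (tMinus β) / 2 + 1 / 2)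

lemma phaseDrop_neg (β θ : ℝ) : phaseDrop β (-θ) = phaseDrop β θ := by
  simp [phaseDrop, xPlus, sPlus, thetaCot_neg]

/-- The quadratic for the real part of `Γ₊` makes `w²` real. The same equation eliminates the linear
term of `f`, which leaves the expression `phaseDrop`. -/
lemma phaseRoot_gammaPlus_sq {β θ : ℝ} (hβ : 0 < β) (h : |θ| < Real.pi / 2) :
    phaseRoot β (gammaPlus β θ) ^ 2 = ((-phaseDrop β θ : ℝ) : ℂ) := by
  have hc := cos_pos_of_abs_lt h
  have hx := xPlus_pos (β := β) h
  have hq := xPlus_quadratic (β := β) h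
  apply Complex.ext
  · rw [re_phaseRoot_sq, Complex.ofReal_re, re_gammaPlus hβ h, im_gammaPlus hβ,
      norm_gammaPlus hβ h, phaseDrop, Real.log_div hx.ne' hc.ne', phaseReal, Real.tan_eq_sin_div_cos]
    have h1 := tMinus_mul_tPlus β
    have h2 := tMinus_add_tPlus β
    have h3 : (xPlus β θ * (Real.sin θ / Real.cos θ)) ^ 2 =
        xPlus β θ ^ 2 / Real.cos θ ^ 2 - xPlus β θ ^ 2 := by
      have := Real.sin_sq_add_cos_sq θ
      field_simp
      linear_combination this
    rw [h3]
    linear_combination 2 * hq + 2 * h1 - 2 * tMinus β * h2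
  · rw [im_phaseRoot_sq, Complex.ofReal_im, re_gammaPlus hβ h, im_gammaPlus hβ,
      arg_gammaPlus hβ h]
    rcases eq_or_ne θ 0 with rfl | h0
    · simp
    · rw [thetaCot_of_ne_zero' h0] at hq
      rw [Real.tan_eq_sin_div_cos]
      have := sin_ne_zero_of_abs_lt h h0
      field_simp at hq ⊢
      linear_combination hq

lemma continuousAt_phaseDrop {β θ : ℝ} (h : |θ| < Real.pi / 2) :
    ContinuousAt (phaseDrop β) θ := by
  have h1 := continuousAt_xPlus (β := β) h
  have h2 := continuousAt_thetaCot h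
  have h3 := (xPlus_pos (β := β) h).ne'
  have h4 := (cos_pos_of_abs_lt h).ne'
  have h5 := pow_ne_zero 2 h4
  unfold phaseDrop
  fun_prop (disch := assumption)

lemma phaseDrop_zero {β : ℝ} (hβ : 0 < β) : phaseDrop β 0 = saddleGap β := by
  have h1 : Real.log (tMinus β) = -β - Real.log 2 := by
    unfold tMinus
    rw [Real.log_div (Real.exp_pos _).ne' two_ne_zero, Real.log_exp]
  have h2 : Real.log (tPlus β) = β - Real.log 2 := by
    unfold tPlus
    rw [Real.log_div (Real.exp_pos _).ne' two_ne_zero, Real.log_exp]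
  have h3 : tMinus β ^ 2 = Real.exp (-(2 * β)) / 4 := by
    unfold tMinus
    rw [div_pow, ← Real.exp_nat_mul]
    norm_num
  have h4 : tPlus β ^ 2 = Real.exp (2 * β) / 4 := by
    unfold tPlus
    rw [div_pow, ← Real.exp_nat_mul]
    norm_num
  rw [phaseDrop, xPlus_zero hβ, thetaCot_zero, h1, h2, h3, saddleGap, Real.sinh_eq]
  simp [h4]
  ring

lemma one_sub_thetaCot_le {θ : ℝ} (h : |θ| < Real.pi / 2) :
    1 - thetaCot θ ≤ Real.tan θ ^ 2 := by
  have hc := cos_pos_of_abs_lt h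
  have h1 := cos_le_thetaCot h
  have h2 := Real.cos_le_one θ
  have h3 : Real.sin θ ^ 2 ≤ Real.tan θ ^ 2 := by
    rw [Real.tan_eq_sin_div_cos, div_pow, le_div_iff₀ (by positivity)]
    have : Real.cos θ ^ 2 ≤ 1 := by nlinarith
    nlinarith [mul_nonneg (sq_nonneg (Real.sin θ)) (sub_nonneg.2 this)]
  nlinarith [Real.sin_sq_add_cos_sq θ]

/-- The drop is even in `θ`, is nondecreasing on `[0, π/2)`, and equals the gap at `θ = 0`, that is
at `t₊`. -/
lemma saddleGap_le_phaseDrop {β θ : ℝ} (hβ : 0 < β) (h : |θ| < Real.pi / 2) :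
    saddleGap β ≤ phaseDrop β θ := by
  have key : ∀ t : ℝ, 0 ≤ t → t < Real.pi / 2 → saddleGap β ≤ phaseDrop β t := by
    intro t ht0 ht
    have hab : ∀ u ∈ Set.Icc 0 t, |u| < Real.pi / 2 := fun u hu => by
      rw [abs_of_nonneg hu.1]; linarith [hu.2]
    have hm : MonotoneOn (phaseDrop β) (Set.Icc 0 t) := by
      refine monotoneOn_of_deriv_nonneg (convex_Icc _ _)
        (fun u hu => (continuousAt_phaseDrop (hab u hu)).continuousWithinAt) ?_ ?_
      all_goals
        have hd : ∀ u ∈ interior (Set.Icc 0 t), ∃ d, HasDerivAt (phaseDrop β) d u ∧ 0 ≤ d := by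
          intro u hu
          rw [interior_Icc] at hu
          have hu' := hab u (Set.Ioo_subset_Icc_self hu)
          have hc := cos_pos_of_abs_lt hu'
          have hx := xPlus_pos (β := β) hu'
          have hs := sPlus_pos hβ hu'
          have h1 := hasDerivAt_xPlus hβ hu' hu.1.ne'
          have h2 := hasDerivAt_thetaCot hu' hu.1.ne'
          have h3 := Real.hasDerivAt_cos u
          have h4 := (((((h1.pow 2).div (h3.pow 2) (pow_ne_zero 2 hc.ne')).sub
            ((h1.log hx.ne').div_const 2)).add ((h3.log hc.ne').div_const 2)).add
            (h2.div_const 2)).sub_const (tMinus β ^ 2 - Real.log (tMinus β) / 2 + 1 / 2)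
          refine ⟨_, h4, ?_⟩
          have hk := thetaCotDeriv_nonneg hu.1.le
          have hxt := tPlus_le_xPlus (β := β) hu'
          have hhalf := half_lt_tPlus hβ
          have hq := xPlus_quadratic (β := β) hu'
          have hsx : sPlus β u = 2 * xPlus β u - Real.cosh β := by unfold xPlus; ring
          have hot := one_sub_thetaCot_le hu'
          have htan : 0 ≤ Real.tan u := Real.tan_nonneg_of_nonneg_of_le_pi_div_two hu.1.le
            (by linarith [hu.2])
          have hsec : 1 / Real.cos u ^ 2 = 1 + Real.tan u ^ 2 := by
            rw [Real.tan_eq_sin_div_cos]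
            have := Real.sin_sq_add_cos_sq u
            field_simp
            linarith
          set x := xPlus β u
          set s := sPlus β u
          set k := thetaCotDeriv u
          set T := Real.tan u
          have hsin : Real.sin u = T * Real.cos u := (Real.tan_mul_cos hc.ne').symm
          have hx2 : 1 ≤ 4 * x ^ 2 := by nlinarith
          -- By the quadratic for `x` one has `4 x s = 4 x² - θ cot θ`, so the claim reduces to `1 -
          -- θ cot θ ≤ 4 x² T²`. With it the derivative `e` below is a sum of two nonnegative terms.
          have hA : 4 * x * s ≤ 4 * x ^ 2 * (1 + T ^ 2) - 1 := by
            rw [hsx]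
            nlinarith [mul_nonneg (sub_nonneg.2 hx2) (sq_nonneg T)]
          have e : (↑(2 : ℕ) * x ^ (2 - 1) * (k / (4 * s)) * Real.cos u ^ 2 -
              x ^ 2 * (↑(2 : ℕ) * Real.cos u ^ (2 - 1) * -Real.sin u)) / (Real.cos u ^ 2) ^ 2 -
              k / (4 * s) / x / 2 + -Real.sin u / Real.cos u / 2 + -k / 2 =
              k / (8 * s * x) * (4 * x ^ 2 * (1 + T ^ 2) - 1 - 4 * x * s) +
                T / 2 * (4 * x ^ 2 * (1 + T ^ 2) - 1) := by
            rw [hsin, ← hsec]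
            field_simp
            ring
          refine le_of_le_of_eq ?_ e.symm
          have hB : 0 ≤ 4 * x ^ 2 * (1 + T ^ 2) - 1 := by
            have : 0 < x * s := mul_pos hx hs
            linarith
          have := sub_nonneg.2 hA
          positivity
      · intro u hu
        obtain ⟨d, hd1, _⟩ := hd u hu
        exact hd1.differentiableAt.differentiableWithinAt
      · intro u hu
        obtain ⟨d, hd1, hd2⟩ := hd u hu
        rwa [hd1.deriv]
    rw [← phaseDrop_zero hβ]
    exact hm ⟨le_rfl, ht0⟩ ⟨ht0, le_rfl⟩ ht0
  rcases le_total 0 θ with h0 | h0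
  · exact key θ h0 (abs_lt.1 h).2
  · rw [← phaseDrop_neg]
    exact key _ (by linarith) (by linarith [(abs_lt.1 h).1])

lemma saddleGap_le_tPlus_sq {β : ℝ} (hβ : 0 < β) : saddleGap β ≤ tPlus β ^ 2 - 1 / 4 := by
  have h1 : Real.exp (2 * β) = 4 * tPlus β ^ 2 := by
    unfold tPlus
    rw [div_pow, ← Real.exp_nat_mul]
    norm_num
    ring
  have h2 : -(2 * β) + 1 ≤ Real.exp (-(2 * β)) := Real.add_one_le_exp _
  rw [saddleGap, Real.sinh_eq, h1]
  linarith

/-- The uniform lower bound does not give integrability along `Γ₊`; growth like `1 / cos² θ` does.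
Where `5 cos² θ ≥ 1` this follows from the uniform bound, elsewhere `x² / cos² θ` dominates both
logarithms. -/
lemma saddleGap_div_le_phaseDrop {β θ : ℝ} (hβ : 0 < β) (h : |θ| < Real.pi / 2) :
    saddleGap β / (5 * Real.cos θ ^ 2) ≤ phaseDrop β θ := by
  have hc := cos_pos_of_abs_lt h
  have hD := saddleGap_pos hβ
  rcases le_or_gt 1 (5 * Real.cos θ ^ 2) with h5 | h5
  · exact (div_le_self hD.le h5).trans (saddleGap_le_phaseDrop hβ h)
  set S := 1 / Real.cos θ ^ 2 with hS
  have hS5 : 5 < S := by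
    rw [hS, lt_div_iff₀ (by positivity)]; exact h5
  have hx := tPlus_le_xPlus (β := β) h
  have hT := half_lt_tPlus hβ
  have hT0 := tPlus_pos β
  have hx0 := xPlus_pos (β := β) h
  have hk := thetaCot_pos h
  have hDT := saddleGap_le_tPlus_sq hβ
  have hlogS : Real.log S = -2 * Real.log (Real.cos θ) := by
    rw [hS, one_div, Real.log_inv, Real.log_pow]; push_cast; ring
  have hlog5 : Real.log 5 < 2 := by
    have h1 : Real.log 5 = 2 * Real.log 2 + Real.log (5 / 4) := by
      rw [show (5 : ℝ) = 2 ^ 2 * (5 / 4) by norm_num, Real.log_mul (by norm_num) (by norm_num),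
        Real.log_pow]
      norm_num
    have h2 : Real.log (5 / 4) ≤ 5 / 4 - 1 := Real.log_le_sub_one_of_pos (by norm_num)
    linarith [Real.log_two_lt_d9]
  -- The tangent of the logarithm at `5`. The error it leaves is absorbed because `log 5 < 2`, which
  -- is what makes the constant `5` sufficient.
  have hlogS' : Real.log S ≤ S / 5 - 1 + Real.log 5 := by
    have h1 : Real.log (S / 5) ≤ S / 5 - 1 := Real.log_le_sub_one_of_pos (by positivity)
    rw [Real.log_div (by positivity) (by norm_num)] at h1
    linarith
  have hlogx : Real.log (xPlus β θ) - Real.log (tPlus β) ≤ 2 * (xPlus β θ - tPlus β) := by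
    have h1 := Real.log_le_sub_one_of_pos (div_pos hx0 hT0)
    rw [Real.log_div hx0.ne' hT0.ne'] at h1
    have h2 : xPlus β θ / tPlus β - 1 ≤ 2 * (xPlus β θ - tPlus β) := by
      rw [div_sub_one hT0.ne', div_le_iff₀ hT0]
      nlinarith
    linarith
  have hz := phaseDrop_zero hβ
  rw [phaseDrop, xPlus_zero hβ, thetaCot_zero] at hz
  simp only [Real.cos_zero, one_pow, div_one, Real.log_one, zero_div, add_zero] at hz
  have e : saddleGap β / (5 * Real.cos θ ^ 2) = saddleGap β * S / 5 := by
    rw [hS]; field_simp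
  have e2 : xPlus β θ ^ 2 / Real.cos θ ^ 2 = xPlus β θ ^ 2 * S := by
    rw [hS]; field_simp
  rw [e, phaseDrop, e2]
  set x := xPlus β θ
  set t := tPlus β
  set D := saddleGap β
  have h1 : t ^ 2 * S + (x - t) ≤ x ^ 2 * S := by
    have : (x - t) * 1 ≤ (x - t) * ((x + t) * S) := by
      refine mul_le_mul_of_nonneg_left ?_ (sub_nonneg.2 hx)
      nlinarith
    nlinarith
  have h2 : (S / 5 - 1) * D ≤ (S / 5 - 1) * (t ^ 2 - 1 / 4) :=
    mul_le_mul_of_nonneg_left hDT (by linarith)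
  have h3 : 1 / 4 * S ≤ t ^ 2 * S := by
    refine mul_le_mul_of_nonneg_right ?_ (by linarith)
    nlinarith
  nlinarith

lemma phaseDrop_pos {β θ : ℝ} (hβ : 0 < β) (h : |θ| < Real.pi / 2) : 0 < phaseDrop β θ :=
  (saddleGap_pos hβ).trans_le (saddleGap_le_phaseDrop hβ h)

lemma norm_phaseRoot_gammaPlus_sq {β θ : ℝ} (hβ : 0 < β) (h : |θ| < Real.pi / 2) :
    ‖phaseRoot β (gammaPlus β θ)‖ ^ 2 = phaseDrop β θ := by
  rw [← norm_pow, phaseRoot_gammaPlus_sq hβ h, Complex.norm_real, norm_neg,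
    Real.norm_of_nonneg (phaseDrop_pos hβ h).le]

/-! ### Contour deformation -/

/-- The plane without `(-∞, 0]` and `[t₋, ∞)`. -/
def leftDomain (β : ℝ) : Set ℂ :=
  Complex.slitPlane ∩ (fun z => (tMinus β : ℂ) - z) ⁻¹' Complex.slitPlane

/-- The part of `wDomain β` off `(-∞, t₋]`. -/
def rightDomain (β : ℝ) : Set ℂ :=
  wDomain β ∩ (fun z => z - (tMinus β : ℂ)) ⁻¹' Complex.slitPlane

lemma isOpen_leftDomain (β : ℝ) : IsOpen (leftDomain β) :=
  Complex.isOpen_slitPlane.inter (Complex.isOpen_slitPlane.preimage (by fun_prop))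

lemma isOpen_rightDomain {β : ℝ} (hβ : 0 < β) : IsOpen (rightDomain β) :=
  (isOpen_wDomain hβ).inter (Complex.isOpen_slitPlane.preimage (by fun_prop))

lemma mem_leftDomain_of_im_ne_zero {β : ℝ} {z : ℂ} (hz : z.im ≠ 0) : z ∈ leftDomain β :=
  ⟨Or.inr hz, Or.inr (by simpa using hz)⟩

lemma mem_rightDomain_of_im_ne_zero {β : ℝ} {z : ℂ} (hz : z.im ≠ 0) : z ∈ rightDomain β :=
  ⟨mem_wDomain_of_im_ne_zero hz, Or.inr (by simpa using hz)⟩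

lemma mem_leftDomain_of_re {β : ℝ} {z : ℂ} (h0 : 0 < z.re) (h1 : z.re < tMinus β) :
    z ∈ leftDomain β :=
  ⟨Or.inl h0, Or.inl (by simpa using h1)⟩

lemma leftDomain_subset {β : ℝ} (hβ : 0 < β) : leftDomain β ⊆ wDomain β \ {(tMinus β : ℂ)} := by
  intro z hz
  refine ⟨⟨hz.1, fun h => ?_⟩, fun h => ?_⟩
  · have h1 := (Complex.mem_slitPlane_iff.1 hz.2).resolve_right (by simp [h.1])
    have h2 := h.2.1
    have h3 := tMinus_lt_tPlus hβ
    simp at h1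
    linarith
  · have h1 := hz.2
    rw [Set.mem_singleton_iff.1 h] at h1
    simp at h1

lemma rightDomain_subset {β : ℝ} : rightDomain β ⊆ wDomain β \ {(tMinus β : ℂ)} := by
  intro z hz
  refine ⟨hz.1, fun h => ?_⟩
  have h1 := hz.2
  rw [Set.mem_singleton_iff.1 h] at h1
  simp at h1

/-- The centre `t₋ / 2` is fixed by `z ↦ t₋ - z`, so both slit plane conditions are star-shaped
about it. -/
lemma starConvex_leftDomain (β : ℝ) : StarConvex ℝ ((tMinus β / 2 : ℝ) : ℂ) (leftDomain β) := by
  have hc := tMinus_pos β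
  have hstar : StarConvex ℝ ((tMinus β / 2 : ℝ) : ℂ) Complex.slitPlane :=
    Complex.starConvex_slitPlane (by
      rw [Complex.lt_def]; simp [hc])
  intro z hz a b ha hb hab
  refine ⟨hstar hz.1 ha hb hab, ?_⟩
  have h := hstar hz.2 ha hb hab
  rw [Set.mem_preimage]
  convert h using 1
  have hab' : (a : ℂ) + b = 1 := by exact_mod_cast hab
  simp only [Complex.real_smul]
  push_cast
  linear_combination (-(tMinus β : ℂ)) * hab'

lemma starConvex_rightDomain {β : ℝ} (hβ : 0 < β) :
    StarConvex ℝ ((tPlus β : ℝ) : ℂ) (rightDomain β) := by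
  have hc := tMinus_lt_tPlus hβ
  have hstar : StarConvex ℝ ((tPlus β - tMinus β : ℝ) : ℂ) Complex.slitPlane :=
    Complex.starConvex_slitPlane (by
      rw [Complex.lt_def]; simpa using hc)
  intro z hz a b ha hb hab
  refine ⟨starConvex_wDomain hβ (ofReal_mem_wDomain (tPlus_pos β) le_rfl) hz.1 ha hb hab, ?_⟩
  have h := hstar hz.2 ha hb hab
  rw [Set.mem_preimage]
  convert h using 1
  have hab' : (a : ℂ) + b = 1 := by exact_mod_cast hab
  simp only [Complex.real_smul]
  push_cast
  linear_combination (tMinus β : ℂ) * hab'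

/-- The part of `Γ₀` with real parts at least `-L`. -/
def keyhole (δ L : ℝ) (F : ℂ → ℂ) : ℂ :=
  (∫ l in (-L)..0, pathIntegrand F (halfLine δ) l) +
  (∫ θ in (Real.pi / 2)..(-(Real.pi / 2)), pathIntegrand F (arc δ) θ) -
  (∫ l in (-L)..0, pathIntegrand F (halfLine (-δ)) l)

lemma hasDerivAt_halfLine (δ l : ℝ) : HasDerivAt (halfLine δ) 1 l := by
  have := (Complex.ofRealCLM.hasDerivAt (x := l)).add_const ((δ : ℂ) * Complex.I)
  exact this.congr_deriv (by simp)

lemma hasDerivAt_arc (δ θ : ℝ) : HasDerivAt (arc δ) (arc δ θ * Complex.I) θ := by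
  have h := ((Complex.ofRealCLM.hasDerivAt (x := θ)).mul_const Complex.I).cexp.const_mul (δ : ℂ)
  refine (h.congr_deriv ?_)
  simp [arc]
  ring

lemma continuous_halfLine (δ : ℝ) : Continuous (halfLine δ) := by unfold halfLine; fun_prop
lemma continuous_arc (δ : ℝ) : Continuous (arc δ) := by unfold arc; fun_prop

lemma pathIntegrand_halfLine (F : ℂ → ℂ) (δ l : ℝ) :
    pathIntegrand F (halfLine δ) l = F (halfLine δ l) := by
  rw [pathIntegrand, (hasDerivAt_halfLine δ l).deriv, mul_one]

lemma pathIntegrand_arc (F : ℂ → ℂ) (δ θ : ℝ) :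
    pathIntegrand F (arc δ) θ = F (arc δ θ) * (arc δ θ * Complex.I) := by
  rw [pathIntegrand, (hasDerivAt_arc δ θ).deriv]

lemma halfLine_mem_leftDomain {β δ : ℝ} (hδ : δ ≠ 0) (l : ℝ) : halfLine δ l ∈ leftDomain β :=
  mem_leftDomain_of_im_ne_zero (by simpa [halfLine] using hδ)

lemma arc_mem_leftDomain {β δ θ : ℝ} (hδ : 0 < δ) (hδc : δ < tMinus β)
    (hθ : |θ| ≤ Real.pi / 2) : arc δ θ ∈ leftDomain β := by
  have hre : (arc δ θ).re = δ * Real.cos θ := by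
    rw [arc, Complex.re_ofReal_mul, Complex.exp_ofReal_mul_I_re]
  have him : (arc δ θ).im = δ * Real.sin θ := by
    rw [arc, Complex.im_ofReal_mul, Complex.exp_ofReal_mul_I_im]
  by_cases h : Real.sin θ = 0
  · have h1 := Real.sin_sq_add_cos_sq θ
    have h2 := Real.cos_nonneg_of_mem_Icc (abs_le.1 hθ)
    have h3 : Real.cos θ = 1 := by
      rw [h] at h1
      nlinarith
    exact mem_leftDomain_of_re (by rw [hre, h3]; linarith) (by rw [hre, h3]; linarith)
  · exact mem_leftDomain_of_im_ne_zero (by rw [him]; exact mul_ne_zero hδ.ne' h)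

lemma uIcc_pi_div_two {θ : ℝ} (h : θ ∈ Set.uIcc (Real.pi / 2) (-(Real.pi / 2))) :
    |θ| ≤ Real.pi / 2 := by
  rw [Set.uIcc_of_ge (by linarith [Real.pi_pos])] at h
  exact abs_le.2 h

lemma intervalIntegrable_halfLine {β δ : ℝ} {F : ℂ → ℂ} (hF : ContinuousOn F (leftDomain β))
    (hδ : δ ≠ 0) (p q : ℝ) :
    IntervalIntegrable (pathIntegrand F (halfLine δ)) volume p q := by
  have : pathIntegrand F (halfLine δ) = fun l => F (halfLine δ l) :=
    funext fun l => pathIntegrand_halfLine F δ l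
  rw [this]
  exact (hF.comp_continuous (continuous_halfLine δ)
    fun l => halfLine_mem_leftDomain hδ l).intervalIntegrable _ _

lemma intervalIntegrable_arc {β δ : ℝ} {F : ℂ → ℂ} (hF : ContinuousOn F (leftDomain β))
    (hδ : 0 < δ) (hδc : δ < tMinus β) :
    IntervalIntegrable (pathIntegrand F (arc δ)) volume (Real.pi / 2) (-(Real.pi / 2)) := by
  have : pathIntegrand F (arc δ) = fun θ => F (arc δ θ) * (arc δ θ * Complex.I) :=
    funext fun l => pathIntegrand_arc F δ l
  rw [this]
  refine ContinuousOn.intervalIntegrable ?_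
  refine (hF.comp (continuous_arc δ).continuousOn
    fun θ hθ => arc_mem_leftDomain hδ hδc (uIcc_pi_div_two hθ)).mul ?_
  have := continuous_arc δ
  fun_prop

lemma keyhole_eq_of_primitive {β δ L : ℝ} {F G : ℂ → ℂ} (hF : ContinuousOn F (leftDomain β))
    (hG : ∀ z ∈ leftDomain β, HasDerivAt G (F z) z) (hδ : 0 < δ) (hδc : δ < tMinus β) :
    keyhole δ L F = G (-L - δ * Complex.I) - G (-L + δ * Complex.I) := by
  have key : ∀ ε : ℝ, ε ≠ 0 → ∫ l in (-L)..0, pathIntegrand F (halfLine ε) l =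
      G (halfLine ε 0) - G (halfLine ε (-L)) := fun ε hε =>
    integral_pathIntegrand (s := ∅) Set.countable_empty (continuous_halfLine ε).continuousOn
      (fun t _ => (hasDerivAt_halfLine ε t).differentiableAt.hasDerivAt)
      (fun t _ => hG _ (halfLine_mem_leftDomain hε t)) (intervalIntegrable_halfLine hF hε _ _)
  have harc : ∫ θ in (Real.pi / 2)..(-(Real.pi / 2)), pathIntegrand F (arc δ) θ =
      G (arc δ (-(Real.pi / 2))) - G (arc δ (Real.pi / 2)) :=
    integral_pathIntegrand (s := ∅) Set.countable_empty (continuous_arc δ).continuousOn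
      (fun t _ => (hasDerivAt_arc δ t).differentiableAt.hasDerivAt)
      (fun t ht => hG _ (arc_mem_leftDomain hδ hδc (uIcc_pi_div_two ht)))
      (intervalIntegrable_arc hF hδ hδc)
  have e1 : arc δ (-(Real.pi / 2)) = halfLine (-δ) 0 := by
    have : Complex.exp (-(Real.pi / 2 * Complex.I)) = -Complex.I := by
      rw [Complex.exp_neg, Complex.exp_pi_div_two_mul_I, Complex.inv_I]
    simp [arc, halfLine, this]
  have e2 : arc δ (Real.pi / 2) = halfLine δ 0 := by
    simp [arc, halfLine, Complex.exp_pi_div_two_mul_I]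
  rw [keyhole, key δ hδ.ne', key (-δ) (neg_ne_zero.2 hδ.ne'), harc, e1, e2]
  simp only [halfLine]
  push_cast
  ring_nf

lemma abs_lt_of_mem_uIcc {b θ : ℝ} (hb0 : 0 < b) (hb : b < Real.pi / 2)
    (h : θ ∈ Set.uIcc (-b) b) : |θ| < Real.pi / 2 := by
  rw [Set.uIcc_of_le (by linarith)] at h
  exact (abs_le.2 h).trans_lt hb

/-- Off the null point `θ = 0` the derivative has an explicit bound, largest at the ends of the
interval; differentiability at `0` is not needed. -/
lemma intervalIntegrable_deriv_gammaPlus {β b : ℝ} (hβ : 0 < β) (hb0 : 0 < b)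
    (hb : b < Real.pi / 2) : IntervalIntegrable (deriv (gammaPlus β)) volume (-b) b := by
  have hcb : 0 < Real.cos b := Real.cos_pos_of_mem_Ioo ⟨by linarith, hb⟩
  have hs := Real.sinh_pos_iff.2 hβ
  refine (intervalIntegrable_const (c := Real.pi / (8 * Real.sinh β * Real.cos b) +
      Real.cosh β / Real.cos b ^ 2)).mono_fun (measurable_deriv _).aestronglyMeasurable ?_
  have h0 : ∀ᵐ θ : ℝ, θ ≠ 0 := by simp [ae_iff]
  filter_upwards [ae_restrict_mem measurableSet_uIoc, ae_restrict_of_ae h0] with θ hθ hθ0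
  have hθ := Set.uIoc_subset_uIcc hθ
  have hθ' := abs_lt_of_mem_uIcc hb0 hb hθ
  rw [(hasDerivAt_gammaPlus hβ hθ' hθ0).deriv]
  refine (norm_gammaPlusDeriv_le hβ hθ' hθ0).trans ?_
  have hc : Real.cos b ≤ Real.cos θ := by
    rw [← Real.cos_abs θ]
    rw [Set.uIcc_of_le (by linarith)] at hθ
    exact Real.cos_le_cos_of_nonneg_of_le_pi (abs_nonneg _) (by linarith [Real.pi_pos])
      (abs_le.2 hθ)
  refine le_trans ?_ (le_abs_self _)
  gcongr

lemma intervalIntegrable_gammaPlus {β b : ℝ} {F : ℂ → ℂ} (hβ : 0 < β)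
    (hF : ContinuousOn F (wDomain β \ {(tMinus β : ℂ)})) (hb0 : 0 < b) (hb : b < Real.pi / 2) :
    IntervalIntegrable (pathIntegrand F (gammaPlus β)) volume (-b) b := by
  refine (intervalIntegrable_deriv_gammaPlus hβ hb0 hb).continuousOn_mul (hF.comp ?_ ?_)
  · exact fun θ hθ =>
      (continuousAt_gammaPlus hβ (abs_lt_of_mem_uIcc hb0 hb hθ)).continuousWithinAt
  · intro θ hθ
    have h := abs_lt_of_mem_uIcc hb0 hb hθ
    refine ⟨gammaPlus_mem_wDomain hβ h, fun h' => ?_⟩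
    have h1 := re_gammaPlus hβ h
    rw [Set.mem_singleton_iff.1 h', Complex.ofReal_re] at h1
    linarith [tPlus_le_xPlus (β := β) h, tMinus_lt_tPlus hβ]

lemma gammaPlus_mem_rightDomain {β θ : ℝ} (hβ : 0 < β) (h : |θ| < Real.pi / 2) :
    gammaPlus β θ ∈ rightDomain β := by
  refine ⟨gammaPlus_mem_wDomain hβ h, Or.inl ?_⟩
  rw [Complex.sub_re, re_gammaPlus hβ h, Complex.ofReal_re]
  linarith [tPlus_le_xPlus (β := β) h, tMinus_lt_tPlus hβ]

lemma integral_gammaPlus_of_primitive {β b : ℝ} {F G : ℂ → ℂ} (hβ : 0 < β)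
    (hF : ContinuousOn F (wDomain β \ {(tMinus β : ℂ)}))
    (hG : ∀ z ∈ rightDomain β, HasDerivAt G (F z) z) (hb0 : 0 < b) (hb : b < Real.pi / 2) :
    ∫ θ in (-b)..b, pathIntegrand F (gammaPlus β) θ =
      G (gammaPlus β b) - G (gammaPlus β (-b)) := by
  refine integral_pathIntegrand (Set.countable_singleton 0) (fun θ hθ =>
      (continuousAt_gammaPlus hβ (abs_lt_of_mem_uIcc hb0 hb hθ)).continuousWithinAt) ?_ ?_
      (intervalIntegrable_gammaPlus hβ hF hb0 hb)
  · intro t ht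
    have ht' := abs_lt_of_mem_uIcc hb0 hb (Set.Ioo_subset_Icc_self ht.1)
    exact (hasDerivAt_gammaPlus hβ ht' ht.2).differentiableAt.hasDerivAt
  · intro t ht
    exact hG _ (gammaPlus_mem_rightDomain hβ (abs_lt_of_mem_uIcc hb0 hb ht))

/-- `F` is `O(|z| ^ (-3/2))` in the part `Re z ≤ cosh β` of the slit plane. -/
def OuterDecay (β R C : ℝ) (F : ℂ → ℂ) : Prop :=
  0 ≤ C ∧ ∀ z : ℂ, R ≤ ‖z‖ → z.im ≠ 0 → z.re ≤ Real.cosh β → ‖F z‖ ≤ C * ‖z‖ ^ (-(3 / 2) : ℝ)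

/-- The end of a truncated `Γ₊` is joined to the end of a half line of the keyhole by a horizontal
and a vertical segment. They stay off the real axis and at distance at least `|y|` from the origin,
and have total length at most `2 |y| + cosh β`. Decay of order `3/2` therefore makes the mean value
bound tend to zero. -/
lemma norm_primitive_sub_le {β R C x y ε : ℝ} {F G : ℂ → ℂ} (hF : OuterDecay β R C F)
    (hG : ∀ z : ℂ, z.im ≠ 0 → HasDerivAt G (F z) z) (hR : R ≤ |y|) (hε : 0 < y * ε)
    (hx0 : 0 ≤ x) (hx : x ≤ Real.cosh β) (hεy : |ε| ≤ |y|) :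
    ‖G (x + y * Complex.I) - G (-|y| + ε * Complex.I)‖ ≤
      C * |y| ^ (-(3 / 2) : ℝ) * (2 * |y| + Real.cosh β) := by
  have hy : y ≠ 0 := fun h => by simp [h] at hε
  have hy0 : 0 < |y| := abs_pos.2 hy
  have hbound : ∀ z : ℂ, |y| ≤ ‖z‖ → z.im ≠ 0 → z.re ≤ Real.cosh β →
      ‖F z‖ ≤ C * |y| ^ (-(3 / 2) : ℝ) := fun z h1 h2 h3 => by
    refine (hF.2 z (hR.trans h1) h2 h3).trans (mul_le_mul_of_nonneg_left ?_ hF.1)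
    exact Real.rpow_le_rpow_of_nonpos hy0 h1 (by norm_num)
  have hcosh := Real.cosh_pos β
  have h1 : ‖G (x + y * Complex.I) - G (-|y| + y * Complex.I)‖ ≤
      C * |y| ^ (-(3 / 2) : ℝ) * ‖((x : ℂ) + y * Complex.I) - (-|y| + y * Complex.I)‖ := by
    refine Convex.norm_image_sub_le_of_norm_hasDerivWithin_le (f' := F)
      (s := {z : ℂ | z.im = y ∧ z.re ≤ Real.cosh β}) ?_ ?_ ?_ ?_ ?_
    · exact fun z hz => (hG z (hz.1 ▸ hy)).hasDerivWithinAt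
    · exact fun z hz => hbound z (hz.1 ▸ Complex.abs_im_le_norm z) (hz.1 ▸ hy) hz.2
    · intro u hu v hv p q hp hq hpq
      refine ⟨?_, ?_⟩
      · simp [hu.1, hv.1, ← add_mul, hpq]
      · have := hu.2
        have := hv.2
        simp only [Complex.add_re, Complex.real_smul, Complex.re_ofReal_mul]
        have : q = 1 - p := by linarith
        subst this
        nlinarith
    · exact ⟨by simp, by simp; linarith⟩
    · exact ⟨by simp, by simp; linarith⟩
  have h2 : ‖G (-|y| + y * Complex.I) - G (-|y| + ε * Complex.I)‖ ≤
      C * |y| ^ (-(3 / 2) : ℝ) * ‖(-((|y| : ℝ) : ℂ) + y * Complex.I) - (-|y| + ε * Complex.I)‖ := by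
    refine Convex.norm_image_sub_le_of_norm_hasDerivWithin_le (f' := F)
      (s := {z : ℂ | z.re = -|y| ∧ 0 < y * z.im}) ?_ ?_ ?_ ?_ ?_
    · exact fun z hz => (hG z fun h => by simpa [h] using hz.2).hasDerivWithinAt
    · refine fun z hz => hbound z ?_ (fun h => by simpa [h] using hz.2) (by rw [hz.1]; linarith)
      have := Complex.abs_re_le_norm z
      rwa [hz.1, abs_neg, abs_abs] at this
    · intro u hu v hv p q hp hq hpq
      refine ⟨?_, ?_⟩
      · have : q = 1 - p := by linarith
        subst this
        simp [hu.1, hv.1]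
        ring
      · simp only [Complex.add_im, Complex.real_smul, Complex.im_ofReal_mul]
        have h1 := hu.2
        have h2 := hv.2
        rcases hp.eq_or_lt with h | h
        · have : q = 1 := by linarith
          rw [← h, this]; simpa using h2
        · nlinarith [mul_pos h h1, mul_nonneg hq h2.le]
    · exact ⟨by simp, by simpa using hε⟩
    · exact ⟨by simp, by simpa using mul_self_pos.2 hy⟩
  have n1 : ‖((x : ℂ) + y * Complex.I) - (-|y| + y * Complex.I)‖ = x + |y| := by
    rw [show ((x : ℂ) + y * Complex.I) - (-|y| + y * Complex.I) = ((x + |y| : ℝ) : ℂ) by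
      push_cast; ring, Complex.norm_real, Real.norm_of_nonneg (by positivity)]
  have n2 : ‖(-((|y| : ℝ) : ℂ) + y * Complex.I) - (-|y| + ε * Complex.I)‖ ≤ |y| := by
    rw [show (-((|y| : ℝ) : ℂ) + y * Complex.I) - (-|y| + ε * Complex.I) =
      ((y - ε : ℝ) : ℂ) * Complex.I by push_cast; ring, norm_mul, Complex.norm_I, mul_one,
      Complex.norm_real, Real.norm_eq_abs]
    rcases lt_or_gt_of_ne hy with h | h
    · have : ε < 0 := by nlinarith
      rw [abs_of_neg h, abs_of_neg this] at hεy
      rw [abs_of_neg h, abs_le]; constructor <;> linarith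
    · have : 0 < ε := by nlinarith
      rw [abs_of_pos h, abs_of_pos this] at hεy
      rw [abs_of_pos h, abs_le]; constructor <;> linarith
  have hK : 0 ≤ C * |y| ^ (-(3 / 2) : ℝ) := mul_nonneg hF.1 (by positivity)
  calc _ = ‖(G (x + y * Complex.I) - G (-|y| + y * Complex.I)) +
        (G (-|y| + y * Complex.I) - G (-|y| + ε * Complex.I))‖ := by congr 1; ring
    _ ≤ _ := norm_add_le _ _
    _ ≤ C * |y| ^ (-(3 / 2) : ℝ) * (x + |y|) + C * |y| ^ (-(3 / 2) : ℝ) * |y| := by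
        rw [n1] at h1
        exact add_le_add h1 (h2.trans (mul_le_mul_of_nonneg_left n2 hK))
    _ ≤ _ := by nlinarith

lemma sub_const_of_hasDerivAt {F G₁ G₂ : ℂ → ℂ} {s : Set ℂ} (hs : IsOpen s) (hc : Convex ℝ s)
    (h1 : ∀ z ∈ s, HasDerivAt G₁ (F z) z) (h2 : ∀ z ∈ s, HasDerivAt G₂ (F z) z) {u v : ℂ}
    (hu : u ∈ s) (hv : v ∈ s) : G₂ u - G₁ u = G₂ v - G₁ v := by
  refine hs.is_const_of_deriv_eq_zero hc.isPreconnected (f := G₂ - G₁)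
    (fun z hz => ((h2 z hz).sub (h1 z hz)).differentiableAt.differentiableWithinAt)
    (fun z hz => ?_) hu hv
  rw [((h2 z hz).sub (h1 z hz)).deriv, sub_self]
  rfl

/-- Truncated contour integrals over `Γ₀ ∪ Γ₊` approximate the integral over a circle around
`t₋`. -/
lemma norm_truncated_sub_circleIntegral_le {β δ b R C ρ : ℝ} {F : ℂ → ℂ} (hβ : 0 < β)
    (hF : DifferentiableOn ℂ F (wDomain β \ {(tMinus β : ℂ)})) (hdec : OuterDecay β R C F)
    (hρ : 0 < ρ) (hρc : ρ < tMinus β) (hρt : ρ ≤ tPlus β - tMinus β)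
    (hδ : 0 < δ) (hδc : δ < tMinus β) (hb0 : 0 < b) (hb : b < Real.pi / 2)
    (hR : R ≤ (gammaPlus β b).im) (hδb : δ ≤ (gammaPlus β b).im) :
    ‖keyhole δ (gammaPlus β b).im F + (∫ θ in (-b)..b, pathIntegrand F (gammaPlus β) θ) -
      ∮ z in C((tMinus β : ℂ), ρ), F z‖ ≤
      2 * (C * (gammaPlus β b).im ^ (-(3 / 2) : ℝ) *
        (2 * (gammaPlus β b).im + Real.cosh β)) := by
  obtain ⟨G₁, hG₁⟩ := exists_primitive_of_starConvex (isOpen_leftDomain β)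
    (starConvex_leftDomain β) (hF.mono (leftDomain_subset hβ))
  obtain ⟨G₂, hG₂⟩ := exists_primitive_of_starConvex (isOpen_rightDomain hβ)
    (starConvex_rightDomain hβ) (hF.mono rightDomain_subset)
  have hbabs : |b| < Real.pi / 2 := by rwa [abs_of_pos hb0]
  have hbabs' : |-b| < Real.pi / 2 := by rwa [abs_neg]
  set L := (gammaPlus β b).im with hL
  have hL0 : 0 < L := hδ.trans_le hδb
  have hγb : gammaPlus β b = xPlus β b + L * Complex.I := by
    apply Complex.ext
    · rw [re_gammaPlus hβ hbabs]; simp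
    · simp [hL]
  have hxn : xPlus β (-b) = xPlus β b := by simp [xPlus, sPlus, thetaCot_neg]
  have hγb' : gammaPlus β (-b) = xPlus β b + (-L : ℝ) * Complex.I := by
    apply Complex.ext
    · rw [re_gammaPlus hβ hbabs', hxn]; simp
    · rw [im_gammaPlus hβ, hxn, Real.tan_neg]
      rw [hL, im_gammaPlus hβ]
      simp [-Complex.ofReal_tan]
  have hup := norm_primitive_sub_le (ε := δ) hdec (fun z hz => hG₁ z (mem_leftDomain_of_im_ne_zero hz))
    (show R ≤ |L| by rwa [abs_of_pos hL0]) (by positivity) (xPlus_pos hbabs).le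
    (xPlus_le_cosh hbabs) (by rwa [abs_of_pos hL0, abs_of_pos hδ])
  have hlow := norm_primitive_sub_le (ε := -δ) hdec
    (fun z hz => hG₁ z (mem_leftDomain_of_im_ne_zero hz))
    (show R ≤ |-L| by rwa [abs_neg, abs_of_pos hL0]) (by nlinarith) (xPlus_pos hbabs).le
    (xPlus_le_cosh hbabs) (by rwa [abs_neg, abs_neg, abs_of_pos hL0, abs_of_pos hδ])
  rw [← hγb, abs_of_pos hL0] at hup
  rw [← hγb', abs_neg, abs_of_pos hL0] at hlow
  have hcirc : (∮ z in C((tMinus β : ℂ), ρ), F z) = _ :=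
    circleIntegral_eq_of_primitives (G₁ := G₁) (G₂ := G₂) hρ.le ?_ ?_ ?_
  rotate_left
  · refine hF.continuousOn.mono fun z hz => ?_
    have hz1 : ‖z - tMinus β‖ = ρ := mem_sphere_iff_norm.1 hz
    refine ⟨?_, fun h => ?_⟩
    · by_cases him : z.im = 0
      · obtain ⟨t, rfl⟩ : ∃ t : ℝ, z = t := ⟨z.re, by apply Complex.ext <;> simp [him]⟩
        rw [← Complex.ofReal_sub, Complex.norm_real, Real.norm_eq_abs] at hz1
        have := abs_le.1 hz1.le
        exact ofReal_mem_wDomain (by linarith) (by linarith)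
      · exact mem_wDomain_of_im_ne_zero him
    · rw [Set.mem_singleton_iff.1 h] at hz1
      simp at hz1
      linarith
  · intro z hz hre
    have hz1 : ‖z - tMinus β‖ = ρ := mem_sphere_iff_norm.1 hz
    by_cases him : z.im = 0
    · obtain ⟨t, rfl⟩ : ∃ t : ℝ, z = t := ⟨z.re, by apply Complex.ext <;> simp [him]⟩
      rw [← Complex.ofReal_sub, Complex.norm_real, Real.norm_eq_abs] at hz1
      simp only [Complex.ofReal_re] at hre
      rw [abs_of_nonneg (by linarith)] at hz1
      refine hG₂ _ ⟨ofReal_mem_wDomain (by linarith [tMinus_pos β]) (by linarith), ?_⟩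
      rw [Set.mem_preimage, ← Complex.ofReal_sub]
      exact ofReal_mem_slitPlane (by linarith)
    · exact hG₂ _ (mem_rightDomain_of_im_ne_zero him)
  · intro z hz hre
    have hz1 : ‖z - tMinus β‖ = ρ := mem_sphere_iff_norm.1 hz
    by_cases him : z.im = 0
    · obtain ⟨t, rfl⟩ : ∃ t : ℝ, z = t := ⟨z.re, by apply Complex.ext <;> simp [him]⟩
      rw [← Complex.ofReal_sub, Complex.norm_real, Real.norm_eq_abs] at hz1
      simp only [Complex.ofReal_re] at hre
      rw [abs_of_nonpos (by linarith)] at hz1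
      exact hG₁ _ (mem_leftDomain_of_re (by simp; linarith) (by simp; linarith))
    · exact hG₁ _ (mem_leftDomain_of_im_ne_zero him)
  -- Two primitives of `F` differ by a constant on each open half plane. The jumps at `t₋ ± i ρ`
  -- that make up the circle integral can therefore be moved to the ends of the truncated `Γ₊`.
  have hconst_up : G₂ (gammaPlus β b) - G₁ (gammaPlus β b) =
      G₂ (tMinus β + ρ * Complex.I) - G₁ (tMinus β + ρ * Complex.I) :=
    sub_const_of_hasDerivAt (s := {z : ℂ | 0 < z.im}) (isOpen_lt continuous_const Complex.continuous_im)
      (convex_halfSpace_im_gt 0)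
      (fun z hz => hG₁ z (mem_leftDomain_of_im_ne_zero (ne_of_gt hz)))
      (fun z hz => hG₂ z (mem_rightDomain_of_im_ne_zero (ne_of_gt hz))) hL0 (by simpa using hρ)
  have hconst_low : G₂ (gammaPlus β (-b)) - G₁ (gammaPlus β (-b)) =
      G₂ (tMinus β - ρ * Complex.I) - G₁ (tMinus β - ρ * Complex.I) :=
    sub_const_of_hasDerivAt (s := {z : ℂ | z.im < 0}) (isOpen_lt Complex.continuous_im continuous_const)
      (convex_halfSpace_im_lt 0)
      (fun z hz => hG₁ z (mem_leftDomain_of_im_ne_zero (ne_of_lt hz)))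
      (fun z hz => hG₂ z (mem_rightDomain_of_im_ne_zero (ne_of_lt hz)))
      (by rw [hγb']; simpa using hL0) (by simpa using hρ)
  rw [keyhole_eq_of_primitive (hF.continuousOn.mono (leftDomain_subset hβ)) hG₁ hδ hδc,
    integral_gammaPlus_of_primitive hβ hF.continuousOn hG₂ hb0 hb, hcirc, ← hconst_up,
    ← hconst_low]
  have e : (-L - δ * Complex.I : ℂ) = -(L : ℂ) + ((-δ : ℝ) : ℂ) * Complex.I := by
    push_cast; ring
  rw [e]
  calc _ = ‖(G₁ (gammaPlus β b) - G₁ (-L + δ * Complex.I)) -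
        (G₁ (gammaPlus β (-b)) - G₁ (-L + (-δ : ℝ) * Complex.I))‖ := by congr 1; ring
    _ ≤ _ := norm_sub_le _ _
    _ ≤ _ := by linarith

lemma tendsto_im_gammaPlus {β : ℝ} (hβ : 0 < β) :
    Tendsto (fun b => (gammaPlus β b).im) (𝓝[<] (Real.pi / 2)) atTop := by
  refine tendsto_atTop_mono' _ (f₁ := fun b => tPlus β * Real.tan b) ?_
    (Real.tendsto_tan_pi_div_two.const_mul_atTop (tPlus_pos β))
  have : Set.Ioo 0 (Real.pi / 2) ∈ 𝓝[<] (Real.pi / 2) := Ioo_mem_nhdsLT (by positivity)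
  filter_upwards [this] with b hb
  rw [im_gammaPlus hβ]
  refine mul_le_mul_of_nonneg_right (tPlus_le_xPlus ?_)
    (Real.tan_nonneg_of_nonneg_of_le_pi_div_two hb.1.le hb.2.le)
  rw [abs_of_pos hb.1]
  exact hb.2

lemma tendsto_truncation_error (C a : ℝ) :
    Tendsto (fun L : ℝ => 2 * (C * L ^ (-(3 / 2) : ℝ) * (2 * L + a))) atTop (𝓝 0) := by
  have h1 : Tendsto (fun L : ℝ => L ^ (-(1 / 2) : ℝ)) atTop (𝓝 0) :=
    tendsto_rpow_neg_atTop (by norm_num)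
  have h2 : Tendsto (fun L : ℝ => L ^ (-(3 / 2) : ℝ)) atTop (𝓝 0) :=
    tendsto_rpow_neg_atTop (by norm_num)
  have h3 : Tendsto (fun L : ℝ => 4 * C * L ^ (-(1 / 2) : ℝ) + 2 * C * a * L ^ (-(3 / 2) : ℝ))
      atTop (𝓝 0) := by
    simpa using (h1.const_mul (4 * C)).add (h2.const_mul (2 * C * a))
  refine h3.congr' ?_
  filter_upwards [eventually_gt_atTop 0] with L hL
  have : L ^ (-(1 / 2) : ℝ) = L ^ (-(3 / 2) : ℝ) * L := by
    rw [← Real.rpow_add_one hL.ne']; norm_num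
  rw [this]; ring

/-- The integral over `Γ₀ ∪ Γ₊` equals the integral over a small circle around `t₋`. -/
lemma contourIntegral_eq_circleIntegral {β δ R C ρ : ℝ} {F : ℂ → ℂ} (hβ : 0 < β)
    (hF : DifferentiableOn ℂ F (wDomain β \ {(tMinus β : ℂ)})) (hdec : OuterDecay β R C F)
    (hρ : 0 < ρ) (hρc : ρ < tMinus β) (hρt : ρ ≤ tPlus β - tMinus β)
    (hδ : 0 < δ) (hδc : δ < tMinus β) (hint : ContourIntegrable β δ F) :
    contourIntegral β δ F = ∮ z in C((tMinus β : ℂ), ρ), F z := by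
  obtain ⟨i1, -, i3, i4⟩ := hint
  have hL := tendsto_im_gammaPlus hβ
  have hneg := tendsto_neg_atTop_atBot.comp hL
  -- One parameter governs both truncations: the half lines are cut at `-L`, where `L` is the height
  -- of the end point of `Γ₊`, and `L → ∞` as `b → π/2`.
  have t1 := (intervalIntegral_tendsto_integral_Iic (0 : ℝ)
    ((integrableOn_Iic_iff_integrableOn_Iio).2 i1) tendsto_neg_atTop_atBot).comp hL
  have t3 := (intervalIntegral_tendsto_integral_Iic (0 : ℝ)
    ((integrableOn_Iic_iff_integrableOn_Iio).2 i3) tendsto_neg_atTop_atBot).comp hL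
  rw [integral_Iic_eq_integral_Iio] at t1 t3
  have t4 : Tendsto (fun b => ∫ θ in (-b)..b, pathIntegrand F (gammaPlus β) θ)
      (𝓝[<] (Real.pi / 2))
      (𝓝 (∫ θ in Set.Ioo (-(Real.pi / 2)) (Real.pi / 2), pathIntegrand F (gammaPlus β) θ)) := by
    have hcov : AECover (volume.restrict (Set.Ioo (-(Real.pi / 2)) (Real.pi / 2)))
        (𝓝[<] (Real.pi / 2)) (fun b => Set.Ioc (-b) b) :=
      aecover_Ioo_of_Ioc (tendsto_nhdsWithin_of_tendsto_nhds tendsto_id).neg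
        (tendsto_nhdsWithin_of_tendsto_nhds tendsto_id)
    have := hcov.integral_tendsto_of_countably_generated i4
    refine this.congr' ?_
    have : Set.Ioo 0 (Real.pi / 2) ∈ 𝓝[<] (Real.pi / 2) := Ioo_mem_nhdsLT (by positivity)
    filter_upwards [this] with b hb
    rw [intervalIntegral.integral_of_le (by linarith [hb.1]),
      Measure.restrict_restrict measurableSet_Ioc, Set.inter_eq_left.2]
    intro x hx
    exact ⟨by linarith [hx.1, hb.2], hx.2.trans_lt hb.2⟩
  have hT : Tendsto (fun b => keyhole δ (gammaPlus β b).im F +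
      (∫ θ in (-b)..b, pathIntegrand F (gammaPlus β) θ)) (𝓝[<] (Real.pi / 2))
      (𝓝 (contourIntegral β δ F)) :=
    (((t1.add_const _).sub t3).add t4)
  have hT' : Tendsto (fun b => keyhole δ (gammaPlus β b).im F +
      (∫ θ in (-b)..b, pathIntegrand F (gammaPlus β) θ)) (𝓝[<] (Real.pi / 2))
      (𝓝 (∮ z in C((tMinus β : ℂ), ρ), F z)) := by
    rw [tendsto_iff_norm_sub_tendsto_zero]
    refine squeeze_zero' (Eventually.of_forall fun _ => norm_nonneg _) ?_
      ((tendsto_truncation_error C (Real.cosh β)).comp hL)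
    have : Set.Ioo 0 (Real.pi / 2) ∈ 𝓝[<] (Real.pi / 2) := Ioo_mem_nhdsLT (by positivity)
    filter_upwards [this, hL.eventually_ge_atTop R, hL.eventually_ge_atTop δ] with b hb h1 h2
    exact norm_truncated_sub_circleIntegral_le hβ hF hdec hρ hρc hρt hδ hδc hb.1 hb.2 h1 h2
  exact tendsto_nhds_unique hT hT'

/-! ### The Cauchy transform of a Gaussian -/

/-- The integrand of `gaussTransform`. -/
def gaussKernel (N : ℝ) (w : ℂ) (τ : ℝ) : ℂ :=
  Complex.exp (((-(1 / (4 * N)) : ℝ) : ℂ) * (τ : ℂ) ^ 2 + -Complex.I * w * τ + 0)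

/-- The entire continuation of `∫ exp (-N v²) / (w - v) dv` from the lower half plane. -/
def gaussTransform (N : ℝ) (w : ℂ) : ℂ :=
  Complex.I * (√(Real.pi / N) : ℂ) * ∫ τ in Set.Ioi (0 : ℝ), gaussKernel N w τ

lemma norm_gaussKernel (N : ℝ) (w : ℂ) (τ : ℝ) :
    ‖gaussKernel N w τ‖ = Real.exp (-(1 / (4 * N)) * τ ^ 2 + w.im * τ) := by
  rw [gaussKernel, Complex.norm_exp]
  congr 1
  simp only [Complex.add_re, ← Complex.ofReal_pow, ← Complex.ofReal_mul, Complex.ofReal_re,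
    Complex.ofReal_im, Complex.zero_re, Complex.neg_re, Complex.mul_re, Complex.I_re,
    Complex.I_im, Complex.neg_im, Complex.mul_im]
  ring

/-- Completing the square spends half of the Gaussian on the factor `exp (K τ)`; the other half is
left for integrability, uniformly in `Im w ≤ K`. -/
lemma norm_gaussKernel_le {N K : ℝ} (hN : 0 < N) {w : ℂ} {τ : ℝ} (hτ : 0 ≤ τ) (hw : w.im ≤ K) :
    ‖gaussKernel N w τ‖ ≤ Real.exp (2 * N * K ^ 2) * Real.exp (-(1 / (8 * N)) * τ ^ 2) := by
  rw [norm_gaussKernel, ← Real.exp_add, Real.exp_le_exp]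
  have h1 : w.im * τ ≤ K * τ := mul_le_mul_of_nonneg_right hw hτ
  have h2 : 0 ≤ (τ - 8 * N * K / 2) ^ 2 / (8 * N) := by positivity
  have h3 : (τ - 8 * N * K / 2) ^ 2 / (8 * N) =
      1 / (8 * N) * τ ^ 2 - K * τ + 2 * N * K ^ 2 := by field_simp; ring
  have h4 : 1 / (4 * N) * τ ^ 2 = 2 * (1 / (8 * N) * τ ^ 2) := by field_simp; ring
  linarith

lemma neg_inv_re_neg {N : ℝ} (hN : 0 < N) : (((-(1 / (4 * N)) : ℝ) : ℂ)).re < 0 := by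
  rw [Complex.ofReal_re, neg_lt_zero]
  positivity

lemma integrable_gaussKernel {N : ℝ} (hN : 0 < N) (w : ℂ) : Integrable (gaussKernel N w) :=
  integrable_cexp_quadratic' (neg_inv_re_neg hN) _ _

lemma hasDerivAt_gaussKernel (N : ℝ) (w : ℂ) (τ : ℝ) :
    HasDerivAt (fun w => gaussKernel N w τ) (-Complex.I * τ * gaussKernel N w τ) w := by
  have h := (((((hasDerivAt_id w).const_mul (-Complex.I)).mul_const (τ : ℂ)).const_add
    (((-(1 / (4 * N)) : ℝ) : ℂ) * (τ : ℂ) ^ 2)).add_const 0).cexp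
  refine h.congr_deriv ?_
  simp only [gaussKernel, id]
  ring

lemma differentiable_gaussTransform {N : ℝ} (hN : 0 < N) :
    Differentiable ℂ (gaussTransform N) := by
  intro w
  have hcont : Continuous (gaussKernel N w) := by unfold gaussKernel; fun_prop
  have h := (hasDerivAt_integral_of_dominated_loc_of_deriv_le
    (μ := volume.restrict (Set.Ioi (0 : ℝ))) (F := fun w τ => gaussKernel N w τ)
    (F' := fun w τ => -Complex.I * τ * gaussKernel N w τ)
    (bound := fun τ => Real.exp (2 * N * (|w.im| + 1) ^ 2) *
      (τ * Real.exp (-(1 / (8 * N)) * τ ^ 2)))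
    (Metric.ball_mem_nhds w zero_lt_one) ?_ ?_ ?_ ?_ ?_ ?_).2
  · exact (h.differentiableAt).const_mul _
  · exact Eventually.of_forall fun w => (integrable_gaussKernel hN w).integrableOn.aestronglyMeasurable
  · exact (integrable_gaussKernel hN w).integrableOn
  · exact (by fun_prop : Continuous fun τ : ℝ =>
      -Complex.I * τ * gaussKernel N w τ).aestronglyMeasurable
  · filter_upwards [ae_restrict_mem measurableSet_Ioi] with τ hτ w' hw'
    have hτ : 0 < τ := hτ
    have h1 : w'.im ≤ |w.im| + 1 := by
      have h2 := (Complex.abs_im_le_norm (w' - w)).trans (mem_ball_iff_norm.1 hw').le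
      rw [Complex.sub_im] at h2
      linarith [(abs_le.1 h2).2, le_abs_self w.im]
    rw [norm_mul, norm_mul, norm_neg, Complex.norm_I, one_mul, Complex.norm_real,
      Real.norm_of_nonneg hτ.le]
    nlinarith [norm_gaussKernel_le hN hτ.le h1]
  · exact ((integrable_mul_exp_neg_mul_sq (by positivity)).const_mul _).integrableOn
  · exact ae_of_all _ fun τ w' _ => hasDerivAt_gaussKernel N w' τ

/-- In `Im w ≤ 1` the transform is `O(1 / |w|)`. -/
lemma exists_norm_gaussTransform_le {N : ℝ} (hN : 0 < N) :
    ∃ C, 0 ≤ C ∧ ∀ w : ℂ, w.im ≤ 1 → w ≠ 0 → ‖gaussTransform N w‖ ≤ C / ‖w‖ := by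
  set B : ℝ := ∫ τ in Set.Ioi (0 : ℝ), Real.exp (2 * N * 1 ^ 2) / (2 * N) *
    (τ * Real.exp (-(1 / (8 * N)) * τ ^ 2)) with hB
  have hBi : IntegrableOn (fun τ : ℝ => Real.exp (2 * N * 1 ^ 2) / (2 * N) *
      (τ * Real.exp (-(1 / (8 * N)) * τ ^ 2))) (Set.Ioi 0) :=
    ((integrable_mul_exp_neg_mul_sq (by positivity)).const_mul _).integrableOn
  have hB0 : 0 ≤ B := setIntegral_nonneg measurableSet_Ioi fun τ hτ => by
    have : 0 < τ := hτ
    positivity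
  refine ⟨√(Real.pi / N) * (1 + B), by positivity, fun w hw hw0 => ?_⟩
  have hcont : Continuous (gaussKernel N w) := by unfold gaussKernel; fun_prop
  set J := ∫ τ in Set.Ioi (0 : ℝ), gaussKernel N w τ with hJ
  have hi := (integrable_gaussKernel hN w).integrableOn (s := Set.Ioi 0)
  have hle : ∀ τ ∈ Set.Ioi (0 : ℝ), ‖((τ / (2 * N) : ℝ) : ℂ) * gaussKernel N w τ‖ ≤
      Real.exp (2 * N * 1 ^ 2) / (2 * N) * (τ * Real.exp (-(1 / (8 * N)) * τ ^ 2)) := fun τ hτ => by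
    have hτ : 0 < τ := hτ
    rw [norm_mul, Complex.norm_real, Real.norm_of_nonneg (by positivity)]
    calc _ ≤ τ / (2 * N) * (Real.exp (2 * N * 1 ^ 2) * Real.exp (-(1 / (8 * N)) * τ ^ 2)) := by
          gcongr
          exact norm_gaussKernel_le hN hτ.le hw
      _ = _ := by ring
  have hi2 : IntegrableOn (fun τ : ℝ => ((τ / (2 * N) : ℝ) : ℂ) * gaussKernel N w τ)
      (Set.Ioi 0) := by
    refine Integrable.mono' hBi (by fun_prop : Continuous _).aestronglyMeasurable ?_
    filter_upwards [ae_restrict_mem measurableSet_Ioi] with τ hτ using hle τ hτ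
  have hB2 : ‖∫ τ in Set.Ioi (0 : ℝ), ((τ / (2 * N) : ℝ) : ℂ) * gaussKernel N w τ‖ ≤ B :=
    norm_integral_le_of_norm_le hBi (by
      filter_upwards [ae_restrict_mem measurableSet_Ioi] with τ hτ using hle τ hτ)
  -- Integration by parts: the integrand is the derivative of the kernel. It expresses `w` times the
  -- integral through a boundary term and a bounded integral, which is the decay `1 / |w|`.
  have hFTC : ∫ τ in Set.Ioi (0 : ℝ), (-Complex.I * w * gaussKernel N w τ -
      ((τ / (2 * N) : ℝ) : ℂ) * gaussKernel N w τ) = 0 - gaussKernel N w 0 := by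
    refine integral_Ioi_of_hasDerivAt_of_tendsto' (fun τ _ => ?_)
      ((hi.const_mul _).sub hi2) ?_
    · have h1 := Complex.ofRealCLM.hasDerivAt (x := τ)
      have h2 : HasDerivAt (gaussKernel N w) (gaussKernel N w τ * _) τ :=
        ((((h1.fun_pow 2).const_mul ((-(1 / (4 * N)) : ℝ) : ℂ)).fun_add
        (h1.const_mul (-Complex.I * w))).add_const 0).cexp
      refine h2.congr_deriv ?_
      have : (N : ℂ) ≠ 0 := by exact_mod_cast hN.ne'
      generalize gaussKernel N w τ = g
      simp only [Complex.ofRealCLM_apply]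
      push_cast
      field_simp
      ring
    · rw [tendsto_zero_iff_norm_tendsto_zero]
      have hlim : Tendsto (fun τ : ℝ => Real.exp (2 * N * 1 ^ 2) *
          Real.exp (-(1 / (8 * N)) * τ ^ 2)) atTop (𝓝 0) := by
        have h1 : Tendsto (fun τ : ℝ => -(1 / (8 * N)) * τ ^ 2) atTop atBot :=
          (tendsto_pow_atTop two_ne_zero).const_mul_atTop_of_neg (by
            rw [neg_lt_zero]; positivity)
        have h2 := (Real.tendsto_exp_atBot.comp h1).const_mul (Real.exp (2 * N * 1 ^ 2))
        rw [mul_zero] at h2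
        exact h2
      refine squeeze_zero' (Eventually.of_forall fun _ => norm_nonneg _) ?_ hlim
      filter_upwards [eventually_ge_atTop 0] with τ hτ using norm_gaussKernel_le hN hτ hw
  rw [integral_sub (hi.const_mul _) hi2, integral_const_mul] at hFTC
  have h0 : gaussKernel N w 0 = 1 := by simp [gaussKernel]
  rw [h0] at hFTC
  have hwJ : ‖w‖ * ‖J‖ ≤ 1 + B := by
    have e : -Complex.I * w * J = -1 +
        ∫ τ in Set.Ioi (0 : ℝ), ((τ / (2 * N) : ℝ) : ℂ) * gaussKernel N w τ := by
      linear_combination hFTC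
    have := congrArg norm e
    rw [norm_mul, norm_mul, norm_neg, Complex.norm_I, one_mul] at this
    rw [this]
    refine (norm_add_le _ _).trans (add_le_add ?_ hB2)
    simp
  have hw0' : 0 < ‖w‖ := norm_pos_iff.2 hw0
  rw [gaussTransform, norm_mul, norm_mul, Complex.norm_I, one_mul, Complex.norm_real,
    Real.norm_of_nonneg (Real.sqrt_nonneg _), le_div_iff₀ hw0', mul_assoc]
  refine mul_le_mul_of_nonneg_left ?_ (Real.sqrt_nonneg _)
  linarith

lemma cpow_half_ofReal {x : ℝ} (hx : 0 ≤ x) : (x : ℂ) ^ (1 / 2 : ℂ) = (√x : ℂ) := by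
  rw [Real.sqrt_eq_rpow, Complex.ofReal_cpow hx]
  norm_num

/-- Under `τ ↦ -τ` the two half-line integrals become one Fourier integral of a Gaussian over the
real line. This jump produces the Hermite polynomial from the left part of the contour. -/
lemma gaussTransform_add_neg {N : ℝ} (hN : 0 < N) (w : ℂ) :
    gaussTransform N w + gaussTransform N (-w) =
      2 * Real.pi * Complex.I * Complex.exp (-N * w ^ 2) := by
  have hi := integrable_gaussKernel hN w
  have h1 : ∫ τ in Set.Ioi (0 : ℝ), gaussKernel N (-w) τ =
      ∫ τ in Set.Iic (0 : ℝ), gaussKernel N w τ := by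
    have := integral_comp_neg_Ioi 0 (gaussKernel N w)
    rw [neg_zero] at this
    rw [← this]
    refine integral_congr_ae (ae_of_all _ fun τ => ?_)
    simp [gaussKernel]
  have hN0 : (N : ℂ) ≠ 0 := by exact_mod_cast hN.ne'
  have h2 : ∫ τ, gaussKernel N w τ = (√(Real.pi * (4 * N)) : ℂ) * Complex.exp (-N * w ^ 2) := by
    have := integral_cexp_quadratic (neg_inv_re_neg hN) (-Complex.I * w) 0
    simp only [gaussKernel]
    rw [this]
    congr 1
    · rw [← cpow_half_ofReal (by positivity)]
      congr 1
      push_cast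
      field_simp
    · congr 1
      push_cast
      field_simp
      rw [Complex.I_sq]
      ring
  have h3 := intervalIntegral.integral_Iic_add_Ioi (hi.integrableOn (s := Set.Iic 0))
    (hi.integrableOn (s := Set.Ioi 0))
  rw [gaussTransform, gaussTransform, h1, ← mul_add, add_comm (∫ τ in Set.Ioi (0 : ℝ), _), h3, h2]
  have h4 : √(Real.pi / N) * √(Real.pi * (4 * N)) = 2 * Real.pi := by
    rw [← Real.sqrt_mul (by positivity), show Real.pi / N * (Real.pi * (4 * N)) = (2 * Real.pi) ^ 2 by
      field_simp; ring, Real.sqrt_sq (by positivity)]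
  have h5 : (√(Real.pi / N) : ℂ) * (√(Real.pi * (4 * N)) : ℂ) = 2 * Real.pi := by
    exact_mod_cast congrArg Complex.ofReal h4
  linear_combination (Complex.I * Complex.exp (-N * w ^ 2)) * h5

lemma sub_ofReal_ne_zero {w : ℂ} (hw : w.im < 0) (v : ℝ) : w - v ≠ 0 := fun h => by
  have := congrArg Complex.im h
  simp at this
  linarith

/-- In the lower half plane `gaussTransform` is the Cauchy transform of the Gaussian. -/
lemma gaussTransform_eq_integral {N : ℝ} (hN : 0 < N) {w : ℂ} (hw : w.im < 0) :
    gaussTransform N w = ∫ v : ℝ, ((Real.exp (-N * v ^ 2) : ℝ) : ℂ) * (w - v)⁻¹ := by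
  have hN0 : (N : ℂ) ≠ 0 := by exact_mod_cast hN.ne'
  -- For `Im w < 0` one has `1 / (w - v) = i ∫₀^∞ exp (-i (w - v) τ) dτ`. Integrating `g` first in
  -- `v` gives the kernel, first in `τ` the Cauchy transform; Fubini applies since `|g|` is a
  -- product.
  set g : ℝ → ℝ → ℂ := fun τ v =>
    Complex.exp (-Complex.I * w * τ) * Complex.exp (-(N : ℂ) * (v : ℂ) ^ 2 + Complex.I * τ * v + 0)
    with hg
  have hre : ((-(N : ℂ))).re < 0 := by simpa using hN
  have hre2 : (-Complex.I * w).re < 0 := by simpa using hw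
  have h1 : ∀ τ : ℝ, (√(Real.pi / N) : ℂ) * gaussKernel N w τ = ∫ v : ℝ, g τ v := fun τ => by
    simp only [hg]
    rw [integral_const_mul, integral_cexp_quadratic hre, neg_neg]
    rw [show (Real.pi : ℂ) / N = ((Real.pi / N : ℝ) : ℂ) by push_cast; rfl,
      cpow_half_ofReal (by positivity), gaussKernel, mul_left_comm, ← Complex.exp_add]
    congr 2
    push_cast
    field_simp
    rw [Complex.I_sq]
    ring
  have hint : Integrable (Function.uncurry g) ((volume.restrict (Set.Ioi (0 : ℝ))).prod volume) := by
    have ha : Integrable (fun τ : ℝ => Complex.exp (-Complex.I * w * τ))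
        (volume.restrict (Set.Ioi (0 : ℝ))) := integrableOn_exp_mul_complex_Ioi hre2 0
    have hb : Integrable (fun v : ℝ => Complex.exp (-(N : ℂ) * (v : ℂ) ^ 2)) := by
      simpa using integrable_cexp_quadratic' hre 0 0
    refine (ha.mul_prod hb).mono (by simp only [hg]; fun_prop : Continuous _).aestronglyMeasurable
      (ae_of_all _ fun p => le_of_eq ?_)
    simp only [Function.uncurry, hg, norm_mul]
    congr 1
    rw [Complex.norm_exp, Complex.norm_exp]
    congr 1
    simp
  have h2 : ∀ v : ℝ, ∫ τ in Set.Ioi (0 : ℝ), g τ v =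
      -Complex.I * (((Real.exp (-N * v ^ 2) : ℝ) : ℂ) * (w - v)⁻¹) := fun v => by
    have hre3 : (-Complex.I * (w - v)).re < 0 := by simpa using hw
    have e : ∀ τ : ℝ, g τ v = ((Real.exp (-N * v ^ 2) : ℝ) : ℂ) *
        Complex.exp (-Complex.I * (w - v) * τ) := fun τ => by
      simp only [hg]
      rw [Complex.ofReal_exp, ← Complex.exp_add, ← Complex.exp_add]
      congr 1
      push_cast
      ring
    simp_rw [e]
    rw [integral_const_mul, integral_exp_mul_complex_Ioi hre3]
    have := sub_ofReal_ne_zero hw v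
    simp only [Complex.ofReal_zero, mul_zero, Complex.exp_zero]
    field_simp
    rw [Complex.I_sq]
    ring
  rw [gaussTransform, mul_assoc, ← integral_const_mul]
  simp_rw [h1]
  rw [integral_integral_swap hint]
  simp_rw [h2]
  rw [integral_const_mul, ← mul_assoc, mul_neg, Complex.I_mul_I, neg_neg, one_mul]

/-- The Gaussian moments `Γ(j + 1/2) / N ^ (j + 1/2)`. -/
def gaussMoment (N : ℝ) (j : ℕ) : ℝ :=
  Real.Gamma ((j : ℝ) + 1 / 2) * N ^ (-((j : ℝ) + 1 / 2))

lemma integrable_gaussMoment {N : ℝ} (hN : 0 < N) (j : ℕ) :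
    Integrable fun v : ℝ => Real.exp (-N * v ^ 2) * v ^ (2 * j) := by
  have := integrable_rpow_mul_exp_neg_mul_sq hN (s := ((2 * j : ℕ) : ℝ))
    (by have : (0 : ℝ) ≤ ((2 * j : ℕ) : ℝ) := Nat.cast_nonneg _
        linarith)
  simp_rw [Real.rpow_natCast] at this
  simpa only [mul_comm] using this

lemma integral_gaussMoment {N : ℝ} (hN : 0 < N) (j : ℕ) :
    ∫ v : ℝ, Real.exp (-N * v ^ 2) * v ^ (2 * j) = gaussMoment N j := by
  have h1 : ∫ v : ℝ, Real.exp (-N * v ^ 2) * v ^ (2 * j) =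
      2 * ∫ v in Set.Ioi (0 : ℝ), Real.exp (-N * v ^ 2) * v ^ (2 * j) := by
    rw [← integral_comp_abs]
    simp_rw [pow_mul, sq_abs]
  have h2 := integral_rpow_mul_exp_neg_mul_rpow (p := 2) (q := ((2 * j : ℕ) : ℝ)) (b := N)
    two_pos (by have : (0 : ℝ) ≤ ((2 * j : ℕ) : ℝ) := Nat.cast_nonneg _
                linarith) hN
  have h3 : ∀ v : ℝ, v ^ (((2 * j : ℕ)) : ℝ) * Real.exp (-N * v ^ (2 : ℝ)) =
      Real.exp (-N * v ^ 2) * v ^ (2 * j) := fun v => by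
    rw [Real.rpow_natCast, ← Nat.cast_ofNat (R := ℝ), Real.rpow_natCast, mul_comm]
  simp_rw [h3] at h2
  rw [h1, h2, gaussMoment]
  push_cast
  rw [show (2 * (j : ℝ) + 1) / 2 = j + 1 / 2 by ring,
    show -(2 * (j : ℝ) + 1) / 2 = -(j + 1 / 2) by ring]
  ring

/-- The remainder in the expansion of `gaussTransform` in inverse odd powers of `w`. -/
lemma norm_gaussTransform_sub_le {N m : ℝ} (hN : 0 < N) {w : ℂ} (hw : w.im < 0) (P : ℕ)
    (hm : 0 < m) (hmw : ∀ v : ℝ, m ≤ ‖w ^ 2 - (v : ℂ) ^ 2‖) :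
    ‖gaussTransform N w - ∑ j ∈ Finset.range (P + 1), (gaussMoment N j : ℂ) / w ^ (2 * j + 1)‖ ≤
      gaussMoment N (P + 1) / (‖w‖ ^ (2 * P + 1) * m) := by
  have hw0 : w ≠ 0 := fun h => by simp [h] at hw
  have hsq : ∀ v : ℝ, w ^ 2 - (v : ℂ) ^ 2 ≠ 0 := fun v h => by
    have := hmw v
    rw [h, norm_zero] at this
    linarith
  have hsub := sub_ofReal_ne_zero hw
  have hadd : ∀ v : ℝ, w + v ≠ 0 := fun v => by
    simpa using sub_ofReal_ne_zero hw (-v)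
  set E : ℝ → ℂ := fun v => ((Real.exp (-N * v ^ 2) : ℝ) : ℂ) with hE
  have hEi : Integrable E := (integrable_exp_neg_mul_sq hN).ofReal
  have hEm : ∀ j : ℕ, Integrable fun v : ℝ => E v * (v : ℂ) ^ (2 * j) := fun j => by
    have := (integrable_gaussMoment hN j).ofReal (𝕜 := ℂ)
    refine this.congr (ae_of_all _ fun v => ?_)
    simp [hE]
  have hEmI : ∀ j : ℕ, ∫ v : ℝ, E v * (v : ℂ) ^ (2 * j) = (gaussMoment N j : ℂ) := fun j => by
    rw [← integral_gaussMoment hN, ← integral_complex_ofReal]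
    refine integral_congr_ae (ae_of_all _ fun v => ?_)
    simp [hE]
  have hbd : ∀ v : ℝ, ‖(w - v)⁻¹‖ ≤ (-w.im)⁻¹ := fun v => by
    rw [norm_inv]
    refine inv_anti₀ (by linarith) ?_
    have := Complex.abs_im_le_norm (w - v)
    rw [Complex.sub_im, Complex.ofReal_im, sub_zero, abs_of_neg hw] at this
    exact this
  have hi1 : Integrable fun v : ℝ => E v * (w - v)⁻¹ := by
    refine hEi.mul_bdd (c := (-w.im)⁻¹) ?_ (ae_of_all _ hbd)
    exact (Continuous.inv₀ (by fun_prop) hsub).aestronglyMeasurable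
  have hi2 : Integrable fun v : ℝ => E v * (w + v)⁻¹ := by
    have := hi1.comp_neg
    refine this.congr (ae_of_all _ fun v => ?_)
    simp [hE, sub_eq_add_neg]
  have hI2 : ∫ v : ℝ, E v * (w + v)⁻¹ = gaussTransform N w := by
    rw [gaussTransform_eq_integral hN hw, ← integral_neg_eq_self]
    refine integral_congr_ae (ae_of_all _ fun v => ?_)
    simp [hE, sub_eq_add_neg]
  -- Averaging over `v` and `-v` replaces `1 / (w - v)` by `w / (w² - v²)`. Only odd powers of `w`
  -- survive, and the error involves only the distance from `w²` to the squares `v²`.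
  have hsym : gaussTransform N w = ∫ v : ℝ, E v * (w / (w ^ 2 - (v : ℂ) ^ 2)) := by
    have h1 : ∀ v : ℝ, E v * (w / (w ^ 2 - (v : ℂ) ^ 2)) =
        (1 / 2 : ℂ) * (E v * (w - v)⁻¹ + E v * (w + v)⁻¹) := fun v => by
      have ha := hsub v
      have hb := hadd v
      rw [show w ^ 2 - (v : ℂ) ^ 2 = (w - v) * (w + v) by ring]
      field_simp
      ring
    simp_rw [h1]
    rw [integral_const_mul, integral_add hi1 hi2, hI2, ← gaussTransform_eq_integral hN hw]
    ring
  -- A finite geometric series in `v² / w²` with its exact last term.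
  have hdecomp : ∀ v : ℝ, E v * (w / (w ^ 2 - (v : ℂ) ^ 2)) =
      (∑ j ∈ Finset.range (P + 1), E v * (v : ℂ) ^ (2 * j) * (1 / w ^ (2 * j + 1))) +
        E v * (v : ℂ) ^ (2 * (P + 1)) * (1 / (w ^ (2 * P + 1) * (w ^ 2 - (v : ℂ) ^ 2))) := by
    intro v
    have h := hsq v
    clear hsym hI2 hi1 hi2
    induction P with
    | zero =>
      simp
      field_simp
      ring
    | succ P ih =>
      rw [Finset.sum_range_succ, ih]
      field_simp
      ring
  have hrem : Integrable fun v : ℝ => E v * (v : ℂ) ^ (2 * (P + 1)) *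
      (1 / (w ^ (2 * P + 1) * (w ^ 2 - (v : ℂ) ^ 2))) := by
    refine (hEm (P + 1)).mul_bdd (c := 1 / (‖w‖ ^ (2 * P + 1) * m)) ?_ (ae_of_all _ fun v => ?_)
    · refine (Continuous.div₀ (by fun_prop) (by fun_prop) fun v => ?_).aestronglyMeasurable
      exact mul_ne_zero (pow_ne_zero _ hw0) (hsq v)
    · rw [norm_div, norm_one, norm_mul, norm_pow]
      have := norm_pos_iff.2 hw0
      gcongr
      exact hmw v
  rw [hsym]
  simp_rw [hdecomp]
  rw [integral_add (integrable_finsetSum _ fun j _ => (hEm j).mul_const _) hrem,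
    integral_finsetSum _ fun j _ => (hEm j).mul_const _]
  simp_rw [integral_mul_const, hEmI, mul_one_div]
  rw [add_sub_cancel_left]
  have hle : ∀ v : ℝ, ‖E v * (v : ℂ) ^ (2 * (P + 1)) / (w ^ (2 * P + 1) * (w ^ 2 - (v : ℂ) ^ 2))‖ ≤
      Real.exp (-N * v ^ 2) * v ^ (2 * (P + 1)) * (1 / (‖w‖ ^ (2 * P + 1) * m)) := fun v => by
    rw [norm_div, norm_mul, norm_mul, norm_pow, norm_pow, div_eq_mul_one_div]
    have h1 : ‖E v‖ = Real.exp (-N * v ^ 2) := by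
      simp only [hE]
      rw [Complex.norm_real, Real.norm_of_nonneg (Real.exp_pos _).le]
    have h2 : ‖(v : ℂ)‖ ^ (2 * (P + 1)) = v ^ (2 * (P + 1)) := by
      rw [Complex.norm_real, Real.norm_eq_abs, pow_mul, sq_abs, pow_mul]
    have h3 : 0 ≤ v ^ (2 * (P + 1)) := by rw [pow_mul]; positivity
    have := norm_pos_iff.2 hw0
    rw [h1, h2]
    gcongr
    exact hmw v
  have hint := (integrable_gaussMoment hN (P + 1)).mul_const (1 / (‖w‖ ^ (2 * P + 1) * m))
  refine (norm_integral_le_of_norm_le hint (ae_of_all _ hle)).trans_eq ?_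
  rw [integral_mul_const, integral_gaussMoment hN]
  ring

/-! ### Decay and integrability of the integrands -/

lemma norm_cpow_neg_half {z : ℂ} (hz : z ≠ 0) :
    ‖z ^ (-(1 / 2) : ℂ)‖ = ‖z‖ ^ (-(1 / 2) : ℝ) := by
  rw [Complex.norm_cpow_of_ne_zero hz]
  have h1 : (-(1 / 2) : ℂ).re = -(1 / 2) := by norm_num
  have h2 : (-(1 / 2) : ℂ).im = 0 := by norm_num
  rw [h1, h2]
  simp

lemma differentiableOn_cpow_neg_half (β : ℝ) :
    DifferentiableOn ℂ (fun z : ℂ => z ^ (-(1 / 2) : ℂ)) (wDomain β) := fun z hz =>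
  ((hasDerivAt_id z).cpow_const hz.1).differentiableAt.differentiableWithinAt

/-- A radius beyond which `‖w‖ ^ 2 ≥ ‖z‖ ^ 2 / 2`. -/
def outerRadius (β : ℝ) : ℝ :=
  2 * (2 * Real.cosh β + 1 / 2 + Real.pi / 2 + |phaseReal β (tMinus β)|) + 3

lemma three_le_outerRadius (β : ℝ) : 3 ≤ outerRadius β := by
  have := Real.cosh_pos β
  have := Real.pi_pos
  have := abs_nonneg (phaseReal β (tMinus β))
  unfold outerRadius
  linarith

/-- The terms of `f` other than `z²`, together with `f(t₋)`, grow at most linearly, with rate at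
most half of `outerRadius`. -/
lemma half_sq_le_norm_phaseRoot_sq {β : ℝ} {z : ℂ}
    (hR : outerRadius β ≤ ‖z‖) : ‖z‖ ^ 2 / 2 ≤ ‖phaseRoot β z‖ ^ 2 := by
  have h3 := (three_le_outerRadius β).trans hR
  have hlog : ‖Complex.log z‖ ≤ ‖z‖ + Real.pi := by
    refine (Complex.norm_le_abs_re_add_abs_im _).trans (add_le_add ?_ ?_)
    · rw [Complex.log_re, abs_of_nonneg (Real.log_nonneg (by linarith))]
      exact (Real.log_le_sub_one_of_pos (by linarith)).trans (by linarith)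
    · rw [Complex.log_im]
      exact Complex.abs_arg_le_pi z
  have e : z ^ 2 = phaseRoot β z ^ 2 + (2 * z * (Real.cosh β : ℂ) - Complex.log z / 2 +
      (phaseReal β (tMinus β) : ℂ)) := by
    rw [phaseRoot_sq β z, phase_tMinus, phase]
    ring
  have h1 : ‖z‖ ^ 2 ≤ ‖phaseRoot β z‖ ^ 2 + (2 * ‖z‖ * Real.cosh β + (‖z‖ + Real.pi) / 2 +
      |phaseReal β (tMinus β)|) := by
    rw [← norm_pow, e, ← norm_pow]
    refine (norm_add_le _ _).trans (add_le_add le_rfl ((norm_add_le _ _).trans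
      (add_le_add ((norm_sub_le _ _).trans (add_le_add ?_ ?_)) ?_)))
    · rw [norm_mul, norm_mul, Complex.norm_real, Real.norm_of_nonneg (Real.cosh_pos β).le,
        Complex.norm_ofNat]
    · rw [norm_div, Complex.norm_ofNat]
      linarith
    · rw [Complex.norm_real, Real.norm_eq_abs]
  have h2 := abs_nonneg (phaseReal β (tMinus β))
  have h4 := Real.cosh_pos β
  have h5 := Real.pi_pos
  have h6 : outerRadius β * ‖z‖ ≤ ‖z‖ * ‖z‖ := mul_le_mul_of_nonneg_right hR (norm_nonneg _)
  have h7 : 2 * ‖z‖ * Real.cosh β + (‖z‖ + Real.pi) / 2 + |phaseReal β (tMinus β)| ≤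
      outerRadius β * ‖z‖ / 2 := by
    unfold outerRadius
    nlinarith
  nlinarith

lemma half_le_norm_phaseRoot {β : ℝ} {z : ℂ}
    (hR : outerRadius β ≤ ‖z‖) : ‖z‖ / 2 ≤ ‖phaseRoot β z‖ := by
  have h := half_sq_le_norm_phaseRoot_sq hR
  refine (sq_le_sq₀ (by positivity) (norm_nonneg _)).1 ?_
  nlinarith [sq_nonneg ‖z‖]

/-- `gaussTransform` decays only where `Im w` is bounded above, so this is needed before its contour
can be closed at infinity. To the right of `t₋` one has `Im w < 0`. To the left, `Im w > 1` would
make `|Im z|` and `|Re w|` small, so that `Re w² < 0`; but then `Re z < 0` with `|Re z| > |Im z|`,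
which makes `Re w²` positive. -/
lemma im_phaseRoot_le_one {β : ℝ} (hβ : 0 < β) {z : ℂ} (hz : z.im ≠ 0) (hR : 3 ≤ ‖z‖) :
    (phaseRoot β z).im ≤ 1 := by
  rcases le_or_gt (tMinus β) z.re with hre | hre
  · have := im_phaseRoot_neg hβ (mem_wDomain_of_im_ne_zero hz) hre
      (fun h => hz (by rw [h, Complex.ofReal_im]))
    linarith
  by_contra! hcon
  have h1 := im_mul_re_phaseRoot_pos hβ hz hre.le
  have h2 := im_phaseRoot_sq β z
  have h3 := re_phaseRoot_sq β z
  have h4 := tMinus_add_tPlus β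
  have h5 := half_lt_tPlus hβ
  have h6 := tMinus_lt_half hβ
  have h7 := phaseReal_tMinus β
  have hπ := Real.pi_lt_d2
  have harg := Complex.abs_arg_le_pi z
  have hyarg : z.im * z.arg ≤ |z.im| * Real.pi := by
    refine (le_abs_self _).trans ?_
    rw [abs_mul]
    exact mul_le_mul_of_nonneg_left harg (abs_nonneg _)
  have hy0 : 0 < |z.im| := abs_pos.2 hz
  set W := phaseRoot β z with hW
  have e2 : (W ^ 2).im = 2 * W.re * W.im := by
    rw [pow_two, Complex.mul_im]; ring
  have e3 : (W ^ 2).re = W.re ^ 2 - W.im ^ 2 := by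
    rw [pow_two, Complex.mul_re]; ring
  have hyy : z.im * z.im = |z.im| * |z.im| := (abs_mul_abs_self _).symm
  have hyW : |z.im| * |W.re| = z.im * W.re := by rw [← abs_mul, abs_of_pos h1]
  -- The formula for `Im w²`, multiplied by `Im z`: both terms on the left are nonnegative, so each
  -- is controlled by the argument term.
  have k1 : 2 * (|z.im| * |W.re|) * W.im + 2 * (|z.im| * |z.im|) * (Real.cosh β - z.re) ≤
      |z.im| * Real.pi / 2 := by
    rw [hyW, ← hyy]
    have : z.im * (2 * W.re * W.im) = z.im * (2 * z.im * (z.re - Real.cosh β) + z.arg / 2) := by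
      rw [← e2, h2]
    linarith
  have k2 : 2 * |W.re| * W.im + 2 * |z.im| * (Real.cosh β - z.re) ≤ Real.pi / 2 := by
    have : |z.im| * (2 * |W.re| * W.im + 2 * |z.im| * (Real.cosh β - z.re)) ≤
      |z.im| * (Real.pi / 2) := by linarith
    exact le_of_mul_le_mul_left this hy0
  have ha : 1 / 2 < Real.cosh β - z.re := by linarith
  have j1 := mul_nonneg (abs_nonneg W.re) (by linarith : 0 ≤ W.im)
  have j2 := mul_le_mul_of_nonneg_left ha.le hy0.le
  have j3 := mul_le_mul_of_nonneg_left hcon.le (abs_nonneg W.re)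
  have k3 : |z.im| < 2 := by linarith
  have k4 : |W.re| < 1 := by linarith
  have k5 : W.re ^ 2 < 1 := by
    rw [← sq_abs]
    nlinarith [abs_nonneg W.re]
  have k6 : (W ^ 2).re < 0 := by
    rw [e3]
    have := one_lt_pow₀ hcon two_ne_zero
    linarith
  have k7 : z.im ^ 2 < 4 := by
    rw [← sq_abs]
    have := pow_lt_pow_left₀ k3 hy0.le two_ne_zero
    linarith
  have kr : 9 ≤ ‖z‖ ^ 2 := by nlinarith
  have k8 : ‖z‖ ^ 2 = z.re ^ 2 + z.im ^ 2 := by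
    rw [← Complex.normSq_eq_norm_sq, Complex.normSq_apply]; ring
  have k9 : z.re < 0 := by
    by_contra! hc
    have : z.re ^ 2 < (1 / 2) ^ 2 := pow_lt_pow_left₀ (by linarith) hc two_ne_zero
    linarith
  have k10 : 0 ≤ Real.log ‖z‖ := Real.log_nonneg (by linarith)
  have k11 := Real.exp_pos (-2 * β)
  have k12 := Real.log_pos one_lt_two
  have k13 : 0 < Real.cosh β := Real.cosh_pos β
  rw [h3, h7] at k6
  linarith [mul_pos (neg_pos.2 k9) k13]

lemma differentiableOn_coeffIntegrand {β : ℝ} (hβ : 0 < β) (j : ℕ) :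
    DifferentiableOn ℂ (coeffIntegrand (phaseRoot β) j) (wDomain β \ {(tMinus β : ℂ)}) := by
  refine ((differentiableOn_cpow_neg_half β).mono Set.sdiff_subset).div
    (((differentiableOn_phaseRoot hβ).mono Set.sdiff_subset).pow _) fun z hz => ?_
  exact pow_ne_zero _ (phaseRoot_ne_zero hβ hz.1 hz.2)

lemma rpow_neg_three_half {r : ℝ} (hr : 0 < r) :
    r ^ (-(1 / 2) : ℝ) * r⁻¹ = r ^ (-(3 / 2) : ℝ) := by
  rw [← Real.rpow_neg_one r, ← Real.rpow_add hr]
  norm_num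

/-- Beyond `outerRadius` one has `|w| ≥ |z| / 2 > 1`, so higher powers of `w` only help and one
constant serves every `j`. -/
lemma outerDecay_coeffIntegrand (β : ℝ) (j : ℕ) :
    OuterDecay β (outerRadius β) 2 (coeffIntegrand (phaseRoot β) j) := by
  refine ⟨zero_le_two, fun z hR hz _ => ?_⟩
  have h3 := (three_le_outerRadius β).trans hR
  have h := half_le_norm_phaseRoot (β := β) hR
  have hz0 : z ≠ 0 := fun h0 => hz (by rw [h0, Complex.zero_im])
  have hp : 0 < ‖z‖ := norm_pos_iff.2 hz0
  rw [coeffIntegrand, norm_div, norm_pow, norm_cpow_neg_half hz0, ← rpow_neg_three_half hp]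
  have h1 : ‖z‖ / 2 ≤ ‖phaseRoot β z‖ ^ (2 * j + 1) :=
    h.trans (le_self_pow₀ (by linarith) (by omega))
  calc _ ≤ ‖z‖ ^ (-(1 / 2) : ℝ) / (‖z‖ / 2) := by gcongr
    _ = _ := by field_simp

/-- The integrand `z ^ (-1/2) * gaussTransform N (w z)`. -/
def gaussIntegrand (N β : ℝ) (z : ℂ) : ℂ :=
  z ^ (-(1 / 2) : ℂ) * gaussTransform N (phaseRoot β z)

lemma differentiableOn_gaussIntegrand {N β : ℝ} (hN : 0 < N) (hβ : 0 < β) :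
    DifferentiableOn ℂ (gaussIntegrand N β) (wDomain β) :=
  (differentiableOn_cpow_neg_half β).mul
    ((differentiable_gaussTransform hN).comp_differentiableOn (differentiableOn_phaseRoot hβ))

lemma exists_outerDecay_gaussIntegrand {N β : ℝ} (hN : 0 < N) (hβ : 0 < β) :
    ∃ C, OuterDecay β (outerRadius β) C (gaussIntegrand N β) := by
  obtain ⟨C, hC, h⟩ := exists_norm_gaussTransform_le hN
  refine ⟨C * 2, by positivity, fun z hR hz _ => ?_⟩
  have h3 := (three_le_outerRadius β).trans hR
  have h1 := half_le_norm_phaseRoot (β := β) hR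
  have hz0 : z ≠ 0 := fun h0 => hz (by rw [h0, Complex.zero_im])
  have hp : 0 < ‖z‖ := norm_pos_iff.2 hz0
  have h2 := h (phaseRoot β z) (im_phaseRoot_le_one hβ hz h3)
    (norm_pos_iff.1 (by linarith))
  rw [gaussIntegrand, norm_mul, norm_cpow_neg_half hz0, ← rpow_neg_three_half hp]
  calc _ ≤ ‖z‖ ^ (-(1 / 2) : ℝ) * (C / (‖z‖ / 2)) := by gcongr; exact h2.trans (by gcongr)
    _ = _ := by field_simp

lemma integrableOn_halfLine {β δ R C : ℝ} {F : ℂ → ℂ}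
    (hF : ContinuousOn F (leftDomain β)) (hdec : OuterDecay β R C F) (hδ : δ ≠ 0) :
    IntegrableOn (pathIntegrand F (halfLine δ)) (Set.Iio 0) := by
  set r := max R 1 with hr
  have hr1 : 1 ≤ r := le_max_right _ _
  have hint : ∀ p q : ℝ, IntervalIntegrable (pathIntegrand F (halfLine δ)) volume p q :=
    intervalIntegrable_halfLine hF hδ
  have hcont : ContinuousOn (pathIntegrand F (halfLine δ)) (Set.Iic (-r)) := by
    have : pathIntegrand F (halfLine δ) = fun l => F (halfLine δ l) :=
      funext fun l => pathIntegrand_halfLine F δ l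
    rw [this]
    exact hF.comp (by unfold halfLine; fun_prop) fun l _ => halfLine_mem_leftDomain hδ l
  have h1 : IntegrableOn (pathIntegrand F (halfLine δ)) (Set.Iic (-r)) := by
    have h2 : IntegrableOn (fun l : ℝ => C * (-l) ^ (-(3 / 2) : ℝ)) (Set.Iic (-r)) := by
      have := ((integrableOn_Ici_iff_integrableOn_Ioi (μ := volume)).2 (integrableOn_Ioi_rpow_of_lt
        (by norm_num : (-(3 / 2) : ℝ) < -1) (by linarith : 0 < r))).comp_neg
      rw [Set.neg_Ici] at this
      exact this.const_mul C
    refine Integrable.mono' h2 (hcont.aestronglyMeasurable measurableSet_Iic) ?_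
    filter_upwards [ae_restrict_mem measurableSet_Iic] with l hl
    have hl : l ≤ -r := hl
    have hre : (halfLine δ l).re = l := by simp [halfLine]
    have him : (halfLine δ l).im = δ := by simp [halfLine]
    have hnorm : -l ≤ ‖halfLine δ l‖ := by
      have := Complex.abs_re_le_norm (halfLine δ l)
      rw [hre, abs_of_neg (by linarith)] at this
      exact this
    rw [pathIntegrand_halfLine]
    refine (hdec.2 _ ?_ (by rw [him]; exact hδ) ?_).trans ?_
    · linarith [le_max_left R 1]
    · rw [hre]; linarith [Real.cosh_pos β]
    · exact mul_le_mul_of_nonneg_left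
        (Real.rpow_le_rpow_of_nonpos (by linarith) hnorm (by norm_num)) hdec.1
  have h2 := (intervalIntegrable_iff_integrableOn_Ioc_of_le (by linarith : -r ≤ 0)).1 (hint (-r) 0)
  refine (h1.union h2).mono_set fun l hl => ?_
  have hl : l < 0 := hl
  rcases le_or_gt l (-r) with h | h
  · exact Or.inl h
  · exact Or.inr ⟨h, hl.le⟩

/-- By Jordan's inequality `cos θ` is at least `2 / π` times the distance to the nearer end point,
where the exponent `-1/2` is integrable. -/
lemma integrableOn_cos_rpow_neg_half :
    IntegrableOn (fun θ : ℝ => Real.cos θ ^ (-(1 / 2) : ℝ)) (Set.Ioo (-(Real.pi / 2)) (Real.pi / 2)) := by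
  have hπ := Real.pi_pos
  have h0 : IntervalIntegrable (fun x : ℝ => x ^ (-(1 / 2) : ℝ)) volume 0 Real.pi :=
    intervalIntegral.intervalIntegrable_rpow' (by norm_num)
  have hA : IntegrableOn (fun θ : ℝ => (Real.pi / 2 - θ) ^ (-(1 / 2) : ℝ))
      (Set.Ioo (-(Real.pi / 2)) (Real.pi / 2)) := by
    have := h0.comp_sub_left (Real.pi / 2)
    have := this.symm
    rw [show Real.pi / 2 - Real.pi = -(Real.pi / 2) by ring, sub_zero,
      intervalIntegrable_iff_integrableOn_Ioo_of_le (by linarith)] at this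
    exact this
  have hB : IntegrableOn (fun θ : ℝ => (Real.pi / 2 + θ) ^ (-(1 / 2) : ℝ))
      (Set.Ioo (-(Real.pi / 2)) (Real.pi / 2)) := by
    have := h0.comp_add_left (Real.pi / 2)
    rw [show Real.pi - Real.pi / 2 = Real.pi / 2 by ring, zero_sub,
      intervalIntegrable_iff_integrableOn_Ioo_of_le (by linarith)] at this
    exact this
  refine Integrable.mono' ((hA.add hB).const_mul ((2 / Real.pi) ^ (-(1 / 2) : ℝ)))
    (by fun_prop : Measurable _).aestronglyMeasurable ?_
  filter_upwards [ae_restrict_mem measurableSet_Ioo] with θ hθ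
  have hcos := Real.cos_pos_of_mem_Ioo hθ
  have h1 : 0 < Real.pi / 2 - θ := by linarith [hθ.2]
  have h2 : 0 < Real.pi / 2 + θ := by linarith [hθ.1]
  rw [Real.norm_of_nonneg (by positivity)]
  simp only [Pi.add_apply]
  rw [mul_add, ← Real.mul_rpow (by positivity) h1.le, ← Real.mul_rpow (by positivity) h2.le]
  rcases le_total 0 θ with h | h
  · have := Real.one_sub_mul_le_cos h hθ.2.le
    have e : 2 / Real.pi * (Real.pi / 2 - θ) ≤ Real.cos θ := by
      refine le_trans (le_of_eq ?_) this
      field_simp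
    have k := Real.rpow_le_rpow_of_nonpos (z := -(1 / 2)) (by positivity) e (by norm_num)
    have : 0 ≤ (2 / Real.pi * (Real.pi / 2 + θ)) ^ (-(1 / 2) : ℝ) := by positivity
    linarith
  · have := Real.one_sub_mul_le_cos (neg_nonneg.2 h) (by linarith [hθ.1])
    rw [Real.cos_neg] at this
    have e : 2 / Real.pi * (Real.pi / 2 + θ) ≤ Real.cos θ := by
      refine le_trans (le_of_eq ?_) this
      field_simp
      ring
    have k := Real.rpow_le_rpow_of_nonpos (z := -(1 / 2)) (by positivity) e (by norm_num)
    have : 0 ≤ (2 / Real.pi * (Real.pi / 2 - θ)) ^ (-(1 / 2) : ℝ) := by positivity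
    linarith

lemma mem_Ioo_iff_abs_lt {θ : ℝ} :
    θ ∈ Set.Ioo (-(Real.pi / 2)) (Real.pi / 2) ↔ |θ| < Real.pi / 2 := abs_lt.symm

lemma gammaPlus_ne_tMinus {β θ : ℝ} (hβ : 0 < β) (hθ : |θ| < Real.pi / 2) :
    gammaPlus β θ ≠ (tMinus β : ℂ) := by
  intro h
  have := congrArg Complex.re h
  rw [re_gammaPlus hβ hθ, Complex.ofReal_re] at this
  linarith [tPlus_le_xPlus (β := β) hθ, tMinus_lt_tPlus hβ]

lemma half_le_xPlus {β θ : ℝ} (hβ : 0 < β) (hθ : |θ| < Real.pi / 2) : 1 / 2 ≤ xPlus β θ :=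
  (half_lt_tPlus hβ).le.trans (tPlus_le_xPlus hθ)

/-- Near the ends `|z| ^ (-1/2)` is `O(√cos θ)`, `1 / |w| ^ (2 j + 1)` is `O(cos θ)` and the
derivative of the path is `O(1 / cos² θ)`; the product is `O(cos ^ (-1/2) θ)`. -/
lemma integrableOn_coeffIntegrand_gammaPlus {β : ℝ} (hβ : 0 < β) (j : ℕ) :
    IntegrableOn (pathIntegrand (coeffIntegrand (phaseRoot β) j) (gammaPlus β))
      (Set.Ioo (-(Real.pi / 2)) (Real.pi / 2)) := by
  have hD := saddleGap_pos hβ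
  have hsh : 0 < Real.sinh β := Real.sinh_pos_iff.2 hβ
  have hπ := Real.pi_pos
  set K : ℝ := (1 / 2 : ℝ) ^ (-(1 / 2) : ℝ) * (√(5 / saddleGap β) / saddleGap β ^ j) *
    (Real.pi / (8 * Real.sinh β) + Real.cosh β) with hK
  refine Integrable.mono' (integrableOn_cos_rpow_neg_half.const_mul K) ?_ ?_
  · have h1 : ContinuousOn (fun θ => coeffIntegrand (phaseRoot β) j (gammaPlus β θ))
        (Set.Ioo (-(Real.pi / 2)) (Real.pi / 2)) := by
      refine (differentiableOn_coeffIntegrand hβ j).continuousOn.comp (fun θ hθ =>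
        (continuousAt_gammaPlus hβ (mem_Ioo_iff_abs_lt.1 hθ)).continuousWithinAt) fun θ hθ => ?_
      have hθ := mem_Ioo_iff_abs_lt.1 hθ
      exact ⟨gammaPlus_mem_wDomain hβ hθ, gammaPlus_ne_tMinus hβ hθ⟩
    exact (h1.aestronglyMeasurable measurableSet_Ioo).mul
      (measurable_deriv (gammaPlus β)).aestronglyMeasurable
  · have hne : ∀ᵐ θ : ℝ ∂(volume.restrict (Set.Ioo (-(Real.pi / 2)) (Real.pi / 2))), θ ≠ 0 :=
      ae_restrict_of_ae (Measure.ae_ne volume 0)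
    filter_upwards [ae_restrict_mem measurableSet_Ioo, hne] with θ hθ' hθ0
    have hθ := mem_Ioo_iff_abs_lt.1 hθ'
    have hcos := Real.cos_pos_of_mem_Ioo hθ'
    have hx := half_le_xPlus hβ hθ
    have hγ0 : gammaPlus β θ ≠ 0 := norm_pos_iff.1 (by rw [norm_gammaPlus hβ hθ]; positivity)
    have hM := saddleGap_div_le_phaseDrop hβ hθ
    have hM2 := saddleGap_le_phaseDrop hβ hθ
    have hW := norm_phaseRoot_gammaPlus_sq hβ hθ
    set W := ‖phaseRoot β (gammaPlus β θ)‖ with hWdef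
    have hW1 : √(saddleGap β / 5) / Real.cos θ ≤ W := by
      refine (sq_le_sq₀ (by positivity) (norm_nonneg _)).1 ?_
      rw [hW, div_pow, Real.sq_sqrt (by positivity)]
      exact (le_of_eq (by field_simp)).trans hM
    have hW2 : saddleGap β ^ j * (√(saddleGap β / 5) / Real.cos θ) ≤ W ^ (2 * j + 1) := by
      rw [pow_succ, pow_mul, hW]
      exact mul_le_mul (pow_le_pow_left₀ hD.le hM2 _) hW1 (by positivity)
        (pow_nonneg (hD.le.trans hM2) _)
    rw [pathIntegrand, (hasDerivAt_gammaPlus hβ hθ hθ0).deriv, coeffIntegrand, norm_mul, norm_div,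
      norm_pow, norm_cpow_neg_half hγ0, norm_gammaPlus hβ hθ]
    have hd := norm_gammaPlusDeriv_le hβ hθ hθ0
    have hc1 : Real.cos θ ≤ 1 := Real.cos_le_one θ
    have hd2 : ‖gammaPlusDeriv β θ‖ ≤
        (Real.pi / (8 * Real.sinh β) + Real.cosh β) / Real.cos θ ^ 2 := by
      refine hd.trans ?_
      rw [add_div]
      refine add_le_add ?_ le_rfl
      rw [div_div, div_le_div_iff₀ (by positivity) (by positivity)]
      have : Real.cos θ ^ 2 ≤ Real.cos θ := by nlinarith
      have h8 : 0 < Real.pi * (8 * Real.sinh β) := by positivity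
      nlinarith
    have hxr : (xPlus β θ / Real.cos θ) ^ (-(1 / 2) : ℝ) ≤
        (1 / 2 : ℝ) ^ (-(1 / 2) : ℝ) * √(Real.cos θ) := by
      rw [Real.div_rpow (by linarith) hcos.le, Real.rpow_neg hcos.le (1 / 2), ← Real.sqrt_eq_rpow,
        div_inv_eq_mul]
      gcongr ?_ * _
      exact Real.rpow_le_rpow_of_nonpos (by norm_num) hx (by norm_num)
    have hcs : √(Real.cos θ) * Real.cos θ / Real.cos θ ^ 2 = Real.cos θ ^ (-(1 / 2) : ℝ) := by
      rw [Real.rpow_neg hcos.le, ← Real.sqrt_eq_rpow]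
      have h1 : 0 < √(Real.cos θ) := Real.sqrt_pos.2 hcos
      have h2 := Real.sq_sqrt hcos.le
      field_simp
      linarith
    calc _ ≤ ((1 / 2 : ℝ) ^ (-(1 / 2) : ℝ) * √(Real.cos θ)) /
          (saddleGap β ^ j * (√(saddleGap β / 5) / Real.cos θ)) *
          ((Real.pi / (8 * Real.sinh β) + Real.cosh β) / Real.cos θ ^ 2) := by gcongr
      _ = K * (√(Real.cos θ) * Real.cos θ / Real.cos θ ^ 2) := by
        rw [hK, show (5 : ℝ) / saddleGap β = (saddleGap β / 5)⁻¹ by rw [inv_div], Real.sqrt_inv]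
        field_simp
      _ = _ := by rw [hcs]

lemma contourIntegrable_coeffIntegrand {β δ : ℝ} (hβ : 0 < β) (hδ : 0 < δ) (hδc : δ < tMinus β)
    (j : ℕ) : ContourIntegrable β δ (coeffIntegrand (phaseRoot β) j) := by
  have hc : ContinuousOn (coeffIntegrand (phaseRoot β) j) (leftDomain β) :=
    (differentiableOn_coeffIntegrand hβ j).continuousOn.mono (leftDomain_subset hβ)
  exact ⟨integrableOn_halfLine hc (outerDecay_coeffIntegrand β j) hδ.ne',
    intervalIntegrable_arc hc hδ hδc,
    integrableOn_halfLine hc (outerDecay_coeffIntegrand β j) (neg_ne_zero.2 hδ.ne'),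
    integrableOn_coeffIntegrand_gammaPlus hβ j⟩

/-! ### Contour integrals see only the values on the domain of the root. -/

lemma pathIntegrand_congr {F G : ℂ → ℂ} {S : Set ℂ} (h : Set.EqOn F G S) {γ : ℝ → ℂ} {T : Set ℝ}
    (hγ : ∀ t ∈ T, γ t ∈ S) : Set.EqOn (pathIntegrand F γ) (pathIntegrand G γ) T := fun t ht => by
  rw [pathIntegrand, pathIntegrand, h (hγ t ht)]

section Congr

variable {β δ : ℝ} {F G : ℂ → ℂ}

lemma arc_mem_wDomain (hβ : 0 < β) (hδ : 0 < δ) (hδc : δ < tMinus β) {θ : ℝ}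
    (hθ : θ ∈ Set.uIcc (Real.pi / 2) (-(Real.pi / 2))) : arc δ θ ∈ wDomain β := by
  rw [Set.uIcc_comm, Set.uIcc_of_le (by linarith [Real.pi_pos])] at hθ
  exact (leftDomain_subset hβ (arc_mem_leftDomain hδ hδc (abs_le.2 hθ))).1

lemma halfLine_mem_wDomain (hβ : 0 < β) (hδ : δ ≠ 0) (l : ℝ) : halfLine δ l ∈ wDomain β :=
  (leftDomain_subset hβ (halfLine_mem_leftDomain hδ l)).1

lemma contourIntegrable_congr (hβ : 0 < β) (hδ : 0 < δ) (hδc : δ < tMinus β)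
    (h : Set.EqOn F G (wDomain β)) (hG : ContourIntegrable β δ G) : ContourIntegrable β δ F := by
  obtain ⟨h1, h2, h3, h4⟩ := hG
  refine ⟨h1.congr_fun (pathIntegrand_congr h.symm fun l _ => halfLine_mem_wDomain hβ hδ.ne' l)
    measurableSet_Iio, ?_,
    h3.congr_fun (pathIntegrand_congr h.symm fun l _ =>
      halfLine_mem_wDomain hβ (neg_ne_zero.2 hδ.ne') l) measurableSet_Iio,
    h4.congr_fun (pathIntegrand_congr h.symm fun θ hθ =>
      gammaPlus_mem_wDomain hβ (mem_Ioo_iff_abs_lt.1 hθ)) measurableSet_Ioo⟩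
  exact h2.congr ((pathIntegrand_congr h.symm fun θ hθ => arc_mem_wDomain hβ hδ hδc hθ).mono
    Set.uIoc_subset_uIcc)

lemma contourIntegral_congr (hβ : 0 < β) (hδ : 0 < δ) (hδc : δ < tMinus β)
    (h : Set.EqOn F G (wDomain β)) : contourIntegral β δ F = contourIntegral β δ G := by
  unfold contourIntegral
  rw [setIntegral_congr_fun measurableSet_Iio
      (pathIntegrand_congr h fun l _ => halfLine_mem_wDomain hβ hδ.ne' l),
    setIntegral_congr_fun measurableSet_Iio
      (pathIntegrand_congr h fun l _ => halfLine_mem_wDomain hβ (neg_ne_zero.2 hδ.ne') l),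
    setIntegral_congr_fun measurableSet_Ioo
      (pathIntegrand_congr h fun θ hθ => gammaPlus_mem_wDomain hβ (mem_Ioo_iff_abs_lt.1 hθ)),
    intervalIntegral.integral_congr (pathIntegrand_congr h fun θ hθ =>
      arc_mem_wDomain hβ hδ hδc hθ)]

end Congr

lemma IsPhaseRoot.coeffIntegrand_eqOn {β : ℝ} (hβ : 0 < β) {w : ℂ → ℂ} (hw : IsPhaseRoot β w)
    (j : ℕ) : Set.EqOn (coeffIntegrand w j) (coeffIntegrand (phaseRoot β) j) (wDomain β) :=
  fun z hz => by rw [coeffIntegrand, coeffIntegrand, hw.eqOn_phaseRoot hβ hz]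

/-! ### The tail of the logarithmic series -/

/-- `∑ (-u) ^ k / (k + m + 3)`. -/
def logTailAux (m : ℕ) (u : ℂ) : ℂ := ∑' k : ℕ, (-u) ^ k / ((k + m + 3 : ℕ) : ℂ)

/-- `(-log (1 + u) + u - u ^ 2 / 2) / u ^ 2`, continued to `u = 0`. -/
def logTail (u : ℂ) : ℂ := -u * logTailAux 0 u

lemma norm_logTailAux_term_le (m : ℕ) {u : ℂ} {r : ℝ} (hu : ‖u‖ ≤ r) (k : ℕ) :
    ‖(-u) ^ k / ((k + m + 3 : ℕ) : ℂ)‖ ≤ r ^ k := by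
  rw [norm_div, norm_pow, norm_neg, Complex.norm_natCast]
  refine (div_le_self (by positivity) ?_).trans (by gcongr)
  exact_mod_cast (by omega : 1 ≤ k + m + 3)

lemma summable_logTailAux (m : ℕ) {u : ℂ} (hu : ‖u‖ < 1) :
    Summable fun k : ℕ => (-u) ^ k / ((k + m + 3 : ℕ) : ℂ) :=
  Summable.of_norm_bounded (summable_geometric_of_lt_one (norm_nonneg _) hu)
    (norm_logTailAux_term_le m le_rfl)

lemma logTailAux_eq (m : ℕ) {u : ℂ} (hu : ‖u‖ < 1) :
    logTailAux m u = 1 / ((m + 3 : ℕ) : ℂ) + -u * logTailAux (m + 1) u := by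
  rw [logTailAux, (summable_logTailAux m hu).tsum_eq_zero_add, logTailAux, ← tsum_mul_left]
  congr 1
  · simp
  · refine tsum_congr fun k => ?_
    rw [pow_succ', mul_div_assoc, show k + 1 + m + 3 = k + (m + 1) + 3 by ring]

lemma logTail_eq_sum (m : ℕ) {u : ℂ} (hu : ‖u‖ < 1) :
    logTail u = ∑ k ∈ Finset.range m, (-u) ^ (k + 1) / ((k + 3 : ℕ) : ℂ) +
      (-u) ^ (m + 1) * logTailAux m u := by
  induction m with
  | zero => simp [logTail]
  | succ m ih =>
    rw [ih, Finset.sum_range_succ, logTailAux_eq m hu]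
    ring

lemma sq_mul_logTail {u : ℂ} (hu : ‖u‖ < 1) :
    u ^ 2 * logTail u = -Complex.log (1 + u) + u - u ^ 2 / 2 := by
  have h := Complex.hasSum_taylorSeries_neg_log (z := -u) (by rwa [norm_neg])
  have h1 := h.summable.sum_add_tsum_nat_add 3
  rw [h.tsum_eq, sub_neg_eq_add] at h1
  have h2 : ∑' k : ℕ, (-u) ^ (k + 3) / ((k + 3 : ℕ) : ℂ) = u ^ 2 * logTail u := by
    rw [logTail, logTailAux, ← mul_assoc, ← tsum_mul_left]
    refine tsum_congr fun k => ?_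
    rw [pow_add]
    simp only [add_zero]
    ring
  rw [h2] at h1
  simp only [Finset.sum_range_succ, Finset.sum_range_zero] at h1
  norm_num at h1
  linear_combination h1

lemma differentiableOn_logTailAux (m : ℕ) :
    DifferentiableOn ℂ (logTailAux m) (Metric.ball 0 1) := by
  intro u hu
  rw [mem_ball_zero_iff] at hu
  obtain ⟨r, hr, hr1⟩ := exists_between hu
  have h : DifferentiableOn ℂ (logTailAux m) (Metric.ball 0 r) :=
    Complex.differentiableOn_tsum_of_summable_norm
      (summable_geometric_of_lt_one ((norm_nonneg _).trans hr.le) hr1)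
      (fun k => by fun_prop) Metric.isOpen_ball
      fun k w hw => norm_logTailAux_term_le m (mem_ball_zero_iff.1 hw).le k
  exact (h.differentiableAt (Metric.isOpen_ball.mem_nhds
    (mem_ball_zero_iff.2 hr))).differentiableWithinAt

lemma differentiableOn_logTail : DifferentiableOn ℂ logTail (Metric.ball 0 1) :=
  differentiableOn_id.neg.mul (differentiableOn_logTailAux 0)

lemma norm_logTail_le {u : ℂ} {r : ℝ} (hu : ‖u‖ ≤ r) (hr : r < 1) :
    ‖logTail u‖ ≤ r * (1 - r)⁻¹ := by
  have h0 := (norm_nonneg u).trans hu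
  rw [logTail, norm_mul, norm_neg]
  gcongr
  exact tsum_of_norm_bounded (hasSum_geometric_of_lt_one h0 hr) (norm_logTailAux_term_le 0 hu)

/-! ### Circle integrals for the coefficients -/

lemma closedBall_subset_ball {r : ℝ} (hr : r < 1) :
    Metric.closedBall (0 : ℂ) r ⊆ Metric.ball 0 1 := Metric.closedBall_subset_ball hr

lemma sphere_subset_ball {r : ℝ} (hr : r < 1) : Metric.sphere (0 : ℂ) r ⊆ Metric.ball 0 1 :=
  Metric.sphere_subset_closedBall.trans (closedBall_subset_ball hr)

lemma ne_zero_of_mem_sphere {r : ℝ} (hr : 0 < r) {u : ℂ} (hu : u ∈ Metric.sphere (0 : ℂ) r) :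
    u ≠ 0 := norm_pos_iff.1 (by rw [mem_sphere_zero_iff_norm.1 hu]; exact hr)

lemma one_add_mem_slitPlane {u : ℂ} (hu : u ∈ Metric.ball (0 : ℂ) 1) :
    1 + u ∈ Complex.slitPlane :=
  Complex.mem_slitPlane_of_norm_lt_one (mem_ball_zero_iff.1 hu)

lemma hasDerivAt_one_add_cpow {u : ℂ} (hu : u ∈ Metric.ball (0 : ℂ) 1) :
    HasDerivAt (fun u : ℂ => (1 + u) ^ (-(1 / 2) : ℂ))
      (-(1 / 2) * (1 + u) ^ (-(1 / 2) : ℂ) / (1 + u)) u := by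
  have h1 := one_add_mem_slitPlane hu
  have h := ((hasDerivAt_id u).const_add 1).cpow_const (c := -(1 / 2)) h1
  refine h.congr_deriv ?_
  simp only [id]
  rw [Complex.cpow_sub _ _ (Complex.slitPlane_ne_zero h1), Complex.cpow_one]
  ring

lemma differentiableOn_one_add_cpow :
    DifferentiableOn ℂ (fun u : ℂ => (1 + u) ^ (-(1 / 2) : ℂ)) (Metric.ball 0 1) := fun _ hu =>
  (hasDerivAt_one_add_cpow hu).differentiableAt.differentiableWithinAt

lemma circleIntegral_eq_zero_of_differentiableOn {G : ℂ → ℂ} {r : ℝ} (hr0 : 0 < r) (hr : r < 1)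
    (hG : DifferentiableOn ℂ G (Metric.ball 0 1)) : ∮ u in C(0, r), G u = 0 :=
  Complex.circleIntegral_eq_zero_of_differentiable_on_off_countable hr0.le Set.countable_empty
    (hG.continuousOn.mono (closedBall_subset_ball hr)) fun _ hz =>
      hG.differentiableAt (Metric.isOpen_ball.mem_nhds
        (closedBall_subset_ball hr (Metric.ball_subset_closedBall hz.1)))

lemma circleIntegrable_inv_pow_mul {G : ℂ → ℂ} {r : ℝ} (hr0 : 0 < r) (hr : r < 1)
    (hG : DifferentiableOn ℂ G (Metric.ball 0 1)) (m : ℕ) :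
    CircleIntegrable (fun u => (u ^ m)⁻¹ * G u) 0 r := by
  refine ContinuousOn.circleIntegrable hr0.le (ContinuousOn.mul ?_
    (hG.continuousOn.mono (sphere_subset_ball hr)))
  exact (continuous_pow m).continuousOn.inv₀ fun u hu => pow_ne_zero _ (ne_zero_of_mem_sphere hr0 hu)

lemma circleIntegrable_const_mul {G : ℂ → ℂ} {c : ℂ} {r : ℝ} (h : CircleIntegrable G c r) (a : ℂ) :
    CircleIntegrable (fun u => a * G u) c r := h.const_smul

/-- Expanding `logTail` to order `m`, each term lowers the order of the pole, and the tail carries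
`u ^ (m + 1)`, cancels the pole and integrates to zero. The result mirrors the sum in `recP`, with
the same index shift. -/
lemma circleIntegral_mul_logTail {G : ℂ → ℂ} {r : ℝ} (hr0 : 0 < r) (hr : r < 1)
    (hG : DifferentiableOn ℂ G (Metric.ball 0 1)) (m : ℕ) :
    ∮ u in C(0, r), (u ^ (m + 1))⁻¹ * G u * logTail u =
      ∑ k : Fin m, (-1 : ℂ) ^ ((k : ℕ) + 1) / (((k : ℕ) + 3 : ℕ) : ℂ) *
        ∮ u in C(0, r), (u ^ (m - 1 - (k : ℕ) + 1))⁻¹ * G u := by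
  have hR : DifferentiableOn ℂ (fun u => (-1 : ℂ) ^ (m + 1) * (G u * logTailAux m u))
      (Metric.ball 0 1) := (hG.mul (differentiableOn_logTailAux m)).const_mul _
  have h1 : ∮ u in C(0, r), (u ^ (m + 1))⁻¹ * G u * logTail u =
      ∮ u in C(0, r), ((∑ k : Fin m, (-1 : ℂ) ^ ((k : ℕ) + 1) / (((k : ℕ) + 3 : ℕ) : ℂ) *
        ((u ^ (m - 1 - (k : ℕ) + 1))⁻¹ * G u)) + (-1 : ℂ) ^ (m + 1) * (G u * logTailAux m u)) := by
    refine circleIntegral.integral_congr hr0.le fun u hu => ?_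
    have hu0 := ne_zero_of_mem_sphere hr0 hu
    rw [logTail_eq_sum m (mem_ball_zero_iff.1 (sphere_subset_ball hr hu)), mul_add,
      Finset.mul_sum, Finset.sum_range]
    congr 1
    · refine Finset.sum_congr rfl fun k _ => ?_
      have hk := k.2
      have e : u ^ (m + 1) = u ^ (m - 1 - (k : ℕ) + 1) * u ^ ((k : ℕ) + 1) := by
        rw [← pow_add]; congr 1; omega
      rw [e, neg_pow u]
      field_simp
    · rw [neg_pow u]
      field_simp
  rw [h1, circleIntegral.integral_add, circleIntegral_eq_zero_of_differentiableOn hr0 hr hR,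
    add_zero, circleIntegral.integral_fun_sum]
  · exact Finset.sum_congr rfl fun k _ => circleIntegral.integral_const_mul _ _ _ _
  · exact fun k _ => circleIntegrable_const_mul (circleIntegrable_inv_pow_mul hr0 hr hG _) _
  · exact CircleIntegrable.fun_sum _ fun k _ =>
      circleIntegrable_const_mul (circleIntegrable_inv_pow_mul hr0 hr hG _) _
  · exact (hR.continuousOn.mono (sphere_subset_ball hr)).circleIntegrable hr0.le

lemma circleIntegral_inv_mul {G : ℂ → ℂ} {r : ℝ} (hr0 : 0 < r) (hr : r < 1)
    (hG : DifferentiableOn ℂ G (Metric.ball 0 1)) :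
    ∮ u in C(0, r), u⁻¹ * G u = 2 * Real.pi * Complex.I * G 0 := by
  have := (hG.mono (closedBall_subset_ball hr)).circleIntegral_sub_inv_smul
    (Metric.mem_ball_self hr0)
  simpa only [sub_zero, smul_eq_mul] using this

/-- These are the binomial coefficients of the power `-1/2`. Integrating the derivative of `u ^
(-(m+1)) (1 + u) ^ (1/2)` around the circle gives the recurrence of the central binomial
coefficients. -/
lemma circleIntegral_inv_pow_mul_one_add_cpow {r : ℝ} (hr0 : 0 < r) (hr : r < 1) (m : ℕ) :
    ∮ u in C(0, r), (u ^ (m + 1))⁻¹ * (1 + u) ^ (-(1 / 2) : ℂ) =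
      2 * Real.pi * Complex.I * ((-1) ^ m * ((2 * m).choose m : ℂ) / 4 ^ m) := by
  induction m with
  | zero =>
    simpa using circleIntegral_inv_mul hr0 hr differentiableOn_one_add_cpow
  | succ m ih =>
    set a : ℕ → ℂ := fun m => ∮ u in C(0, r), (u ^ (m + 1))⁻¹ * (1 + u) ^ (-(1 / 2) : ℂ) with ha
    have hint := circleIntegrable_inv_pow_mul hr0 hr differentiableOn_one_add_cpow
    have h0 : ∮ u in C(0, r), (-((m : ℂ) + 1) * ((u ^ (m + 1 + 1))⁻¹ * (1 + u) ^ (-(1 / 2) : ℂ)) +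
        -((m : ℂ) + 1 / 2) * ((u ^ (m + 1))⁻¹ * (1 + u) ^ (-(1 / 2) : ℂ))) = 0 := by
      refine circleIntegral.integral_eq_zero_of_hasDerivWithinAt
        (f := fun u => (u ^ (m + 1))⁻¹ * ((1 + u) * (1 + u) ^ (-(1 / 2) : ℂ))) hr0.le fun u hu => ?_
      have hu0 := ne_zero_of_mem_sphere hr0 hu
      have hu1 := sphere_subset_ball hr hu
      have h10 := Complex.slitPlane_ne_zero (one_add_mem_slitPlane hu1)
      have h1 := ((hasDerivAt_pow (m + 1) u).fun_inv (pow_ne_zero _ hu0)).fun_mul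
        (((hasDerivAt_id u).const_add 1).fun_mul (hasDerivAt_one_add_cpow hu1))
      refine (h1.congr_deriv ?_).hasDerivWithinAt
      generalize (1 + u) ^ (-(1 / 2) : ℂ) = g
      simp only [id, Nat.add_sub_cancel]
      push_cast
      field_simp
      ring
    rw [circleIntegral.integral_add (circleIntegrable_const_mul (hint _) _)
      (circleIntegrable_const_mul (hint _) _), circleIntegral.integral_const_mul, circleIntegral.integral_const_mul, ih] at h0
    have hm : (m : ℂ) + 1 ≠ 0 := by exact_mod_cast Nat.succ_ne_zero m
    have hc := congrArg (Nat.cast (R := ℂ)) (Nat.succ_mul_centralBinom_succ m)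
    rw [Nat.centralBinom, Nat.centralBinom] at hc
    push_cast at hc
    refine mul_left_cancel₀ hm ?_
    rw [pow_succ (4 : ℂ), pow_succ (-1 : ℂ)]
    linear_combination -h0 + (2 * Real.pi * Complex.I * (-1) ^ m / 4 ^ m / 4) * hc

/-- Fubini in a form used twice: on `(0, T]` for the recursion of `recP`, and on `(0, ∞)` for
Euler's integral in the residue. -/
lemma circleIntegral_exp_swap {r : ℝ} (hr : 0 ≤ r) {h v : ℂ → ℂ}
    (hh : ContinuousOn h (Metric.sphere 0 r)) (hv : ContinuousOn v (Metric.sphere 0 r))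
    {S : Set ℝ} (hS : MeasurableSet S) {k : ℝ → ℂ} (hk : Measurable k) {B : ℝ → ℝ}
    (hB : IntegrableOn B S)
    (hle : ∀ s ∈ S, ∀ z ∈ Metric.sphere (0 : ℂ) r, ‖Complex.exp (-(v z * s))‖ * ‖k s‖ ≤ B s) :
    ∮ z in C(0, r), h z * ∫ s in S, Complex.exp (-(v z * s)) * k s =
      ∫ s in S, (∮ z in C(0, r), h z * Complex.exp (-(v z * s))) * k s := by
  have hmem : ∀ θ, circleMap (0 : ℂ) r θ ∈ Metric.sphere (0 : ℂ) r := circleMap_mem_sphere 0 hr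
  have hhc : Continuous fun θ => h (circleMap 0 r θ) := hh.comp_continuous (continuous_circleMap 0 r) hmem
  have hvc : Continuous fun θ => v (circleMap 0 r θ) := hv.comp_continuous (continuous_circleMap 0 r) hmem
  obtain ⟨K, hK⟩ := (isCompact_sphere (0 : ℂ) r).exists_bound_of_continuousOn hh
  have hd : Continuous (deriv (circleMap (0 : ℂ) r)) := by
    rw [funext (deriv_circleMap 0 r)]
    exact (continuous_circleMap 0 r).mul continuous_const
  set f : ℝ → ℝ → ℂ := fun θ s => deriv (circleMap 0 r) θ * (h (circleMap 0 r θ) *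
    (Complex.exp (-(v (circleMap 0 r θ) * s)) * k s)) with hf
  have hmeas : Measurable (Function.uncurry f) := by
    simp only [hf, Function.uncurry_def]
    have h1 : Measurable fun p : ℝ × ℝ => Complex.exp (-(v (circleMap 0 r p.1) * p.2)) := by
      have h0 : Continuous fun p : ℝ × ℝ => v (circleMap 0 r p.1) := hvc.comp continuous_fst
      have : Continuous fun p : ℝ × ℝ => Complex.exp (-(v (circleMap 0 r p.1) * p.2)) :=
        (h0.mul (Complex.continuous_ofReal.comp continuous_snd)).neg.cexp
      exact this.measurable
    exact (hd.measurable.comp measurable_fst).mul ((hhc.measurable.comp measurable_fst).mul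
      (h1.mul (hk.comp measurable_snd)))
  have hint : Integrable (Function.uncurry f)
      ((volume.restrict (Set.uIoc 0 (2 * Real.pi))).prod (volume.restrict S)) := by
    have hb : Integrable (fun p : ℝ × ℝ => (r * K) * B p.2)
        ((volume.restrict (Set.uIoc 0 (2 * Real.pi))).prod (volume.restrict S)) := by
      have hc : Integrable (fun _ : ℝ => r * K) (volume.restrict (Set.uIoc 0 (2 * Real.pi))) := by
        rw [Set.uIoc_of_le (by positivity)]
        exact integrableOn_const (by simp [ENNReal.mul_eq_top])
      exact hc.mul_prod hB
    refine hb.mono' hmeas.aestronglyMeasurable ?_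
    have hS2 : ∀ᵐ p : ℝ × ℝ ∂((volume.restrict (Set.uIoc 0 (2 * Real.pi))).prod
        (volume.restrict S)), p.2 ∈ S :=
      Measure.quasiMeasurePreserving_snd.ae (ae_restrict_mem hS)
    filter_upwards [hS2] with p hp
    have h1 := hle p.2 hp _ (hmem p.1)
    have h2 := hK _ (hmem p.1)
    simp only [Function.uncurry, hf]
    rw [norm_mul, norm_mul, norm_mul, deriv_circleMap, norm_mul, Complex.norm_I, mul_one,
      mem_sphere_zero_iff_norm.1 (hmem p.1), mul_assoc]
    exact mul_le_mul_of_nonneg_left (mul_le_mul h2 h1 (by positivity) ((norm_nonneg _).trans h2)) hr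
  have := intervalIntegral_integral_swap hint
  simp only [circleIntegral, smul_eq_mul]
  calc _ = ∫ θ in (0 : ℝ)..2 * Real.pi, ∫ s in S, f θ s := by
        refine intervalIntegral.integral_congr fun θ _ => ?_
        simp only [hf]
        rw [integral_const_mul, integral_const_mul]
    _ = _ := this
    _ = _ := by
        refine integral_congr_ae (ae_of_all _ fun s => ?_)
        simp only [hf]
        rw [← intervalIntegral.integral_mul_const]
        refine intervalIntegral.integral_congr fun θ _ => ?_
        ring

/-- The contour integral representation of the recursively defined polynomials. -/
lemma circleIntegral_eq_recP {r : ℝ} (hr0 : 0 < r) (hr : r < 1) (m : ℕ) {T : ℝ} (hT : 0 ≤ T) :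
    ∮ u in C(0, r), (u ^ (m + 1))⁻¹ * (1 + u) ^ (-(1 / 2) : ℂ) * Complex.exp (-(logTail u * T)) =
      2 * Real.pi * Complex.I * ((-1) ^ m / 2 ^ m * (recP m T : ℂ)) := by
  induction m using Nat.strong_induction_on generalizing T with
  | _ m ih =>
  have hψ : ContinuousOn logTail (Metric.sphere 0 r) :=
    differentiableOn_logTail.continuousOn.mono (sphere_subset_ball hr)
  have hg : ContinuousOn (fun u : ℂ => (u ^ (m + 1))⁻¹ * (1 + u) ^ (-(1 / 2) : ℂ))
      (Metric.sphere 0 r) :=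
    ((continuous_pow (m + 1)).continuousOn.inv₀ fun u hu =>
      pow_ne_zero _ (ne_zero_of_mem_sphere hr0 hu)).mul
      (differentiableOn_one_add_cpow.continuousOn.mono (sphere_subset_ball hr))
  -- This trades the exponential for an integral over `(0, T]` at the price of a factor `logTail u`.
  -- Expanding that factor lowers the pole order, so the induction hypothesis applies under the
  -- integral.
  have hexp : ∀ u : ℂ, Complex.exp (-(logTail u * T)) =
      1 - logTail u * ∫ s in Set.Ioc 0 T, Complex.exp (-(logTail u * s)) * 1 := fun u => by
    have h1 : ∫ s in (0 : ℝ)..T, -logTail u * Complex.exp (-(logTail u * s)) =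
        Complex.exp (-(logTail u * T)) - Complex.exp (-(logTail u * (0 : ℝ))) := by
      refine intervalIntegral.integral_eq_sub_of_hasDerivAt
        (f := fun s : ℝ => Complex.exp (-(logTail u * s))) (fun s _ => ?_)
        (Continuous.intervalIntegrable (by fun_prop) _ _)
      have := ((Complex.ofRealCLM.hasDerivAt (x := s)).const_mul (logTail u)).fun_neg.cexp
      refine this.congr_deriv ?_
      simp only [Complex.ofRealCLM_apply, Complex.ofReal_one]
      ring
    rw [intervalIntegral.integral_const_mul, intervalIntegral.integral_of_le hT] at h1
    simp only [Complex.ofReal_zero, mul_zero, neg_zero, Complex.exp_zero] at h1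
    simp only [mul_one]
    linear_combination -h1
  have hK := fun s (hs : s ∈ Set.Ioc 0 T) (z : ℂ) (hz : z ∈ Metric.sphere (0 : ℂ) r) =>
    show ‖Complex.exp (-(logTail z * s))‖ * ‖(1 : ℂ)‖ ≤ Real.exp (r * (1 - r)⁻¹ * T) from by
      rw [norm_one, mul_one, Complex.norm_exp, Real.exp_le_exp]
      refine (Complex.re_le_norm _).trans ?_
      rw [norm_neg, norm_mul, Complex.norm_real, Real.norm_of_nonneg hs.1.le]
      have := norm_logTail_le (mem_sphere_zero_iff_norm.1 hz).le hr
      exact mul_le_mul this hs.2 hs.1.le ((norm_nonneg _).trans this)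
  have hswap := circleIntegral_exp_swap hr0.le (hg.mul hψ) hψ measurableSet_Ioc
    (k := fun _ => 1) measurable_const (B := fun _ => Real.exp (r * (1 - r)⁻¹ * T))
    (integrableOn_const (by simp)) hK
  have hinner : ∀ s ∈ Set.Ioc 0 T,
      (∮ u in C(0, r), (u ^ (m + 1))⁻¹ * (1 + u) ^ (-(1 / 2) : ℂ) * logTail u *
        Complex.exp (-(logTail u * s))) * 1 =
      2 * Real.pi * Complex.I * ∑ k : Fin m, (-1 : ℂ) ^ ((k : ℕ) + 1) / (((k : ℕ) + 3 : ℕ) : ℂ) *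
        ((-1) ^ (m - 1 - (k : ℕ)) / 2 ^ (m - 1 - (k : ℕ)) * (recP (m - 1 - (k : ℕ)) s : ℂ)) := by
    intro s hs
    have hG : DifferentiableOn ℂ (fun u : ℂ => (1 + u) ^ (-(1 / 2) : ℂ) *
        Complex.exp (-(logTail u * s))) (Metric.ball 0 1) :=
      differentiableOn_one_add_cpow.mul ((differentiableOn_logTail.mul_const _).neg.cexp)
    have h1 := circleIntegral_mul_logTail hr0 hr hG m
    rw [mul_one, Finset.mul_sum]
    calc _ = _ := by
          refine circleIntegral.integral_congr hr0.le fun u _ => ?_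
          rw [mul_right_comm, mul_assoc ((u ^ (m + 1))⁻¹)]
      _ = _ := h1
      _ = _ := by
          refine Finset.sum_congr rfl fun k _ => ?_
          have hk := k.2
          have h2 := ih (m - 1 - (k : ℕ)) (by omega) hs.1.le
          simp only [mul_assoc] at h2 ⊢
          rw [h2]
          ring
  have hcont : ∀ i, Continuous (recP i) := fun i => by
    obtain ⟨q, -, -, hq⟩ := exists_polynomial_recP i
    rw [funext hq]
    exact q.continuous_aeval
  simp only [Pi.mul_apply] at hswap
  have hsplit : ∮ u in C(0, r), (u ^ (m + 1))⁻¹ * (1 + u) ^ (-(1 / 2) : ℂ) *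
      Complex.exp (-(logTail u * T)) =
      (∮ u in C(0, r), (u ^ (m + 1))⁻¹ * (1 + u) ^ (-(1 / 2) : ℂ)) -
      ∮ u in C(0, r), (u ^ (m + 1))⁻¹ * (1 + u) ^ (-(1 / 2) : ℂ) * logTail u *
        ∫ s in Set.Ioc 0 T, Complex.exp (-(logTail u * s)) * 1 := by
    rw [← circleIntegral.integral_sub (hg.circleIntegrable hr0.le)]
    · refine circleIntegral.integral_congr hr0.le fun u _ => ?_
      rw [hexp u]
      ring
    · have h1 : ContinuousOn (fun u : ℂ => (u ^ (m + 1))⁻¹ * (1 + u) ^ (-(1 / 2) : ℂ) *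
          (1 - Complex.exp (-(logTail u * T)))) (Metric.sphere 0 r) :=
        hg.mul (continuousOn_const.sub ((hψ.mul continuousOn_const).neg.cexp))
      refine (h1.congr fun u _ => ?_).circleIntegrable hr0.le
      rw [hexp u]
      ring
  rw [hsplit, hswap, setIntegral_congr_fun measurableSet_Ioc hinner, integral_const_mul,
    circleIntegral_inv_pow_mul_one_add_cpow hr0 hr, ← mul_sub, integral_finsetSum]
  · congr 1
    rw [recP]
    push_cast
    rw [mul_sub, Finset.mul_sum]
    congr 1
    · rw [show (4 : ℂ) ^ m = 2 ^ m * 2 ^ m by rw [← mul_pow]; norm_num]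
      field_simp
    · refine Finset.sum_congr rfl fun k _ => ?_
      have hk := k.2
      rw [integral_const_mul, integral_const_mul, intervalIntegral.integral_of_le hT,
        integral_complex_ofReal]
      have e1 : (-1 : ℂ) ^ m = (-1) ^ ((k : ℕ) + 1) * (-1) ^ (m - 1 - (k : ℕ)) := by
        rw [← pow_add]; congr 1; omega
      have e2 : (2 : ℂ) ^ m = 2 ^ ((k : ℕ) + 1) * 2 ^ (m - 1 - (k : ℕ)) := by
        rw [← pow_add]; congr 1; omega
      have hk3 : ((k : ℕ) : ℂ) + 3 ≠ 0 := by exact_mod_cast (by omega : (k : ℕ) + 3 ≠ 0)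
      rw [e1, e2]
      field_simp
  · intro k _
    exact (((Complex.continuous_ofReal.comp (hcont _)).integrableOn_Ioc).const_mul _).const_mul _

/-! ### The residue at the saddle point -/

lemma integrableOn_rpow_mul_exp {a b : ℝ} (ha : 0 < a) (hb : 0 < b) :
    IntegrableOn (fun s : ℝ => s ^ (a - 1) * Real.exp (-b * s)) (Set.Ioi 0) := by
  have := integrableOn_rpow_mul_exp_neg_mul_rpow (p := 1) (s := a - 1) (by linarith) one_pos hb
  simpa only [Real.rpow_one] using this

lemma integral_exp_mul_rpow_ofReal {a x : ℝ} (ha : 0 < a) (hx : 0 < x) :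
    ∫ s in Set.Ioi (0 : ℝ), Complex.exp (-((x : ℂ) * s)) * ((s ^ (a - 1) : ℝ) : ℂ) =
      (Real.Gamma a : ℂ) * ((x : ℂ) ^ (a : ℂ))⁻¹ := by
  have h := Complex.integral_cpow_mul_exp_neg_mul_Ioi (a := (a : ℂ)) (by simpa using ha) hx
  rw [one_div, ← Complex.ofReal_inv, ← Complex.ofReal_cpow (by positivity), Real.inv_rpow hx.le,
    Complex.ofReal_inv, Complex.ofReal_cpow hx.le, Complex.Gamma_ofReal] at h
  rw [mul_comm, ← h]
  refine setIntegral_congr_fun measurableSet_Ioi fun s hs => ?_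
  have hs : 0 < s := hs
  rw [mul_comm, Complex.ofReal_cpow hs.le]
  push_cast
  rfl

lemma differentiableAt_integral_exp_mul_rpow {a : ℝ} (ha : 0 < a) {v : ℂ} (hv : 0 < v.re) :
    DifferentiableAt ℂ (fun v : ℂ => ∫ s in Set.Ioi (0 : ℝ),
      Complex.exp (-(v * s)) * ((s ^ (a - 1) : ℝ) : ℂ)) v := by
  have hmeas : ∀ v : ℂ, AEStronglyMeasurable (fun s : ℝ =>
      Complex.exp (-(v * s)) * ((s ^ (a - 1) : ℝ) : ℂ)) (volume.restrict (Set.Ioi 0)) := fun v =>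
    (by fun_prop : Measurable _).aestronglyMeasurable
  have hnorm : ∀ (v : ℂ) (s : ℝ), ‖Complex.exp (-(v * s))‖ = Real.exp (-v.re * s) := fun v s => by
    rw [Complex.norm_exp]
    simp
  refine (hasDerivAt_integral_of_dominated_loc_of_deriv_le
    (μ := volume.restrict (Set.Ioi (0 : ℝ)))
    (F := fun (v : ℂ) (s : ℝ) => Complex.exp (-(v * s)) * ((s ^ (a - 1) : ℝ) : ℂ))
    (F' := fun (v : ℂ) (s : ℝ) => -(s : ℂ) * (Complex.exp (-(v * s)) * ((s ^ (a - 1) : ℝ) : ℂ)))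
    (bound := fun s : ℝ => s ^ (a + 1 - 1) * Real.exp (-(v.re / 2) * s))
    (Metric.ball_mem_nhds v (half_pos hv)) (Eventually.of_forall hmeas) ?_ ?_ ?_ ?_ ?_).2.differentiableAt
  · refine Integrable.mono' (integrableOn_rpow_mul_exp ha hv) (hmeas v) ?_
    filter_upwards [ae_restrict_mem measurableSet_Ioi] with s hs
    have hs : 0 < s := hs
    rw [norm_mul, hnorm, Complex.norm_real, Real.norm_of_nonneg (by positivity), mul_comm]
  · exact (by fun_prop : Measurable fun s : ℝ => -(s : ℂ) * (Complex.exp (-(v * s)) *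
      ((s ^ (a - 1) : ℝ) : ℂ))).aestronglyMeasurable
  · filter_upwards [ae_restrict_mem measurableSet_Ioi] with s hs v' hv'
    have hs : 0 < s := hs
    have h1 : v.re / 2 ≤ v'.re := by
      have h2 := (Complex.abs_re_le_norm (v' - v)).trans (mem_ball_iff_norm.1 hv').le
      rw [Complex.sub_re] at h2
      linarith [(abs_le.1 h2).1]
    rw [norm_mul, norm_mul, norm_neg, hnorm, Complex.norm_real, Complex.norm_real,
      Real.norm_of_nonneg hs.le, Real.norm_of_nonneg (by positivity), add_sub_right_comm,
      Real.rpow_add_one hs.ne']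
    have h3 : Real.exp (-v'.re * s) ≤ Real.exp (-(v.re / 2) * s) :=
      Real.exp_le_exp.2 (mul_le_mul_of_nonneg_right (by linarith) hs.le)
    calc _ ≤ s * (Real.exp (-(v.re / 2) * s) * s ^ (a - 1)) := by gcongr
      _ = _ := by ring
  · exact integrableOn_rpow_mul_exp (by linarith) (half_pos hv)
  · refine ae_of_all _ fun s v' _ => ?_
    have := (((hasDerivAt_id v').mul_const (s : ℂ)).fun_neg.cexp).mul_const ((s ^ (a - 1) : ℝ) : ℂ)
    refine this.congr_deriv ?_
    simp only [id]
    ring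

/-- Euler's integral for complex rate in the right half plane. -/
lemma integral_exp_mul_rpow_complex {a : ℝ} (ha : 0 < a) {v : ℂ} (hv : 0 < v.re) :
    ∫ s in Set.Ioi (0 : ℝ), Complex.exp (-(v * s)) * ((s ^ (a - 1) : ℝ) : ℂ) =
      (Real.Gamma a : ℂ) * (v ^ (a : ℂ))⁻¹ := by
  set U : Set ℂ := {v | 0 < v.re} with hU
  have hUo : IsOpen U := isOpen_lt continuous_const Complex.continuous_re
  have hslit : U ⊆ Complex.slitPlane := fun v hv => Or.inl hv
  have hf : AnalyticOnNhd ℂ (fun v : ℂ => ∫ s in Set.Ioi (0 : ℝ),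
      Complex.exp (-(v * s)) * ((s ^ (a - 1) : ℝ) : ℂ)) U :=
    DifferentiableOn.analyticOnNhd (fun v hv =>
      (differentiableAt_integral_exp_mul_rpow ha hv).differentiableWithinAt) hUo
  have hg : AnalyticOnNhd ℂ (fun v : ℂ => (Real.Gamma a : ℂ) * (v ^ (a : ℂ))⁻¹) U := by
    refine DifferentiableOn.analyticOnNhd (fun v hv => ?_) hUo
    have hv0 := hslit hv
    have h1 : DifferentiableAt ℂ (fun v : ℂ => v ^ (a : ℂ)) v :=
      ((hasDerivAt_id v).cpow_const hv0).differentiableAt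
    refine ((h1.fun_inv ?_).const_mul _).differentiableWithinAt
    rw [Ne, Complex.cpow_eq_zero_iff]
    exact fun h => Complex.slitPlane_ne_zero hv0 h.1
  have h1 : (1 : ℂ) ∈ U := by simp [hU]
  -- Both sides are holomorphic on the right half plane and agree on the positive axis, which
  -- accumulates at `1`.
  refine hf.eqOn_of_preconnected_of_frequently_eq hg
    (convex_halfSpace_re_gt 0).isPreconnected h1 ?_ hv
  have ht : Tendsto (fun t : ℝ => (t : ℂ)) (𝓝[≠] 1) (𝓝[≠] (1 : ℂ)) := by
    refine tendsto_nhdsWithin_of_tendsto_nhds_of_eventually_within _ ?_ ?_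
    · exact (Complex.continuous_ofReal.tendsto' 1 1 Complex.ofReal_one).mono_left nhdsWithin_le_nhds
    · filter_upwards [self_mem_nhdsWithin] with t ht
      simpa using ht
  refine ht.frequently (Eventually.frequently ?_)
  filter_upwards [nhdsWithin_le_nhds (lt_mem_nhds zero_lt_one)] with t ht
  exact integral_exp_mul_rpow_ofReal ha ht

lemma ofReal_mul_cpow {a : ℝ} (ha : 0 < a) {z : ℂ} (hz : z ≠ 0) (s : ℂ) :
    ((a : ℂ) * z) ^ s = (a : ℂ) ^ s * z ^ s := by
  have ha0 : (a : ℂ) ≠ 0 := by exact_mod_cast ha.ne'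
  rw [Complex.cpow_def_of_ne_zero (mul_ne_zero ha0 hz), Complex.cpow_def_of_ne_zero ha0,
    Complex.cpow_def_of_ne_zero hz, Complex.log_ofReal_mul ha hz, ← Complex.exp_add, add_mul,
    Complex.ofReal_log ha.le]

lemma one_sub_exp_mul_one_add_coth {β : ℝ} (hβ : 0 < β) :
    (1 - Real.exp (-2 * β)) * (1 + coth β) = 2 := by
  have hs : Real.sinh β ≠ 0 := (Real.sinh_pos_iff.2 hβ).ne'
  rw [coth]
  field_simp
  rw [Real.sinh_eq, Real.cosh_eq, show -(2 * β) = -β + -β by ring, Real.exp_add]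
  have : Real.exp β * Real.exp (-β) = 1 := by rw [← Real.exp_add]; simp
  linear_combination (-Real.exp (-β)) * this

lemma four_mul_tMinus_sq (β : ℝ) : 4 * tMinus β ^ 2 = Real.exp (-2 * β) := by
  rw [tMinus, div_pow, ← Real.exp_nat_mul]
  push_cast
  rw [show (2 : ℝ) * -β = -2 * β by ring]
  ring

/-- In `f(t₋ (1 + u))` the linear terms cancel against that of `log (1 + u)`; the quadratic terms
give the constant, and the rest of the logarithm is `u² ψ(u)` by definition of `logTail`. The
coefficient of `ψ` comes from `(1 - exp (-2β)) (1 + coth β) = 2`. -/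
lemma phaseQuot_tMinus_mul {β : ℝ} (hβ : 0 < β) {u : ℂ} (hu0 : u ≠ 0) (hu : ‖u‖ < 1) :
    phaseQuot β ((tMinus β : ℂ) * (1 + u)) =
      (((1 - Real.exp (-2 * β)) / (4 * tMinus β ^ 2) : ℝ) : ℂ) *
        (1 + (1 + coth β : ℝ) * logTail u) := by
  have hc := tMinus_pos β
  have h1 := phaseQuot_mul β ((tMinus β : ℂ) * (1 + u))
  have h1u : 1 + u ≠ 0 :=
    Complex.slitPlane_ne_zero (Complex.mem_slitPlane_of_norm_lt_one hu)
  have hlog := sq_mul_logTail hu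
  have hc0 : (tMinus β : ℂ) ≠ 0 := by exact_mod_cast hc.ne'
  rw [phase, phase, Complex.log_ofReal_mul hc h1u, Complex.ofReal_log hc.le] at h1
  have e1 : (4 : ℂ) * (tMinus β : ℂ) ^ 2 = 1 - ((1 - Real.exp (-2 * β) : ℝ) : ℂ) := by
    have := congrArg Complex.ofReal (four_mul_tMinus_sq β)
    push_cast at this ⊢
    rw [this]
    ring
  have e2 : ((1 - Real.exp (-2 * β) : ℝ) : ℂ) * ((1 + coth β : ℝ) : ℂ) = 2 := by
    exact_mod_cast congrArg Complex.ofReal (one_sub_exp_mul_one_add_coth hβ)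
  have e3 : (2 : ℂ) * (tMinus β : ℂ) * (Real.cosh β : ℂ) = 2 * (tMinus β : ℂ) ^ 2 + 1 / 2 := by
    have h : 2 * tMinus β * Real.cosh β = 2 * tMinus β ^ 2 + 1 / 2 := by
      rw [← tMinus_add_tPlus]
      linear_combination 2 * tMinus_mul_tPlus β
    have := congrArg Complex.ofReal h
    push_cast at this ⊢
    exact this
  set κ : ℂ := ((1 - Real.exp (-2 * β) : ℝ) : ℂ) with hκ
  set τ : ℂ := ((1 + coth β : ℝ) : ℂ) with hτ
  set c : ℂ := (tMinus β : ℂ) with hcdef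
  have h2 : (c * u) ^ 2 * phaseQuot β (c * (1 + u)) = u ^ 2 * κ / 4 * (1 + τ * logTail u) := by
    rw [show c * u = c * (1 + u) - c by ring, h1]
    linear_combination u * e3 - (1 / 2 : ℂ) * hlog - u ^ 2 / 4 * e1 - u ^ 2 / 4 * logTail u * e2
  have h3 : (((1 - Real.exp (-2 * β)) / (4 * tMinus β ^ 2) : ℝ) : ℂ) = κ / (4 * c ^ 2) := by
    rw [hκ, hcdef]
    push_cast
    rfl
  rw [h3]
  have h4 : (c * u) ^ 2 ≠ 0 := pow_ne_zero _ (mul_ne_zero hc0 hu0)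
  refine mul_left_cancel₀ h4 ?_
  rw [h2]
  field_simp

/-- Positive real factors come out of the principal powers, and `(-i) ^ (-(2 j + 1)) = (-1) ^ j i`.
What remains is a pole of order `2 j + 1` at `u = 0` and a half-integer power of `1 + (1 + coth β)
ψ`. -/
lemma coeffIntegrand_tMinus_mul {β : ℝ} (hβ : 0 < β) {u : ℂ} (hu0 : u ≠ 0) (hu : ‖u‖ < 1)
    (hv : 0 < (1 + (1 + coth β : ℝ) * logTail u).re) (j : ℕ) :
    (tMinus β : ℂ) * coeffIntegrand (phaseRoot β) j ((tMinus β : ℂ) * (1 + u)) =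
      ((√(tMinus β) * (-1) ^ j * 2 ^ (2 * j + 1) / √(1 - Real.exp (-2 * β)) ^ (2 * j + 1) : ℝ) : ℂ) *
        Complex.I * ((u ^ (2 * j + 1))⁻¹ * (1 + u) ^ (-(1 / 2) : ℂ) *
          ((1 + (1 + coth β : ℝ) * logTail u) ^ (((j : ℝ) + 1 / 2 : ℝ) : ℂ))⁻¹) := by
  have hc := tMinus_pos β
  have hκ : 0 < 1 - Real.exp (-2 * β) := by
    rw [sub_pos, Real.exp_lt_one_iff]
    linarith
  have h1u : 1 + u ≠ 0 :=
    Complex.slitPlane_ne_zero (Complex.mem_slitPlane_of_norm_lt_one hu)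
  set v := 1 + (1 + coth β : ℝ) * logTail u with hvdef
  have hv0 : v ≠ 0 := fun h => by rw [h] at hv; simp at hv
  have hsq : Complex.sqrt v ≠ 0 := fun h => hv0 (by rw [← sqrt_sq v, h]; simp)
  have hc0 : (tMinus β : ℂ) ≠ 0 := by exact_mod_cast hc.ne'
  have hW : phaseRoot β ((tMinus β : ℂ) * (1 + u)) =
      -Complex.I * (u / 2 * (√(1 - Real.exp (-2 * β)) : ℂ) * Complex.sqrt v) := by
    rw [phaseRoot, phaseQuot_tMinus_mul hβ hu0 hu]
    have e : Complex.sqrt ((((1 - Real.exp (-2 * β)) / (4 * tMinus β ^ 2) : ℝ) : ℂ) * v) =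
        ((√(1 - Real.exp (-2 * β)) / (2 * tMinus β) : ℝ) : ℂ) * Complex.sqrt v := by
      rw [Complex.sqrt, ofReal_mul_cpow (by positivity) hv0, ← Complex.sqrt, ← Complex.sqrt,
        sqrt_ofReal (by positivity), Real.sqrt_div hκ.le,
        show 4 * tMinus β ^ 2 = (2 * tMinus β) ^ 2 by ring, Real.sqrt_sq (by positivity)]
    rw [e]
    push_cast
    field_simp
    ring
  have hpow : v ^ (((j : ℝ) + 1 / 2 : ℝ) : ℂ) = Complex.sqrt v ^ (2 * j + 1) := by
    rw [Complex.sqrt, ← Complex.cpow_nat_mul]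
    congr 1
    push_cast
    ring
  have hI : Complex.I ^ (2 * j + 1) = (-1) ^ j * Complex.I := by
    rw [pow_succ, pow_mul, Complex.I_sq]
  have hcc : (tMinus β : ℂ) * (tMinus β : ℂ) ^ (-(1 / 2) : ℂ) = (√(tMinus β) : ℂ) := by
    have : tMinus β * tMinus β ^ (-(1 / 2) : ℝ) = √(tMinus β) := by
      rw [Real.sqrt_eq_rpow]
      nth_rw 1 [← Real.rpow_one (tMinus β)]
      rw [← Real.rpow_add hc]
      norm_num
    rw [← this]
    push_cast
    rw [Complex.ofReal_cpow hc.le]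
    push_cast
    rfl
  have hκ0 : (√(1 - Real.exp (-2 * β)) : ℂ) ≠ 0 := by exact_mod_cast (Real.sqrt_pos.2 hκ).ne'
  rw [coeffIntegrand, hW, ofReal_mul_cpow hc h1u, hpow, mul_div_assoc', ← mul_assoc, hcc,
    mul_pow, mul_pow, mul_pow, neg_pow Complex.I, hI, div_pow]
  push_cast
  have hm : (-1 : ℂ) ^ (2 * j + 1) = -1 := by rw [pow_succ, pow_mul]; simp
  have hm2 : (-1 : ℂ) ^ j * (-1) ^ j = 1 := by rw [← mul_pow]; simp
  have hm0 : (-1 : ℂ) ^ j ≠ 0 := pow_ne_zero _ (by norm_num)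
  have hunit : ((-1 : ℂ) * ((-1) ^ j * Complex.I))⁻¹ = (-1) ^ j * Complex.I := by
    refine inv_eq_of_mul_eq_one_left ?_
    linear_combination (-1 : ℂ) * (Complex.I ^ 2) * hm2 - Complex.I_sq
  rw [hm, div_eq_mul_inv, mul_inv (-1 * ((-1) ^ j * Complex.I)), hunit]
  field_simp

lemma circleIntegral_comp_mul_one_add {c r : ℝ} (G : ℂ → ℂ) :
    ∮ z in C((c : ℂ), c * r), G z = ∮ u in C(0, r), (c : ℂ) * G ((c : ℂ) * (1 + u)) := by
  simp only [circleIntegral, deriv_circleMap, smul_eq_mul]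
  refine intervalIntegral.integral_congr fun θ _ => ?_
  have h : circleMap (c : ℂ) (c * r) θ = (c : ℂ) * (1 + circleMap 0 r θ) := by
    simp only [circleMap]
    push_cast
    ring
  simp only [h]
  simp only [circleMap]
  push_cast
  ring

/-- The two bounds on `r` keep the real part of `v = 1 + (1 + coth β) ψ` at least `1/2` on the
circle, so Euler's integral represents `v ^ (-(j + 1/2))` there. After interchanging the integrals
the inner one is that of `recP (2 * j)`. -/
lemma circleIntegral_coeffIntegrand {β r : ℝ} (hβ : 0 < β) (hr0 : 0 < r) (hr : r ≤ 1 / 2)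
    (hrτ : r * (1 + coth β) ≤ 1 / 4) (j : ℕ) :
    ∮ z in C((tMinus β : ℂ), tMinus β * r), coeffIntegrand (phaseRoot β) j z =
      ((-(4 * Real.pi * √(tMinus β) * (-1) ^ j /
        (√(1 - Real.exp (-2 * β)) ^ (2 * j + 1) * Real.Gamma ((j : ℝ) + 1 / 2))) *
        ∫ s in Set.Ioi (0 : ℝ), Real.exp (-s) * s ^ ((j : ℝ) - 1 / 2) *
          recP (2 * j) ((1 + coth β) * s) : ℝ) : ℂ) := by
  have hr1 : r < 1 := by linarith
  have hτ : 0 < 1 + coth β := by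
    have : 0 < coth β := div_pos (Real.cosh_pos β) (Real.sinh_pos_iff.2 hβ)
    linarith
  set τ := 1 + coth β with hτdef
  have ha : 0 < (j : ℝ) + 1 / 2 := by positivity
  set v : ℂ → ℂ := fun u => 1 + (τ : ℂ) * logTail u with hvdef
  have hv : ∀ u ∈ Metric.sphere (0 : ℂ) r, 1 / 2 ≤ (v u).re := fun u hu => by
    have h1 := norm_logTail_le (mem_sphere_zero_iff_norm.1 hu).le hr1
    have h2 : r * (1 - r)⁻¹ ≤ 2 * r := by
      rw [mul_comm]
      refine mul_le_mul_of_nonneg_right ?_ hr0.le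
      rw [inv_le_comm₀ (by linarith) two_pos]
      linarith
    have h3 : |(logTail u).re| ≤ 2 * r := (Complex.abs_re_le_norm _).trans (h1.trans h2)
    simp only [hvdef, Complex.add_re, Complex.one_re, Complex.re_ofReal_mul]
    have h4 : τ * -(2 * r) ≤ τ * (logTail u).re :=
      mul_le_mul_of_nonneg_left (abs_le.1 h3).1 hτ.le
    linarith
  have hψ : ContinuousOn logTail (Metric.sphere 0 r) :=
    differentiableOn_logTail.continuousOn.mono (sphere_subset_ball hr1)
  have hvc : ContinuousOn v (Metric.sphere 0 r) :=
    continuousOn_const.add (continuousOn_const.mul hψ)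
  have hg : ContinuousOn (fun u : ℂ => (u ^ (2 * j + 1))⁻¹ * (1 + u) ^ (-(1 / 2) : ℂ))
      (Metric.sphere 0 r) :=
    ((continuous_pow (2 * j + 1)).continuousOn.inv₀ fun u hu =>
      pow_ne_zero _ (ne_zero_of_mem_sphere hr0 hu)).mul
      (differentiableOn_one_add_cpow.continuousOn.mono (sphere_subset_ball hr1))
  set k : ℝ → ℂ := fun s => ((s ^ ((j : ℝ) + 1 / 2 - 1) : ℝ) : ℂ) with hk
  have hswap := circleIntegral_exp_swap hr0.le hg hvc measurableSet_Ioi (k := k)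
    (by simp only [hk]; fun_prop) (integrableOn_rpow_mul_exp ha (half_pos one_pos))
    (fun s hs z hz => by
      have hs : 0 < s := hs
      rw [Complex.norm_exp, Complex.norm_real, Real.norm_of_nonneg (by positivity), mul_comm]
      gcongr
      simp only [Complex.neg_re, Complex.re_mul_ofReal, neg_mul]
      exact neg_le_neg (mul_le_mul_of_nonneg_right (hv z hz) hs.le))
  set G := Real.Gamma ((j : ℝ) + 1 / 2) with hG
  have hG0 : (G : ℂ) ≠ 0 := by exact_mod_cast (Real.Gamma_pos_of_pos ha).ne'
  set A : ℝ := √(tMinus β) * (-1) ^ j * 2 ^ (2 * j + 1) / √(1 - Real.exp (-2 * β)) ^ (2 * j + 1)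
    with hA
  rw [circleIntegral_comp_mul_one_add]
  have h1 : ∮ u in C(0, r), (tMinus β : ℂ) *
      coeffIntegrand (phaseRoot β) j ((tMinus β : ℂ) * (1 + u)) =
      ∮ u in C(0, r), (A * Complex.I / G) * ((u ^ (2 * j + 1))⁻¹ * (1 + u) ^ (-(1 / 2) : ℂ) *
        ∫ s in Set.Ioi (0 : ℝ), Complex.exp (-(v u * s)) * k s) := by
    refine circleIntegral.integral_congr hr0.le fun u hu => ?_
    have hvu : 0 < (v u).re := by linarith [hv u hu]
    have h3 := coeffIntegrand_tMinus_mul hβ (ne_zero_of_mem_sphere hr0 hu)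
      (by rw [mem_sphere_zero_iff_norm.1 hu]; exact hr1) hvu j
    have h4 : 1 + ((1 + coth β : ℝ) : ℂ) * logTail u = v u := rfl
    rw [h4, ← hA] at h3
    simp only [hk]
    rw [integral_exp_mul_rpow_complex ha hvu, h3, ← hG]
    field_simp
  have h2 : ∀ s ∈ Set.Ioi (0 : ℝ), (∮ u in C(0, r), (u ^ (2 * j + 1))⁻¹ *
      (1 + u) ^ (-(1 / 2) : ℂ) * Complex.exp (-(v u * s))) * k s =
      2 * Real.pi * Complex.I / 2 ^ (2 * j) * ((Real.exp (-s) * s ^ ((j : ℝ) - 1 / 2) *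
          recP (2 * j) (τ * s) : ℝ) : ℂ) := fun s hs => by
    have hs : 0 < s := hs
    have h3 := circleIntegral_eq_recP hr0 hr1 (2 * j) (T := τ * s) (by positivity)
    have h4 : ∮ u in C(0, r), (u ^ (2 * j + 1))⁻¹ *
        (1 + u) ^ (-(1 / 2) : ℂ) * Complex.exp (-(v u * s)) = (Real.exp (-s) : ℂ) *
        ∮ u in C(0, r), (u ^ (2 * j + 1))⁻¹ * (1 + u) ^ (-(1 / 2) : ℂ) *
          Complex.exp (-(logTail u * (τ * s : ℝ))) := by
      rw [← circleIntegral.integral_const_mul]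
      refine circleIntegral.integral_congr hr0.le fun u _ => ?_
      simp only [hvdef]
      rw [show -((1 + (τ : ℂ) * logTail u) * s) = ((-s : ℝ) : ℂ) + -(logTail u * (τ * s : ℝ)) by
        push_cast; ring, Complex.exp_add, Complex.ofReal_exp]
      ring
    rw [h4, h3]
    simp only [hk]
    rw [show (j : ℝ) + 1 / 2 - 1 = j - 1 / 2 by ring, pow_mul (-1 : ℂ)]
    push_cast
    simp only [neg_one_sq, one_pow]
    ring
  rw [h1, circleIntegral.integral_const_mul, hswap, setIntegral_congr_fun measurableSet_Ioi h2,
    integral_const_mul, integral_complex_ofReal]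
  set J := ∫ s in Set.Ioi (0 : ℝ), Real.exp (-s) * s ^ ((j : ℝ) - 1 / 2) * recP (2 * j) (τ * s)
  rw [hA]
  push_cast
  have hI2 := Complex.I_sq
  rw [pow_succ (2 : ℂ)]
  field_simp
  rw [hI2]
  ring

lemma sqrt_tMinus_mul_sinh (β : ℝ) :
    √(Real.sinh β) * √(tMinus β) = √(1 - Real.exp (-2 * β)) / 2 := by
  have h : tMinus β * Real.sinh β = (1 - Real.exp (-2 * β)) / 2 ^ 2 := by
    rw [tMinus, Real.sinh_eq, show -2 * β = -β + -β by ring, Real.exp_add]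
    have : Real.exp β * Real.exp (-β) = 1 := by rw [← Real.exp_add]; simp
    linear_combination (1 / 4 : ℝ) * this
  rw [mul_comm, ← Real.sqrt_mul (tMinus_pos β).le, h, Real.sqrt_div' _ (by positivity),
    Real.sqrt_sq two_pos.le]

/-- A radius on which the residue at `t₋` can be evaluated. -/
lemma exists_circleIntegral_coeffIntegrand {β : ℝ} (hβ : 0 < β) :
    ∃ ρ, 0 < ρ ∧ ρ < tMinus β ∧ ρ ≤ tPlus β - tMinus β ∧ ∀ j : ℕ,
      -((√(Real.sinh β) * Real.Gamma ((j : ℝ) + 1 / 2) / (2 * Real.pi ^ (3 / 2 : ℝ)) : ℝ) : ℂ) *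
        ∮ z in C((tMinus β : ℂ), ρ), coeffIntegrand (phaseRoot β) j z = (coeffA j (coth β) : ℂ) := by
  have hc := tMinus_pos β
  have hct := tMinus_lt_tPlus hβ
  have hτ : 0 < 1 + coth β := by
    have : 0 < coth β := div_pos (Real.cosh_pos β) (Real.sinh_pos_iff.2 hβ)
    linarith
  -- The first two bounds make the residue computable, the third keeps the disc of radius `t₋ r`
  -- around `t₋` from reaching beyond `t₊`.
  set r := min (min (1 / 2) (1 / (4 * (1 + coth β)))) ((tPlus β - tMinus β) / tMinus β) with hr
  have hr0 : 0 < r := lt_min (lt_min (by norm_num) (by positivity)) (div_pos (by linarith) hc)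
  have hr1 : r ≤ 1 / 2 := (min_le_left _ _).trans (min_le_left _ _)
  have hr2 : r * (1 + coth β) ≤ 1 / 4 := by
    have : r ≤ 1 / (4 * (1 + coth β)) := (min_le_left _ _).trans (min_le_right _ _)
    rw [le_div_iff₀ (by positivity)] at this
    linarith
  have hr3 : r ≤ (tPlus β - tMinus β) / tMinus β := min_le_right _ _
  rw [le_div_iff₀ hc] at hr3
  refine ⟨tMinus β * r, by positivity, by nlinarith, by linarith, fun j => ?_⟩
  rw [circleIntegral_coeffIntegrand hβ hr0 hr1 hr2, ← Complex.ofReal_neg, ← Complex.ofReal_mul]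
  congr 1
  rw [coeffA]
  set J := ∫ s in Set.Ioi (0 : ℝ), Real.exp (-s) * s ^ ((j : ℝ) - 1 / 2) *
    recP (2 * j) ((1 + coth β) * s)
  have hκ : 0 < 1 - Real.exp (-2 * β) := by
    rw [sub_pos, Real.exp_lt_one_iff]
    linarith
  have h1 : ((1 + coth β) / 2) ^ j * √(1 - Real.exp (-2 * β)) ^ (2 * j) = 1 := by
    rw [pow_mul, Real.sq_sqrt hκ.le, ← mul_pow]
    rw [show (1 + coth β) / 2 * (1 - Real.exp (-2 * β)) = 1 by
      linear_combination (1 / 2 : ℝ) * one_sub_exp_mul_one_add_coth hβ, one_pow]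
  have h2 := sqrt_tMinus_mul_sinh β
  have h3 : Real.pi ^ (3 / 2 : ℝ) = Real.pi * √Real.pi := by
    rw [Real.sqrt_eq_rpow, show (3 / 2 : ℝ) = 1 + 1 / 2 by norm_num,
      Real.rpow_add Real.pi_pos, Real.rpow_one]
  have hG0 : Real.Gamma ((j : ℝ) + 1 / 2) ≠ 0 := (Real.Gamma_pos_of_pos (by positivity)).ne'
  have hπ := Real.pi_pos
  have hsπ : √Real.pi ≠ 0 := (Real.sqrt_pos.2 hπ).ne'
  have hk0 : √(1 - Real.exp (-2 * β)) ≠ 0 := (Real.sqrt_pos.2 hκ).ne'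
  have hk2 : √(1 - Real.exp (-2 * β)) ^ (2 * j) ≠ 0 := pow_ne_zero _ hk0
  rw [eq_div_of_mul_eq hk2 h1, h3, pow_succ]
  clear_value J
  generalize √(1 - Real.exp (-2 * β)) = k at *
  field_simp
  linear_combination 4 * J * h2

lemma contourCoeff_phaseRoot {β δ : ℝ} (hβ : 0 < β) (hδ : 0 < δ) (hδc : δ < tMinus β) (j : ℕ) :
    contourCoeff β δ (phaseRoot β) j = (coeffA j (coth β) : ℂ) := by
  obtain ⟨ρ, hρ, hρc, hρt, h⟩ := exists_circleIntegral_coeffIntegrand hβ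
  rw [contourCoeff, contourIntegral_eq_circleIntegral hβ (differentiableOn_coeffIntegrand hβ j)
    (outerDecay_coeffIntegrand β j) hρ hρc hρt hδ hδc
    (contourIntegrable_coeffIntegrand hβ hδ hδc j), h]

lemma IsPhaseRoot.contourCoeff_eq {β δ : ℝ} (hβ : 0 < β) {w : ℂ → ℂ} (hw : IsPhaseRoot β w)
    (hδ : 0 < δ) (hδc : δ < tMinus β) (j : ℕ) :
    ContourIntegrable β δ (coeffIntegrand w j) ∧
      contourCoeff β δ w j = (coeffA j (coth β) : ℂ) := by
  have h := hw.coeffIntegrand_eqOn hβ j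
  refine ⟨contourIntegrable_congr hβ hδ hδc h (contourIntegrable_coeffIntegrand hβ hδ hδc j), ?_⟩
  rw [← contourCoeff_phaseRoot hβ hδ hδc j, contourCoeff, contourCoeff,
    contourIntegral_congr hβ hδ hδc h]

/-! ### Contour integrals for the Hermite polynomials -/

lemma derivative_hermite_succ (n : ℕ) :
    Polynomial.derivative (Polynomial.hermite (n + 1)) = (n + 1 : ℤ) • Polynomial.hermite n := by
  induction n with
  | zero => simp
  | succ n ih =>
    rw [Polynomial.hermite_succ (n + 1), Polynomial.derivative_sub, Polynomial.derivative_mul,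
      Polynomial.derivative_X, ih, Polynomial.derivative_smul, Polynomial.hermite_succ n]
    simp only [zsmul_eq_mul]
    push_cast
    ring

lemma hermite_succ_succ (n : ℕ) : Polynomial.hermite (n + 2) =
    Polynomial.X * Polynomial.hermite (n + 1) - (n + 1 : ℤ) • Polynomial.hermite n := by
  rw [Polynomial.hermite_succ (n + 1), derivative_hermite_succ]

/-- Up to a constant the integrand `z ^ (-1/2) * exp (-N w(z) ^ 2)`, `N = 2 n + 1`. -/
def hermiteKernel (N a : ℝ) (n : ℕ) (z : ℂ) : ℂ :=
  (z ^ (n + 1))⁻¹ * Complex.exp ((N : ℂ) * (2 * a * z - z ^ 2))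

lemma hasDerivAt_exp_quadratic (N a : ℝ) (z : ℂ) :
    HasDerivAt (fun z : ℂ => Complex.exp ((N : ℂ) * (2 * a * z - z ^ 2)))
      (Complex.exp ((N : ℂ) * (2 * a * z - z ^ 2)) * ((N : ℂ) * (2 * a - 2 * z))) z := by
  have h := ((((hasDerivAt_id z).const_mul (2 * (a : ℂ))).fun_sub
    (hasDerivAt_pow 2 z)).const_mul (N : ℂ)).cexp
  refine h.congr_deriv ?_
  simp

lemma hermiteKernel_differentiableAt (N a : ℝ) (n : ℕ) {z : ℂ} (hz : z ≠ 0) :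
    DifferentiableAt ℂ (hermiteKernel N a n) z :=
  ((differentiableAt_id.pow (n + 1)).inv (pow_ne_zero _ hz)).mul
    (hasDerivAt_exp_quadratic N a z).differentiableAt

lemma continuousOn_hermiteKernel_sphere (N a : ℝ) (n : ℕ) {r : ℝ} (hr : 0 < r) :
    ContinuousOn (hermiteKernel N a n) (Metric.sphere 0 r) := fun _ hz =>
  (hermiteKernel_differentiableAt N a n
    (ne_zero_of_mem_sphere hr hz)).continuousAt.continuousWithinAt

/-- The derivative of the kernel of index `n + 1` has vanishing integral around the circle; written
out, this is the three-term recurrence. -/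
lemma circleIntegral_hermiteKernel_succ_succ (N a : ℝ) (n : ℕ) {r : ℝ} (hr : 0 < r) :
    ((n : ℂ) + 2) * ∮ z in C(0, r), hermiteKernel N a (n + 2) z =
      2 * N * a * (∮ z in C(0, r), hermiteKernel N a (n + 1) z) -
        2 * N * ∮ z in C(0, r), hermiteKernel N a n z := by
  have hint := fun k => (continuousOn_hermiteKernel_sphere N a k hr).circleIntegrable hr.le
  have h0 : ∮ z in C(0, r), (-((n : ℂ) + 2) * hermiteKernel N a (n + 2) z +
      (2 * N * a * hermiteKernel N a (n + 1) z + -(2 * N) * hermiteKernel N a n z)) = 0 := by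
    refine circleIntegral.integral_eq_zero_of_hasDerivWithinAt
      (f := hermiteKernel N a (n + 1)) hr.le fun z hz => ?_
    have hz0 := ne_zero_of_mem_sphere hr hz
    have h1 := ((hasDerivAt_pow (n + 1 + 1) z).fun_inv (pow_ne_zero _ hz0)).fun_mul
      (hasDerivAt_exp_quadratic N a z)
    refine (h1.congr_deriv ?_).hasDerivWithinAt
    simp only [hermiteKernel]
    generalize Complex.exp ((N : ℂ) * (2 * a * z - z ^ 2)) = g
    simp only [Nat.add_sub_cancel]
    push_cast
    field_simp
    ring
  rw [circleIntegral.integral_add (circleIntegrable_const_mul (hint _) _)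
    ((circleIntegrable_const_mul (hint _) _).fun_add (circleIntegrable_const_mul (hint _) _)),
    circleIntegral.integral_add (circleIntegrable_const_mul (hint _) _)
      (circleIntegrable_const_mul (hint _) _),
    circleIntegral.integral_const_mul, circleIntegral.integral_const_mul,
    circleIntegral.integral_const_mul] at h0
  linear_combination -h0

lemma circleIntegral_hermiteKernel_zero (N a : ℝ) {r : ℝ} (hr : 0 < r) :
    ∮ z in C(0, r), hermiteKernel N a 0 z = 2 * Real.pi * Complex.I := by
  have h : Differentiable ℂ fun z : ℂ => Complex.exp ((N : ℂ) * (2 * a * z - z ^ 2)) := fun z =>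
    (hasDerivAt_exp_quadratic N a z).differentiableAt
  have := h.differentiableOn.circleIntegral_sub_inv_smul (c := 0) (Metric.mem_ball_self hr)
  simpa [hermiteKernel] using this

/-- The same argument one step lower, where the third term is the entire exponential and integrates
to zero. -/
lemma circleIntegral_hermiteKernel_one (N a : ℝ) {r : ℝ} (hr : 0 < r) :
    ∮ z in C(0, r), hermiteKernel N a 1 z = 2 * N * a * (2 * Real.pi * Complex.I) := by
  have hint := fun k => (continuousOn_hermiteKernel_sphere N a k hr).circleIntegrable hr.le
  have hg : Continuous fun z : ℂ => Complex.exp ((N : ℂ) * (2 * a * z - z ^ 2)) := by fun_prop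
  have h0 : ∮ z in C(0, r), (-1 * hermiteKernel N a 1 z + (2 * N * a * hermiteKernel N a 0 z +
      -(2 * N) * Complex.exp ((N : ℂ) * (2 * a * z - z ^ 2)))) = 0 := by
    refine circleIntegral.integral_eq_zero_of_hasDerivWithinAt
      (f := hermiteKernel N a 0) hr.le fun z hz => ?_
    have hz0 := ne_zero_of_mem_sphere hr hz
    have h1 := ((hasDerivAt_pow (0 + 1) z).fun_inv (pow_ne_zero _ hz0)).fun_mul
      (hasDerivAt_exp_quadratic N a z)
    refine (h1.congr_deriv ?_).hasDerivWithinAt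
    simp only [hermiteKernel]
    generalize Complex.exp ((N : ℂ) * (2 * a * z - z ^ 2)) = g
    simp
    field_simp
    ring
  have hz : ∮ z in C(0, r), Complex.exp ((N : ℂ) * (2 * a * z - z ^ 2)) = 0 :=
    Complex.circleIntegral_eq_zero_of_differentiable_on_off_countable hr.le Set.countable_empty
      hg.continuousOn fun z _ => (hasDerivAt_exp_quadratic N a z).differentiableAt
  have hgi := hg.continuousOn.circleIntegrable (c := 0) hr.le
  rw [circleIntegral.integral_add (circleIntegrable_const_mul (hint _) _)
    ((circleIntegrable_const_mul (hint _) _).fun_add (circleIntegrable_const_mul hgi _)),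
    circleIntegral.integral_add (circleIntegrable_const_mul (hint _) _)
      (circleIntegrable_const_mul hgi _),
    circleIntegral.integral_const_mul, circleIntegral.integral_const_mul,
    circleIntegral.integral_const_mul, hz, circleIntegral_hermiteKernel_zero N a hr] at h0
  linear_combination -h0

lemma physHermite_zero (x : ℝ) : physHermite 0 x = 1 := by simp [physHermite]

lemma physHermite_one (x : ℝ) : physHermite 1 x = 2 * x := by
  have := Real.mul_self_sqrt (zero_le_two (α := ℝ))
  simp only [physHermite, pow_one, Polynomial.hermite_one, Polynomial.aeval_X]
  linear_combination x * this

lemma physHermite_succ_succ (n : ℕ) (x : ℝ) :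
    physHermite (n + 2) x = 2 * x * physHermite (n + 1) x - 2 * (n + 1) * physHermite n x := by
  have := Real.mul_self_sqrt (zero_le_two (α := ℝ))
  have h : Polynomial.aeval (√2 * x) ((n + 1 : ℤ) • Polynomial.hermite n) =
      ((n : ℝ) + 1) * Polynomial.aeval (√2 * x) (Polynomial.hermite n) := by
    rw [map_zsmul, zsmul_eq_mul]
    push_cast
    rfl
  simp only [physHermite, hermite_succ_succ, map_sub, map_mul, Polynomial.aeval_X, h]
  rw [pow_succ, pow_succ]
  set A := Polynomial.aeval (√2 * x) (Polynomial.hermite n)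
  set B := Polynomial.aeval (√2 * x) (Polynomial.hermite (n + 1))
  linear_combination √2 ^ n * (√2 * x * B - (n + 1) * A) * this

/-- The generating function of the Hermite polynomials, as a contour integral. -/
lemma circleIntegral_hermiteKernel {N : ℝ} (hN : 0 ≤ N) (a : ℝ) (n : ℕ) {r : ℝ} (hr : 0 < r) :
    ∮ z in C(0, r), hermiteKernel N a n z =
      2 * Real.pi * Complex.I * ((√N ^ n * physHermite n (√N * a) / (n ! : ℝ) : ℝ) : ℂ) := by
  induction n using Nat.twoStepInduction with
  | zero => simp [circleIntegral_hermiteKernel_zero N a hr, physHermite_zero]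
  | one =>
    rw [circleIntegral_hermiteKernel_one N a hr, physHermite_one]
    have h : N = √N * √N := (Real.mul_self_sqrt hN).symm
    have : √N ^ 1 * (2 * (√N * a)) / ((1 ! : ℕ) : ℝ) = 2 * N * a := by
      simp
      linear_combination (-2 * a) * h
    rw [this]
    push_cast
    ring
  | more n ih0 ih1 =>
    have h := circleIntegral_hermiteKernel_succ_succ N a n hr
    rw [ih0, ih1] at h
    have hn : (n : ℂ) + 2 ≠ 0 := by exact_mod_cast (by omega : n + 2 ≠ 0)
    refine mul_left_cancel₀ hn ?_
    rw [h]
    have hs : √N * √N = N := Real.mul_self_sqrt hN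
    have hf1 : ((n + 1)! : ℝ) = (n + 1) * (n ! : ℝ) := by
      rw [Nat.factorial_succ]; push_cast; ring
    have hf2 : ((n + 2)! : ℝ) = (n + 2) * ((n + 1) * (n ! : ℝ)) := by
      rw [Nat.factorial_succ, Nat.cast_mul, hf1]; push_cast; ring
    have hf0 : (n ! : ℝ) ≠ 0 := by exact_mod_cast Nat.factorial_ne_zero n
    have hreal : 2 * N * a * (√N ^ (n + 1) * physHermite (n + 1) (√N * a) / ((n + 1)! : ℝ)) -
        2 * N * (√N ^ n * physHermite n (√N * a) / (n ! : ℝ)) =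
        (n + 2) * (√N ^ (n + 2) * physHermite (n + 2) (√N * a) / ((n + 2)! : ℝ)) := by
      have hn1 : (n : ℝ) + 1 ≠ 0 := by positivity
      have hn2 : (n : ℝ) + 2 ≠ 0 := by positivity
      rw [hf2, hf1, physHermite_succ_succ]
      set A := physHermite n (√N * a)
      set B := physHermite (n + 1) (√N * a)
      set s := √N
      rw [← hs]
      field_simp
      ring
    have := congrArg Complex.ofReal hreal
    push_cast at this ⊢
    linear_combination (2 * Real.pi * Complex.I) * this

/-- Since `N = 2 n + 1`, the exponents `-1/2` and `-N/2` of `z` add up to the integer `-(n + 1)`: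
the product has no branch cut, although its factors do. -/
lemma cpow_mul_exp_phaseRoot {β : ℝ} (n : ℕ) {z : ℂ} (hz : z ≠ 0) :
    z ^ (-(1 / 2) : ℂ) * Complex.exp (-(bigN n : ℂ) * phaseRoot β z ^ 2) =
      Complex.exp ((bigN n * phaseReal β (tMinus β) : ℝ) : ℂ) *
        hermiteKernel (bigN n) (Real.cosh β) n z := by
  have h1 : (z ^ (n + 1))⁻¹ = Complex.exp (Complex.log z * (-((n : ℂ) + 1))) := by
    rw [mul_neg, Complex.exp_neg, mul_comm, show (n : ℂ) + 1 = ((n + 1 : ℕ) : ℂ) by push_cast; rfl,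
      Complex.exp_nat_mul, Complex.exp_log hz]
  rw [hermiteKernel, h1, Complex.cpow_def_of_ne_zero hz, phaseRoot_sq, phase_tMinus, phase,
    ← Complex.exp_add, ← Complex.exp_add, ← Complex.exp_add]
  congr 1
  simp only [bigN]
  push_cast
  ring

lemma starConvex_slitPlane_neg :
    StarConvex ℝ (-1 : ℂ) ((fun z : ℂ => -z) ⁻¹' Complex.slitPlane) := by
  have h := Complex.starConvex_one_slitPlane.neg
  rwa [← Set.neg_preimage] at h

lemma differentiableOn_hermiteKernel (N a : ℝ) (n : ℕ) {s : Set ℂ} (hs : ∀ z ∈ s, z ≠ 0) :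
    DifferentiableOn ℂ (hermiteKernel N a n) s := fun z hz =>
  (hermiteKernel_differentiableAt N a n (hs z hz)).differentiableWithinAt

/-- As the keyhole closes, its integral tends to minus the full circle. -/
lemma tendsto_keyhole_hermiteKernel {β L : ℝ} (hL : 0 < L) (N a : ℝ) (n : ℕ) :
    Tendsto (fun δ => keyhole δ L (hermiteKernel N a n)) (𝓝[>] 0)
      (𝓝 (-∮ z in C(0, L), hermiteKernel N a n z)) := by
  set E := hermiteKernel N a n with hE
  set T : Set ℂ := (fun z : ℂ => -z) ⁻¹' Complex.slitPlane with hT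
  have hTo : IsOpen T := Complex.isOpen_slitPlane.preimage continuous_neg
  have hT0 : ∀ z ∈ T, z ≠ 0 := fun z hz h => by
    have := Complex.slitPlane_ne_zero hz
    exact this (by simp [h])
  obtain ⟨G, hG⟩ := exists_primitive_of_starConvex Complex.isOpen_slitPlane
    Complex.starConvex_one_slitPlane
    (differentiableOn_hermiteKernel N a n fun z hz => Complex.slitPlane_ne_zero hz)
  obtain ⟨K, hK⟩ := exists_primitive_of_starConvex hTo starConvex_slitPlane_neg
    (differentiableOn_hermiteKernel N a n hT0)
  have hup : IsOpen {z : ℂ | 0 < z.im} := isOpen_lt continuous_const Complex.continuous_im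
  have hlo : IsOpen {z : ℂ | z.im < 0} := isOpen_lt Complex.continuous_im continuous_const
  have hslit : ∀ z : ℂ, z.im ≠ 0 → z ∈ Complex.slitPlane := fun z hz => Or.inr hz
  have hslit' : ∀ z : ℂ, z.im ≠ 0 → z ∈ T := fun z hz => Or.inr (by simpa using hz)
  have hcU : ∀ u v : ℂ, 0 < u.im → 0 < v.im → G u - K u = G v - K v := fun u v hu hv =>
    sub_const_of_hasDerivAt hup (convex_halfSpace_im_gt 0)
      (fun z hz => hK z (hslit' z (ne_of_gt hz))) (fun z hz => hG z (hslit z (ne_of_gt hz))) hu hv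
  have hcL : ∀ u v : ℂ, u.im < 0 → v.im < 0 → G u - K u = G v - K v := fun u v hu hv =>
    sub_const_of_hasDerivAt hlo (convex_halfSpace_im_lt 0)
      (fun z hz => hK z (hslit' z (ne_of_lt hz))) (fun z hz => hG z (hslit z (ne_of_lt hz))) hu hv
  have hmem : ∀ z ∈ Metric.sphere (0 : ℂ) L, z.re = 0 → z.im ≠ 0 := fun z hz hre him =>
    ne_zero_of_mem_sphere hL hz (Complex.ext hre him)
  have hcirc := circleIntegral_eq_of_primitives (F := E) (G₂ := G) (G₁ := K) (c := 0) hL.le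
    (continuousOn_hermiteKernel_sphere N a n hL)
    (fun z hz hre => hG z (by
      rcases (Complex.zero_re ▸ hre : (0 : ℝ) ≤ z.re).eq_or_lt with h | h
      · exact hslit z (hmem z hz h.symm)
      · exact Or.inl h))
    (fun z hz hre => hK z (by
      rcases (Complex.zero_re ▸ hre : z.re ≤ (0 : ℝ)).eq_or_lt with h | h
      · exact hslit' z (hmem z hz h)
      · exact Or.inl (by simpa using h)))
  -- `K` is a primitive across the negative axis, so its values at `-L ± i δ` coalesce. The keyhole
  -- is evaluated with `G` instead; `G - K` is constant on each half plane, and the difference of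
  -- these constants is the circle integral.
  have hlim : Tendsto (fun δ : ℝ => K (-L - δ * Complex.I) - K (-L + δ * Complex.I) -
      ∮ z in C(0, L), E z) (𝓝[>] 0) (𝓝 (-∮ z in C(0, L), E z)) := by
    have hKc : ContinuousAt K (-L : ℂ) := (hK _ (Or.inl (by simpa using hL))).continuousAt
    have h1 : Tendsto (fun δ : ℝ => (-L - δ * Complex.I : ℂ)) (𝓝 0) (𝓝 (-L)) := by
      have : Continuous fun δ : ℝ => (-L - δ * Complex.I : ℂ) := by fun_prop
      simpa using this.tendsto 0
    have h2 : Tendsto (fun δ : ℝ => (-L + δ * Complex.I : ℂ)) (𝓝 0) (𝓝 (-L)) := by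
      have : Continuous fun δ : ℝ => (-L + δ * Complex.I : ℂ) := by fun_prop
      simpa using this.tendsto 0
    have h3 := ((hKc.tendsto.comp h1).sub (hKc.tendsto.comp h2)).sub_const (∮ z in C(0, L), E z)
    rw [sub_self, zero_sub] at h3
    exact h3.mono_left nhdsWithin_le_nhds
  refine hlim.congr' ?_
  have hc := tMinus_pos β
  filter_upwards [Ioo_mem_nhdsGT hc] with δ hδ
  have hleft : leftDomain β ⊆ Complex.slitPlane := Set.inter_subset_left
  rw [keyhole_eq_of_primitive (β := β) (F := E) (G := G)
    ((differentiableOn_hermiteKernel N a n fun z hz =>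
      Complex.slitPlane_ne_zero (hleft hz)).continuousOn)
    (fun z hz => hG z (hleft hz)) hδ.1 hδ.2, hcirc]
  have e1 := hcU (0 + L * Complex.I) (-L + δ * Complex.I) (by simpa using hL) (by simpa using hδ.1)
  have e2 := hcL (0 - L * Complex.I) (-L - δ * Complex.I) (by simpa using hL) (by simpa using hδ.1)
  linear_combination -e1 + e2

/-! ### The remainder along the contours -/

/-- The integrand of the remainder after the terms `j ≤ P`. -/
def remainder (N β : ℝ) (P : ℕ) (z : ℂ) : ℂ :=
  gaussIntegrand N β z - ∑ j ∈ Finset.range (P + 1),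
    (gaussMoment N j : ℂ) * coeffIntegrand (phaseRoot β) j z

/-- The remainder on the left part of the contour. -/
def leftRemainder (N β : ℝ) (P : ℕ) (z : ℂ) : ℂ :=
  remainder N β P z - 2 * Real.pi * Complex.I *
    (z ^ (-(1 / 2) : ℂ) * Complex.exp (-(N : ℂ) * phaseRoot β z ^ 2))

lemma remainder_eq (N β : ℝ) (P : ℕ) (z : ℂ) : remainder N β P z = z ^ (-(1 / 2) : ℂ) *
    (gaussTransform N (phaseRoot β z) - ∑ j ∈ Finset.range (P + 1),
      (gaussMoment N j : ℂ) / phaseRoot β z ^ (2 * j + 1)) := by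
  simp only [remainder, gaussIntegrand, coeffIntegrand, mul_sub, Finset.mul_sum]
  congr 1
  exact Finset.sum_congr rfl fun j _ => by ring

section Bounds

variable {N β m : ℝ} {z : ℂ}

lemma norm_remainder_le (hN : 0 < N) (P : ℕ) (hz : z ≠ 0) (hW : (phaseRoot β z).im < 0)
    (hm : 0 < m) (hmw : ∀ v : ℝ, m ≤ ‖phaseRoot β z ^ 2 - (v : ℂ) ^ 2‖) :
    ‖remainder N β P z‖ ≤ ‖z‖ ^ (-(1 / 2) : ℝ) *
      (gaussMoment N (P + 1) / (‖phaseRoot β z‖ ^ (2 * P + 1) * m)) := by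
  rw [remainder_eq, norm_mul, norm_cpow_neg_half hz]
  exact mul_le_mul_of_nonneg_left (norm_gaussTransform_sub_le hN hW P hm hmw) (by positivity)

/-- By the reflection formula, removing the exponential leaves `-J(-w)`, where `-w` lies in the
lower half plane. The inverse powers are odd and change sign as well, so the expansion at `-w`
applies. -/
lemma norm_leftRemainder_le (hN : 0 < N) (P : ℕ) (hz : z ≠ 0) (hW : 0 < (phaseRoot β z).im)
    (hm : 0 < m) (hmw : ∀ v : ℝ, m ≤ ‖phaseRoot β z ^ 2 - (v : ℂ) ^ 2‖) :
    ‖leftRemainder N β P z‖ ≤ ‖z‖ ^ (-(1 / 2) : ℝ) *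
      (gaussMoment N (P + 1) / (‖phaseRoot β z‖ ^ (2 * P + 1) * m)) := by
  have h := norm_gaussTransform_sub_le hN (w := -phaseRoot β z) (by simpa using hW) P hm
    (by simpa only [neg_sq] using hmw)
  have hadd := gaussTransform_add_neg hN (phaseRoot β z)
  have e : leftRemainder N β P z = -(z ^ (-(1 / 2) : ℂ) * (gaussTransform N (-phaseRoot β z) -
      ∑ j ∈ Finset.range (P + 1), (gaussMoment N j : ℂ) / (-phaseRoot β z) ^ (2 * j + 1))) := by
    have hs : ∑ j ∈ Finset.range (P + 1), (gaussMoment N j : ℂ) / (-phaseRoot β z) ^ (2 * j + 1) =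
        -∑ j ∈ Finset.range (P + 1), (gaussMoment N j : ℂ) / phaseRoot β z ^ (2 * j + 1) := by
      rw [← Finset.sum_neg_distrib]
      refine Finset.sum_congr rfl fun j _ => ?_
      rw [Odd.neg_pow ⟨j, rfl⟩, div_neg]
    rw [leftRemainder, remainder_eq, hs]
    linear_combination z ^ (-(1 / 2) : ℂ) * hadd
  rw [e, norm_neg, norm_mul, norm_cpow_neg_half hz]
  rw [norm_neg] at h
  exact mul_le_mul_of_nonneg_left h (by positivity)

lemma gaussMoment_pos (hN : 0 < N) (j : ℕ) : 0 < gaussMoment N j :=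
  mul_pos (Real.Gamma_pos_of_pos (by positivity)) (by positivity)

end Bounds

lemma pow_two_mul_add_one_eq_rpow {r : ℝ} (hr : 0 ≤ r) (P : ℕ) :
    r ^ (2 * P + 1) = (r ^ 2) ^ ((P : ℝ) + 1 / 2) := by
  rw [← Real.rpow_natCast r 2, ← Real.rpow_mul hr, ← Real.rpow_natCast]
  congr 1
  push_cast
  ring

/-! #### The steepest descent path -/

lemma half_cosh_le_xPlus {β θ : ℝ} (hβ : 0 < β) (hθ : |θ| < Real.pi / 2) : Real.cosh β / 2 ≤ xPlus β θ := by
  refine le_trans ?_ (tPlus_le_xPlus hθ)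
  rw [← tMinus_add_tPlus]
  linarith [tMinus_lt_tPlus hβ]

/-- On `Γ₊` the number `w²` is negative, so its distance to every `v²` is at least `phaseDrop`. One
factor `phaseDrop` is bounded below by `saddleGap / (5 cos² θ)`, which cancels the growth of the
path derivative; the uniform bound suffices for the others. -/
lemma norm_pathIntegrand_remainder_le {N β : ℝ} (hN : 0 < N) (hβ : 0 < β) (P : ℕ) {θ : ℝ}
    (hθ : |θ| < Real.pi / 2) (hθ0 : θ ≠ 0) :
    ‖pathIntegrand (remainder N β P) (gammaPlus β) θ‖ ≤
      gaussMoment N (P + 1) * (5 * √2 / (√(Real.cosh β) * saddleGap β ^ ((P : ℝ) + 3 / 2))) *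
        (Real.pi / (8 * Real.sinh β) * Real.cos θ + Real.cosh β * ((1 + Real.cos θ) / 2)) := by
  have hD := saddleGap_pos hβ
  have hsh : 0 < Real.sinh β := Real.sinh_pos_iff.2 hβ
  have hch : 0 < Real.cosh β := Real.cosh_pos β
  have hπ := Real.pi_pos
  have hcos := cos_pos_of_abs_lt hθ
  have hc1 := Real.cos_le_one θ
  have hx := half_cosh_le_xPlus hβ hθ
  have hx0 : 0 < xPlus β θ := by linarith
  have hγ0 : gammaPlus β θ ≠ 0 := norm_pos_iff.1 (by rw [norm_gammaPlus hβ hθ]; positivity)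
  have hM := saddleGap_div_le_phaseDrop hβ hθ
  have hM2 := saddleGap_le_phaseDrop hβ hθ
  have hMp := phaseDrop_pos hβ hθ
  have hW := norm_phaseRoot_gammaPlus_sq hβ hθ
  have hmw : ∀ v : ℝ, phaseDrop β θ ≤ ‖phaseRoot β (gammaPlus β θ) ^ 2 - (v : ℂ) ^ 2‖ := fun v => by
    rw [phaseRoot_gammaPlus_sq hβ hθ, ← Complex.ofReal_pow, ← Complex.ofReal_sub, Complex.norm_real,
      Real.norm_eq_abs, abs_of_nonpos (by nlinarith [sq_nonneg v])]
    nlinarith [sq_nonneg v]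
  have hre : tMinus β ≤ (gammaPlus β θ).re := by
    rw [re_gammaPlus hβ hθ]
    linarith [tPlus_le_xPlus (β := β) hθ, tMinus_lt_tPlus hβ]
  have hIm := im_phaseRoot_neg hβ (gammaPlus_mem_wDomain hβ hθ) hre (gammaPlus_ne_tMinus hβ hθ)
  have h1 := norm_remainder_le hN P hγ0 hIm hMp hmw
  have hg := gaussMoment_pos hN (P + 1)
  rw [pathIntegrand, (hasDerivAt_gammaPlus hβ hθ hθ0).deriv, norm_mul]
  have hd := norm_gammaPlusDeriv_le hβ hθ hθ0
  have hden : saddleGap β ^ ((P : ℝ) + 3 / 2) / (5 * Real.cos θ ^ 2) ≤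
      ‖phaseRoot β (gammaPlus β θ)‖ ^ (2 * P + 1) * phaseDrop β θ := by
    rw [pow_two_mul_add_one_eq_rpow (norm_nonneg _), hW]
    calc _ = saddleGap β ^ ((P : ℝ) + 1 / 2) * (saddleGap β / (5 * Real.cos θ ^ 2)) := by
          rw [show (P : ℝ) + 3 / 2 = P + 1 / 2 + 1 by ring, Real.rpow_add_one hD.ne']
          ring
      _ ≤ _ := by gcongr
  have hnorm : ‖gammaPlus β θ‖ ^ (-(1 / 2) : ℝ) ≤ √2 / √(Real.cosh β) * √(Real.cos θ) := by
    rw [norm_gammaPlus hβ hθ, Real.rpow_neg (by positivity), ← Real.sqrt_eq_rpow,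
      Real.sqrt_div hx0.le, inv_div, ← Real.sqrt_div zero_le_two, div_eq_mul_one_div, mul_comm]
    gcongr
    rw [one_div, ← Real.sqrt_inv]
    refine Real.sqrt_le_sqrt ?_
    rw [inv_le_comm₀ hx0 (by positivity), inv_div]
    exact hx
  have hs1 : √(Real.cos θ) ≤ 1 := Real.sqrt_le_one.2 hc1
  -- The arithmetic-geometric mean gives a majorant with an elementary primitive.
  have hs2 : √(Real.cos θ) ≤ (1 + Real.cos θ) / 2 := by
    nlinarith [Real.sq_sqrt hcos.le, sq_nonneg (√(Real.cos θ) - 1)]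
  calc _ ≤ (√2 / √(Real.cosh β) * √(Real.cos θ) * (gaussMoment N (P + 1) /
        (saddleGap β ^ ((P : ℝ) + 3 / 2) / (5 * Real.cos θ ^ 2)))) *
        (Real.pi / (8 * Real.sinh β * Real.cos θ) + Real.cosh β / Real.cos θ ^ 2) := by
        refine mul_le_mul (h1.trans ?_) hd (norm_nonneg _) (by positivity)
        gcongr
    _ = gaussMoment N (P + 1) * (5 * √2 / (√(Real.cosh β) * saddleGap β ^ ((P : ℝ) + 3 / 2))) *
        (Real.pi / (8 * Real.sinh β) * (√(Real.cos θ) * Real.cos θ) +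
          Real.cosh β * √(Real.cos θ)) := by
        field_simp
    _ ≤ _ := by
        gcongr
        exact mul_le_of_le_one_left hcos.le hs1

/-- The contribution of the steepest descent path to the error constant. -/
def descentBound (P : ℕ) (β : ℝ) : ℝ :=
  2 / Real.tanh β *
    (4 * Real.pi * √(Real.cosh β) / (Real.sinh (2 * β) / 2 - β) ^ ((P : ℝ) + 3 / 2))

lemma norm_integral_remainder_le {N β b : ℝ} (hN : 0 < N) (hβ : 0 < β) (P : ℕ) (hb0 : 0 < b)
    (hb : b < Real.pi / 2) :
    ‖∫ θ in (-b)..b, pathIntegrand (remainder N β P) (gammaPlus β) θ‖ ≤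
      gaussMoment N (P + 1) * descentBound P β := by
  have hD := saddleGap_pos hβ
  have hsh : 0 < Real.sinh β := Real.sinh_pos_iff.2 hβ
  have hch : 0 < Real.cosh β := Real.cosh_pos β
  have hπ := Real.pi_pos
  have hg := gaussMoment_pos hN (P + 1)
  set K : ℝ := 5 * √2 / (√(Real.cosh β) * saddleGap β ^ ((P : ℝ) + 3 / 2)) with hK
  have hK0 : 0 < K := by positivity
  have hle : ∀ᵐ θ : ℝ, θ ∈ Set.Ioc (-b) b →
      ‖pathIntegrand (remainder N β P) (gammaPlus β) θ‖ ≤ gaussMoment N (P + 1) * K *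
        (Real.pi / (8 * Real.sinh β) * Real.cos θ + Real.cosh β * ((1 + Real.cos θ) / 2)) := by
    filter_upwards [Measure.ae_ne volume (0 : ℝ)] with θ hθ0 hθ
    exact norm_pathIntegrand_remainder_le hN hβ P
      (abs_lt.2 ⟨by linarith [hθ.1], by linarith [hθ.2]⟩) hθ0
  refine (intervalIntegral.norm_integral_le_of_norm_le (by linarith) hle
    (Continuous.intervalIntegrable (by fun_prop) _ _)).trans ?_
  have hval : ∫ θ in (-b)..b, gaussMoment N (P + 1) * K *
      (Real.pi / (8 * Real.sinh β) * Real.cos θ + Real.cosh β * ((1 + Real.cos θ) / 2)) =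
      gaussMoment N (P + 1) * K * (Real.pi / (4 * Real.sinh β) * Real.sin b +
        Real.cosh β * (b + Real.sin b)) := by
    rw [intervalIntegral.integral_eq_sub_of_hasDerivAt (f := fun θ => gaussMoment N (P + 1) * K *
      (Real.pi / (8 * Real.sinh β) * Real.sin θ + Real.cosh β * ((θ + Real.sin θ) / 2)))
      (fun θ _ => ?_) (Continuous.intervalIntegrable (by fun_prop) _ _)]
    · rw [Real.sin_neg]
      field_simp
      ring
    · exact (((Real.hasDerivAt_sin θ).const_mul _).fun_add ((((hasDerivAt_id θ).fun_add
        (Real.hasDerivAt_sin θ)).div_const 2).const_mul _)).const_mul _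
  rw [hval, mul_assoc]
  refine mul_le_mul_of_nonneg_left ?_ hg.le
  have hsin := Real.sin_le_one b
  have h1 : Real.pi / (4 * Real.sinh β) * Real.sin b + Real.cosh β * (b + Real.sin b) ≤
      Real.cosh β ^ 2 / Real.sinh β * (3 * Real.pi / 4 + 1) := by
    have hc1 := Real.one_le_cosh β
    have hcs : Real.sinh β ≤ Real.cosh β := (Real.sinh_lt_cosh β).le
    have k1 : Real.pi / (4 * Real.sinh β) * Real.sin b ≤
        Real.cosh β ^ 2 / Real.sinh β * (Real.pi / 4) := by
      rw [div_mul_eq_mul_div, div_mul_eq_mul_div, div_le_div_iff₀ (by positivity) hsh]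
      have : Real.sin b ≤ Real.cosh β ^ 2 := hsin.trans (one_le_pow₀ hc1)
      nlinarith [mul_pos hπ hsh]
    have k2 : Real.cosh β * (b + Real.sin b) ≤
        Real.cosh β ^ 2 / Real.sinh β * (Real.pi / 2 + 1) := by
      have : Real.cosh β ≤ Real.cosh β ^ 2 / Real.sinh β := by
        rw [le_div_iff₀ hsh]
        nlinarith
      have h2 : b + Real.sin b ≤ Real.pi / 2 + 1 := by linarith
      calc _ ≤ Real.cosh β * (Real.pi / 2 + 1) := by gcongr
        _ ≤ _ := by gcongr
    linarith
  have h2 : K * (Real.cosh β ^ 2 / Real.sinh β * (3 * Real.pi / 4 + 1)) =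
      (5 * √2 * (3 * Real.pi / 4 + 1)) * (Real.cosh β / Real.sinh β *
        (√(Real.cosh β) / saddleGap β ^ ((P : ℝ) + 3 / 2))) := by
    rw [hK]
    have := Real.mul_self_sqrt hch.le
    field_simp
    linear_combination -this
  have h3 : descentBound P β = (8 * Real.pi) * (Real.cosh β / Real.sinh β *
        (√(Real.cosh β) / saddleGap β ^ ((P : ℝ) + 3 / 2))) := by
    rw [descentBound, Real.tanh_eq_sinh_div_cosh, ← saddleGap]
    field_simp
    ring
  refine (mul_le_mul_of_nonneg_left h1 hK0.le).trans ?_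
  rw [h2, h3]
  refine mul_le_mul_of_nonneg_right ?_ (by positivity)
  -- The constants from the path estimate fit under the stated one because `5 √2 (3π/4 + 1) ≤ 8π`.
  have hs2 : √2 ≤ 1.4143 := by
    rw [Real.sqrt_le_left (by norm_num)]
    norm_num
  nlinarith [Real.pi_gt_d2]

/-! #### The keyhole -/

lemma phaseReal_tMinus_neg {β : ℝ} (hβ : 0 < β) : phaseReal β (tMinus β) < 0 := by
  rw [phaseReal_tMinus]
  linarith [Real.exp_pos (-2 * β), Real.log_pos one_lt_two]

/-- Subtracting `v² ≥ 0` moves the real part further left and leaves the imaginary part alone. This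
lemma and the next bound the distance from `w²` to the positive axis near and away from the origin.
-/
lemma le_norm_sub_of_re_le {A : ℂ} {m : ℝ} (h : A.re ≤ -m) (v : ℝ) : m ≤ ‖A - (v : ℂ) ^ 2‖ := by
  have := Complex.abs_re_le_norm (A - (v : ℂ) ^ 2)
  rw [Complex.sub_re, ← Complex.ofReal_pow, Complex.ofReal_re] at this
  have h2 := (abs_le.1 this).1
  push_cast at h2 ⊢
  nlinarith [sq_nonneg v]

lemma le_norm_sub_of_le_abs_im {A : ℂ} {m : ℝ} (h : m ≤ |A.im|) (v : ℝ) :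
    m ≤ ‖A - (v : ℂ) ^ 2‖ := by
  have := Complex.abs_im_le_norm (A - (v : ℂ) ^ 2)
  rw [Complex.sub_im, ← Complex.ofReal_pow, Complex.ofReal_im, sub_zero] at this
  push_cast at this ⊢
  linarith

/-- Near the origin the real part of `w ^ 2` is very negative. -/
lemma exists_re_phaseRoot_sq_le (β : ℝ) : ∃ η, 0 < η ∧ η ≤ 1 ∧ ∀ z : ℂ, z ≠ 0 → ‖z‖ ≤ η →
    (phaseRoot β z ^ 2).re ≤ -(Real.pi / 2) := by
  have hch := Real.cosh_pos β
  have hπ := Real.pi_pos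
  set Q := 1 + 2 * Real.cosh β + |phaseReal β (tMinus β)| + Real.pi / 2 with hQ
  have hQ0 : 0 < Q := by positivity
  refine ⟨Real.exp (-2 * Q), Real.exp_pos _, Real.exp_le_one_iff.2 (by linarith),
    fun z hz hle => ?_⟩
  have hz0 : 0 < ‖z‖ := norm_pos_iff.2 hz
  have h1 : ‖z‖ ≤ 1 := hle.trans (Real.exp_le_one_iff.2 (by linarith))
  have hlog : Real.log ‖z‖ ≤ -2 * Q := (Real.log_le_iff_le_exp hz0).2 hle
  have hre := (Complex.abs_re_le_norm z).trans h1
  have hre2 : z.re ^ 2 ≤ 1 := by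
    rw [← sq_abs]
    exact pow_le_one₀ (abs_nonneg _) hre
  rw [re_phaseRoot_sq]
  have h2 := neg_abs_le (phaseReal β (tMinus β))
  nlinarith [(abs_le.1 hre).1, sq_nonneg z.im]

/-- Jordan's inequality for `π - |arg z|`, whose sine is `|Im z| / |z|`. -/
lemma pi_sub_abs_arg_le {z : ℂ} (hz : z.re < 0) :
    Real.pi - |z.arg| ≤ Real.pi / 2 * (|z.im| / |z.re|) := by
  have hre : 0 < |z.re| := abs_pos.2 hz.ne
  have hπ := Real.pi_pos
  have h1 := Complex.abs_arg_le_pi z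
  have h2 : Real.pi / 2 < |z.arg| := by
    by_contra! h
    exact absurd (Complex.abs_arg_le_pi_div_two_iff.1 h) (not_le.2 hz)
  have h3 := Real.mul_le_sin (x := Real.pi - |z.arg|) (by linarith) (by linarith)
  rw [Real.sin_pi_sub, ← Real.abs_sin_eq_sin_abs_of_abs_le_pi h1, Complex.sin_arg, abs_div,
    abs_norm] at h3
  have h4 : |z.im| / ‖z‖ ≤ |z.im| / |z.re| :=
    div_le_div_of_nonneg_left (abs_nonneg _) hre (Complex.abs_re_le_norm z)
  have h5 := h3.trans h4
  calc Real.pi - |z.arg| = Real.pi / 2 * (2 / Real.pi * (Real.pi - |z.arg|)) := by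
        field_simp
    _ ≤ _ := by gcongr

lemma im_mul_arg_eq (z : ℂ) : z.im * z.arg = |z.im| * |z.arg| := by
  rw [← abs_mul, abs_of_nonneg]
  rcases le_total 0 z.im with h | h
  · exact mul_nonneg h (Complex.arg_nonneg_iff.2 h)
  · rcases h.eq_or_lt with h | h
    · rw [h, zero_mul]
    · exact (mul_pos_of_neg_of_neg h (Complex.arg_neg_iff.2 h)).le

lemma half_mem_of_halfLine (δ l : ℝ) : (halfLine δ l).re = l ∧ (halfLine δ l).im = δ := by
  simp [halfLine]

/-- Lower bounds for `w` on the half lines of a narrow keyhole. -/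
lemma exists_halfLine_bounds {β : ℝ} (hβ : 0 < β) {μ L : ℝ} (hμ : μ < Real.pi / 2) (hL : 0 < L) :
    ∃ δ₀, 0 < δ₀ ∧ ∀ ε : ℝ, ε ≠ 0 → |ε| < δ₀ → ∀ l : ℝ, -L ≤ l → l < 0 →
      0 < (phaseRoot β (halfLine ε l)).im ∧
      (∀ v : ℝ, μ ≤ ‖phaseRoot β (halfLine ε l) ^ 2 - (v : ℂ) ^ 2‖) ∧
      (l ≤ -1 → 2 * Real.cosh β * -l ≤ ‖phaseRoot β (halfLine ε l)‖ ^ 2) := by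
  have hch := Real.cosh_pos β
  have hπ := Real.pi_pos
  have hfc := phaseReal_tMinus_neg hβ
  obtain ⟨η, hη, hη1, hsmall⟩ := exists_re_phaseRoot_sq_le β
  set S := Real.pi / η + 4 * (Real.cosh β + L) with hS
  have hS0 : 0 < S := by positivity
  -- The first bound covers the part near the origin, the second makes `Im z * Im w²` positive, and
  -- the third keeps the loss in `|Im w²|` compared with `π/2` below `π/2 - μ`.
  set δ₀ := min (min (η / 2) (Real.pi / (8 * (Real.cosh β + L)))) ((Real.pi / 2 - μ) / S) with hδ₀
  refine ⟨δ₀, lt_min (lt_min (by positivity) (by positivity)) (div_pos (by linarith) hS0),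
    fun ε hε hεδ l hlL hl => ?_⟩
  have hε0 : 0 < |ε| := abs_pos.2 hε
  have k1 : |ε| < η / 2 := hεδ.trans_le ((min_le_left _ _).trans (min_le_left _ _))
  have k2 : |ε| < Real.pi / (8 * (Real.cosh β + L)) :=
    hεδ.trans_le ((min_le_left _ _).trans (min_le_right _ _))
  have k3 : |ε| < (Real.pi / 2 - μ) / S := hεδ.trans_le (min_le_right _ _)
  rw [lt_div_iff₀ (by positivity)] at k2 k3
  obtain ⟨hre, him⟩ := half_mem_of_halfLine ε l
  set z := halfLine ε l with hz
  have hz0 : z ≠ 0 := fun h => hε (by rw [← him, h, Complex.zero_im])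
  have harg2 : Real.pi / 2 < |z.arg| := by
    by_contra! h
    exact absurd (Complex.abs_arg_le_pi_div_two_iff.1 h) (not_le.2 (by rw [hre]; exact hl))
  have hIm := im_phaseRoot_sq β z
  rw [hre, him] at hIm
  refine ⟨?_, fun v => ?_, fun hl1 => ?_⟩
  · refine im_phaseRoot_pos hβ (by rw [him]; exact hε) (by rw [hre]; linarith [tMinus_pos β]) ?_
    have h1 := im_mul_arg_eq z
    rw [him] at h1
    rw [him, hIm]
    have h2 : ε * (2 * ε * (l - Real.cosh β) + z.arg / 2) =
        |ε| * (|z.arg| / 2 - 2 * |ε| * (Real.cosh β - l)) := by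
      have : ε * ε = |ε| * |ε| := (abs_mul_abs_self ε).symm
      linear_combination (2 * (l - Real.cosh β)) * this + (1 / 2 : ℝ) * h1
    rw [h2]
    refine mul_pos hε0 ?_
    have : |ε| * (Real.cosh β - l) ≤ |ε| * (Real.cosh β + L) := by gcongr; linarith
    nlinarith
  -- Near the origin the logarithm makes `Re w²` very negative. Further out `|arg z| / 2` is close
  -- to `π/2` and carries the imaginary part.
  · rcases le_or_gt (-(η / 2)) l with hcase | hcase
    · have hn : ‖z‖ ≤ η := by
        refine (Complex.norm_le_abs_re_add_abs_im z).trans ?_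
        rw [hre, him, abs_of_neg hl]
        linarith
      exact hμ.le.trans (le_norm_sub_of_re_le (hsmall z hz0 hn) v)
    · refine le_norm_sub_of_le_abs_im ?_ v
      rw [hIm]
      have h1 := pi_sub_abs_arg_le (z := z) (by rw [hre]; exact hl)
      rw [hre, him] at h1
      have h2 : |ε| / |l| ≤ |ε| / (η / 2) := by
        rw [abs_of_neg hl]
        gcongr
        linarith
      have h3 : Real.pi - |z.arg| ≤ Real.pi / η * |ε| := by
        refine h1.trans ((mul_le_mul_of_nonneg_left h2 (by positivity)).trans_eq ?_)
        field_simp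
      have h4 : |2 * ε * (l - Real.cosh β)| ≤ 2 * |ε| * (Real.cosh β + L) := by
        rw [abs_mul, abs_mul, abs_two]
        gcongr
        rw [abs_le]
        constructor <;> linarith
      have h5 : |z.arg / 2| = |z.arg| / 2 := by rw [abs_div, abs_two]
      have h6 : |z.arg / 2| - |2 * ε * (l - Real.cosh β)| ≤
          |2 * ε * (l - Real.cosh β) + z.arg / 2| := by
        have := abs_sub_abs_le_abs_sub (z.arg / 2) (-(2 * ε * (l - Real.cosh β)))
        rwa [abs_neg, sub_neg_eq_add, add_comm (z.arg / 2)] at this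
      have h7 : |ε| * S = Real.pi / η * |ε| + 4 * |ε| * (Real.cosh β + L) := by rw [hS]; ring
      linarith
  · have h1 := (Complex.re_le_norm (phaseRoot β z ^ 2))
    rw [norm_pow, re_phaseRoot_sq, hre, him] at h1
    have hn : 1 ≤ ‖z‖ := by
      have := Complex.abs_re_le_norm z
      rw [hre, abs_of_neg hl] at this
      linarith
    have h2 := Real.log_nonneg hn
    have h3 : ε ^ 2 ≤ 1 := by
      rw [← sq_abs]
      exact pow_le_one₀ (abs_nonneg _) (by linarith)
    nlinarith

/-- Lower bounds for `w` on the arc of a narrow keyhole. -/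
lemma exists_arc_bounds {β : ℝ} (hβ : 0 < β) : ∃ δ₀, 0 < δ₀ ∧ ∀ δ, 0 < δ → δ < δ₀ → ∀ θ : ℝ,
    |θ| ≤ Real.pi / 2 → θ ≠ 0 → 0 < (phaseRoot β (arc δ θ)).im ∧
      ∀ v : ℝ, Real.pi / 2 ≤ ‖phaseRoot β (arc δ θ) ^ 2 - (v : ℂ) ^ 2‖ := by
  have hch := Real.cosh_pos β
  have hπ := Real.pi_pos
  obtain ⟨η, hη, hη1, hsmall⟩ := exists_re_phaseRoot_sq_le β
  refine ⟨min (min η (tMinus β)) (1 / (4 * Real.cosh β)), lt_min (lt_min hη (tMinus_pos β))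
    (by positivity), fun δ hδ hlt θ hθ hθ0 => ?_⟩
  have k1 : δ < η := hlt.trans_le ((min_le_left _ _).trans (min_le_left _ _))
  have k2 : δ < tMinus β := hlt.trans_le ((min_le_left _ _).trans (min_le_right _ _))
  have k3 : δ < 1 / (4 * Real.cosh β) := hlt.trans_le (min_le_right _ _)
  rw [lt_div_iff₀ (by positivity)] at k3
  have hexp : Complex.exp ((θ : ℂ) * Complex.I) = Real.cos θ + Real.sin θ * Complex.I := by
    rw [Complex.exp_mul_I]; push_cast; rfl
  have hre : (arc δ θ).re = δ * Real.cos θ := by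
    rw [arc, Complex.re_ofReal_mul, Complex.exp_ofReal_mul_I_re]
  have him : (arc δ θ).im = δ * Real.sin θ := by
    rw [arc, Complex.im_ofReal_mul, Complex.exp_ofReal_mul_I_im]
  have hnorm : ‖arc δ θ‖ = δ := by
    rw [arc, norm_mul, Complex.norm_exp_ofReal_mul_I, Complex.norm_real,
      Real.norm_of_nonneg hδ.le, mul_one]
  have harg : (arc δ θ).arg = θ := by
    rw [arc, hexp]
    have := Complex.arg_mul_cos_add_sin_mul_I hδ (θ := θ)
      ⟨by linarith [(abs_le.1 hθ).1], by linarith [(abs_le.1 hθ).2]⟩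
    push_cast
    exact this
  set z := arc δ θ with hz
  have hz0 : z ≠ 0 := norm_pos_iff.1 (by rw [hnorm]; exact hδ)
  have hθp : 0 < |θ| := abs_pos.2 hθ0
  have hsin0 : 0 < |Real.sin θ| := by
    rw [Real.abs_sin_eq_sin_abs_of_abs_le_pi (by linarith)]
    exact Real.sin_pos_of_pos_of_lt_pi hθp (by linarith)
  have himne : z.im ≠ 0 := by
    rw [him]
    exact mul_ne_zero hδ.ne' (abs_pos.1 hsin0)
  refine ⟨im_phaseRoot_pos hβ himne ?_ ?_, fun v =>
    le_norm_sub_of_re_le (hsmall z hz0 (by rw [hnorm]; exact k1.le)) v⟩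
  · rw [hre]
    nlinarith [Real.cos_le_one θ]
  · have h1 := im_mul_arg_eq z
    have hc0 : 0 ≤ Real.cos θ := Real.cos_nonneg_of_mem_Icc ⟨(abs_le.1 hθ).1, (abs_le.1 hθ).2⟩
    rw [im_phaseRoot_sq, hre]
    have h2 : z.im * (2 * z.im * (δ * Real.cos θ - Real.cosh β) + z.arg / 2) =
        |z.im| * (|z.arg| / 2 - 2 * |z.im| * (Real.cosh β - δ * Real.cos θ)) := by
      have : z.im * z.im = |z.im| * |z.im| := (abs_mul_abs_self _).symm
      linear_combination (2 * (δ * Real.cos θ - Real.cosh β)) * this + (1 / 2 : ℝ) * h1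
    rw [h2, harg]
    refine mul_pos (abs_pos.2 himne) ?_
    have h3 : |z.im| ≤ δ * |θ| := by
      rw [him, abs_mul, abs_of_pos hδ]
      exact mul_le_mul_of_nonneg_left Real.abs_sin_le_abs hδ.le
    have h4 : |z.im| * (Real.cosh β - δ * Real.cos θ) ≤ |z.im| * Real.cosh β := by
      gcongr
      nlinarith
    have h5 : |z.im| * Real.cosh β ≤ δ * |θ| * Real.cosh β := by gcongr
    nlinarith

/-- The contribution of the keyhole to the error constant. -/
def keyholeBound (P : ℕ) (β : ℝ) : ℝ :=
  2 ^ ((P : ℝ) + 9 / 2) / Real.pi ^ ((P : ℝ) + 3 / 2) +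
    1 / (Real.pi * P * 2 ^ ((P : ℝ) - 5 / 2) * Real.cosh β ^ ((P : ℝ) + 1 / 2))

lemma integral_neg_rpow (a b r : ℝ) : ∫ l in (-b)..(-a), (-l) ^ r = ∫ x in a..b, x ^ r := by
  rw [intervalIntegral.integral_comp_neg (fun x => x ^ r), neg_neg, neg_neg]

lemma intervalIntegrable_neg_rpow {r : ℝ} (hr : -1 < r) (a b : ℝ) :
    IntervalIntegrable (fun l : ℝ => (-l) ^ r) volume a b := by
  have := (intervalIntegral.intervalIntegrable_rpow' (a := -a) (b := -b) hr).comp_sub_left 0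
  simpa using this

/-- Split at `l = -1`. On the inner part `|w|² ≥ μ` and `∫₀¹ x ^ (-1/2) dx = 2`; on the outer part
`|w|² ≥ 2 |l| cosh β`, which leaves `|l| ^ (-P-1)` with integral at most `1 / P`. -/
lemma norm_integral_halfLine_le {β μ L ε N : ℝ} {P : ℕ} (hN : 0 < N) (hP : 1 ≤ P) (hμ0 : 0 < μ)
    (hL : 1 ≤ L) (hε : ε ≠ 0)
    (h : ∀ l : ℝ, -L ≤ l → l < 0 → 0 < (phaseRoot β (halfLine ε l)).im ∧
      (∀ v : ℝ, μ ≤ ‖phaseRoot β (halfLine ε l) ^ 2 - (v : ℂ) ^ 2‖) ∧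
      (l ≤ -1 → 2 * Real.cosh β * -l ≤ ‖phaseRoot β (halfLine ε l)‖ ^ 2))
    (hint : ∀ a b, IntervalIntegrable (pathIntegrand (leftRemainder N β P) (halfLine ε)) volume a b) :
    ‖∫ l in (-L)..0, pathIntegrand (leftRemainder N β P) (halfLine ε) l‖ ≤
      gaussMoment N (P + 1) * (2 / μ ^ ((P : ℝ) + 3 / 2) +
        1 / (μ * P * (2 * Real.cosh β) ^ ((P : ℝ) + 1 / 2))) := by
  have hch := Real.cosh_pos β
  have hg := gaussMoment_pos hN (P + 1)
  have hP0 : (0 : ℝ) < P := by exact_mod_cast hP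
  have hpt : ∀ l : ℝ, -L ≤ l → l < 0 → ∀ m, 0 < m → m ≤ ‖phaseRoot β (halfLine ε l)‖ ^ 2 →
      ‖pathIntegrand (leftRemainder N β P) (halfLine ε) l‖ ≤
      (-l) ^ (-(1 / 2) : ℝ) * (gaussMoment N (P + 1) / (m ^ ((P : ℝ) + 1 / 2) * μ)) := by
    intro l hlL hl m hm hmle
    obtain ⟨h1, h2, -⟩ := h l hlL hl
    obtain ⟨hre, him⟩ := half_mem_of_halfLine ε l
    have hz0 : halfLine ε l ≠ 0 := fun h => hε (by rw [← him, h, Complex.zero_im])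
    rw [pathIntegrand_halfLine]
    refine (norm_leftRemainder_le hN P hz0 h1 hμ0 h2).trans ?_
    have hn : -l ≤ ‖halfLine ε l‖ := by
      have := Complex.abs_re_le_norm (halfLine ε l)
      rwa [hre, abs_of_neg hl] at this
    rw [pow_two_mul_add_one_eq_rpow (norm_nonneg _)]
    have a1 := Real.rpow_le_rpow_of_nonpos (z := -(1 / 2)) (neg_pos.2 hl) hn (by norm_num)
    have a2 := Real.rpow_le_rpow (z := (P : ℝ) + 1 / 2) hm.le hmle (by positivity)
    have a3 : 0 ≤ (-l) ^ (-(1 / 2) : ℝ) := Real.rpow_nonneg (by linarith) _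
    gcongr
  have hμW : ∀ l : ℝ, -L ≤ l → l < 0 → μ ≤ ‖phaseRoot β (halfLine ε l)‖ ^ 2 := fun l hlL hl => by
    have := (h l hlL hl).2.1 0
    simpa using this
  have hne : ∀ᵐ l : ℝ, l ≠ 0 := Measure.ae_ne volume 0
  have hA : ‖∫ l in (-1 : ℝ)..0, pathIntegrand (leftRemainder N β P) (halfLine ε) l‖ ≤
      gaussMoment N (P + 1) * (2 / μ ^ ((P : ℝ) + 3 / 2)) := by
    refine (intervalIntegral.norm_integral_le_of_norm_le (by norm_num) (g := fun l : ℝ =>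
      (-l) ^ (-(1 / 2) : ℝ) * (gaussMoment N (P + 1) / (μ ^ ((P : ℝ) + 1 / 2) * μ))) ?_
      ((intervalIntegrable_neg_rpow (by norm_num) _ _).mul_const _)).trans_eq ?_
    · filter_upwards [hne] with l hl0 hl
      have hl' : l < 0 := lt_of_le_of_ne hl.2 hl0
      have hlL : -L ≤ l := by linarith [hl.1]
      exact hpt l hlL hl' μ hμ0 (hμW l hlL hl')
    · rw [intervalIntegral.integral_mul_const]
      have : ∫ l in (-1 : ℝ)..0, (-l) ^ (-(1 / 2) : ℝ) = 2 := by
        have := integral_neg_rpow 0 1 (-(1 / 2))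
        rw [neg_zero] at this
        rw [this, integral_rpow (Or.inl (by norm_num))]
        norm_num
      rw [this, show (P : ℝ) + 3 / 2 = P + 1 / 2 + 1 by ring, Real.rpow_add_one hμ0.ne']
      ring
  have hB : ‖∫ l in (-L)..(-1 : ℝ), pathIntegrand (leftRemainder N β P) (halfLine ε) l‖ ≤
      gaussMoment N (P + 1) * (1 / (μ * P * (2 * Real.cosh β) ^ ((P : ℝ) + 1 / 2))) := by
    have hrint : IntervalIntegrable (fun l : ℝ => (-l) ^ (-(P : ℝ) - 1)) volume (-L) (-1) := by
      refine ContinuousOn.intervalIntegrable fun l hl => ?_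
      rw [Set.uIcc_of_le (by linarith)] at hl
      exact (continuousAt_id.neg.rpow_const (Or.inl fun h => by
        have h : -l = 0 := h
        linarith [hl.2])).continuousWithinAt
    refine (intervalIntegral.norm_integral_le_of_norm_le (by linarith) (g := fun l : ℝ =>
      (-l) ^ (-(P : ℝ) - 1) *
        (gaussMoment N (P + 1) / ((2 * Real.cosh β) ^ ((P : ℝ) + 1 / 2) * μ))) ?_
      (hrint.mul_const _)).trans ?_
    · refine ae_of_all _ fun l hl => ?_
      have hl' : l < 0 := by linarith [hl.2]
      have hlp : 0 < -l := by linarith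
      refine (hpt l hl.1.le hl' (2 * Real.cosh β * -l) (by positivity)
        ((h l hl.1.le hl').2.2 hl.2)).trans_eq ?_
      rw [Real.mul_rpow (by positivity) hlp.le,
        show -(P : ℝ) - 1 = -(1 / 2) - ((P : ℝ) + 1 / 2) by ring, Real.rpow_sub hlp]
      field_simp
    · rw [intervalIntegral.integral_mul_const, integral_neg_rpow 1 L,
        integral_rpow (Or.inr ⟨by linarith, by
          rw [Set.uIcc_of_le hL]
          exact fun h => by linarith [h.1]⟩), Real.one_rpow]
      have h1 : (L ^ (-(P : ℝ) - 1 + 1) - 1) / (-(P : ℝ) - 1 + 1) ≤ 1 / P := by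
        rw [show -(P : ℝ) - 1 + 1 = -P by ring, div_neg, ← neg_div]
        gcongr
        have : 0 ≤ L ^ (-(P : ℝ)) := by positivity
        linarith
      refine (mul_le_mul_of_nonneg_right h1 (by positivity)).trans_eq ?_
      field_simp
  rw [← intervalIntegral.integral_add_adjacent_intervals (hint (-L) (-1)) (hint (-1) 0)]
  refine (norm_add_le _ _).trans ?_
  linarith

lemma norm_integral_arc_le {β δ N μ : ℝ} {P : ℕ} (hN : 0 < N) (hδ : 0 < δ) (hμ0 : 0 < μ)
    (hμ : μ ≤ Real.pi / 2)
    (h : ∀ θ : ℝ, |θ| ≤ Real.pi / 2 → θ ≠ 0 → 0 < (phaseRoot β (arc δ θ)).im ∧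
      ∀ v : ℝ, Real.pi / 2 ≤ ‖phaseRoot β (arc δ θ) ^ 2 - (v : ℂ) ^ 2‖) :
    ‖∫ θ in (Real.pi / 2)..(-(Real.pi / 2)), pathIntegrand (leftRemainder N β P) (arc δ) θ‖ ≤
      gaussMoment N (P + 1) * (Real.pi * √δ / μ ^ ((P : ℝ) + 3 / 2)) := by
  have hg := gaussMoment_pos hN (P + 1)
  have hπ := Real.pi_pos
  have hle : ∀ᵐ θ : ℝ, θ ∈ Set.uIoc (Real.pi / 2) (-(Real.pi / 2)) →
      ‖pathIntegrand (leftRemainder N β P) (arc δ) θ‖ ≤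
        gaussMoment N (P + 1) * (√δ / μ ^ ((P : ℝ) + 3 / 2)) := by
    filter_upwards [Measure.ae_ne volume (0 : ℝ)] with θ hθ0 hθ
    rw [Set.uIoc_comm, Set.uIoc_of_le (by linarith)] at hθ
    obtain ⟨h1, h2⟩ := h θ (abs_le.2 ⟨hθ.1.le, hθ.2⟩) hθ0
    have hnorm : ‖arc δ θ‖ = δ := by
      rw [arc, norm_mul, Complex.norm_exp_ofReal_mul_I, Complex.norm_real,
        Real.norm_of_nonneg hδ.le, mul_one]
    have hz0 : arc δ θ ≠ 0 := norm_pos_iff.1 (by rw [hnorm]; exact hδ)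
    have hμW : μ ≤ ‖phaseRoot β (arc δ θ)‖ ^ 2 := by
      have := h2 0
      simp at this
      linarith
    rw [pathIntegrand_arc, norm_mul, norm_mul, Complex.norm_I, mul_one, hnorm]
    have h3 := norm_leftRemainder_le hN P hz0 h1 hμ0 fun v => hμ.trans (h2 v)
    rw [hnorm, pow_two_mul_add_one_eq_rpow (norm_nonneg _)] at h3
    have hs : δ ^ (-(1 / 2) : ℝ) * δ = √δ := by
      rw [← Real.rpow_add_one hδ.ne', Real.sqrt_eq_rpow]
      norm_num
    calc _ ≤ δ ^ (-(1 / 2) : ℝ) * (gaussMoment N (P + 1) / (μ ^ ((P : ℝ) + 1 / 2) * μ)) * δ := by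
          refine mul_le_mul_of_nonneg_right (h3.trans ?_) hδ.le
          gcongr
      _ = gaussMoment N (P + 1) * ((δ ^ (-(1 / 2) : ℝ) * δ) / (μ ^ ((P : ℝ) + 1 / 2) * μ)) := by
          ring
      _ = _ := by
          rw [hs, show (P : ℝ) + 3 / 2 = P + 1 / 2 + 1 by ring, Real.rpow_add_one hμ0.ne']
  refine (intervalIntegral.norm_integral_le_of_norm_le_const_ae hle).trans_eq ?_
  rw [show -(Real.pi / 2) - Real.pi / 2 = -Real.pi by ring, abs_neg, abs_of_pos hπ]
  ring

lemma continuousOn_leftRemainder {N β : ℝ} (hN : 0 < N) (hβ : 0 < β) (P : ℕ) :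
    ContinuousOn (leftRemainder N β P) (leftDomain β) := by
  have hsub := leftDomain_subset hβ
  have hsub' : leftDomain β ⊆ wDomain β := fun z hz => (hsub hz).1
  refine ContinuousOn.sub (ContinuousOn.sub
    ((differentiableOn_gaussIntegrand hN hβ).continuousOn.mono hsub')
    (continuousOn_finsetSum _ fun j _ => continuousOn_const.mul
      ((differentiableOn_coeffIntegrand hβ j).continuousOn.mono hsub)))
    (continuousOn_const.mul (ContinuousOn.mul
      ((differentiableOn_cpow_neg_half β).continuousOn.mono hsub') ?_))
  exact (continuousOn_const.mul
    (((differentiableOn_phaseRoot hβ).continuousOn.mono hsub').pow 2)).cexp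

/-- The remainder on a narrow keyhole. -/
lemma exists_norm_keyhole_leftRemainder_le {N β L : ℝ} {P : ℕ} (hN : 0 < N) (hβ : 0 < β)
    (hP : 1 ≤ P) (hL : 1 ≤ L) : ∃ δ₀, 0 < δ₀ ∧ ∀ δ, 0 < δ → δ < δ₀ →
      ‖keyhole δ L (leftRemainder N β P)‖ ≤ gaussMoment N (P + 1) * keyholeBound P β := by
  have hπ := Real.pi_pos
  have hch := Real.cosh_pos β
  have hP0 : (0 : ℝ) < P := by exact_mod_cast hP
  have hg := gaussMoment_pos hN (P + 1)
  have hq : (0 : ℝ) < P + 3 / 2 := by positivity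
  -- `μ` lies slightly below `π/2`, chosen so that `μ ^ (P + 3/2)` loses exactly a factor `7/8`. The
  -- arc and the two inner half lines contribute a numerator of at most `7`, and `7 / (7/8) = 2 ^ 3`
  -- is the power of two in the error constant.
  set s : ℝ := (7 / 8 : ℝ) ^ ((P : ℝ) + 3 / 2)⁻¹ with hs
  have hs0 : 0 < s := by positivity
  have hs1 : s < 1 := Real.rpow_lt_one (by norm_num) (by norm_num) (by positivity)
  have hspow : s ^ ((P : ℝ) + 3 / 2) = 7 / 8 := by
    rw [hs, ← Real.rpow_mul (by norm_num), inv_mul_cancel₀ hq.ne', Real.rpow_one]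
  have hs2 : 7 / 8 ≤ s := by
    rw [← hspow]
    have := Real.rpow_le_rpow_of_exponent_ge hs0 hs1.le (by linarith : (1 : ℝ) ≤ P + 3 / 2)
    rwa [Real.rpow_one] at this
  set μ := Real.pi / 2 * s with hμ
  have hμ0 : 0 < μ := by positivity
  have hμπ : μ < Real.pi / 2 := by nlinarith
  have hμpow : μ ^ ((P : ℝ) + 3 / 2) = (Real.pi / 2) ^ ((P : ℝ) + 3 / 2) * (7 / 8) := by
    rw [hμ, Real.mul_rpow (by positivity) hs0.le, hspow]
  obtain ⟨δ₁, hδ₁, h1⟩ := exists_halfLine_bounds hβ hμπ (by linarith : 0 < L)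
  obtain ⟨δ₂, hδ₂, h2⟩ := exists_arc_bounds hβ
  refine ⟨min (min δ₁ δ₂) (1 / 4), lt_min (lt_min hδ₁ hδ₂) (by norm_num), fun δ hδ hlt => ?_⟩
  have k1 : δ < δ₁ := hlt.trans_le ((min_le_left _ _).trans (min_le_left _ _))
  have k2 : δ < δ₂ := hlt.trans_le ((min_le_left _ _).trans (min_le_right _ _))
  have k3 : δ < 1 / 4 := hlt.trans_le (min_le_right _ _)
  have hcont := continuousOn_leftRemainder hN hβ P
  have e1 := norm_integral_halfLine_le (ε := δ) hN hP hμ0 hL hδ.ne'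
    (fun l hl hl0 => h1 δ hδ.ne' (by rwa [abs_of_pos hδ]) l hl hl0)
    (intervalIntegrable_halfLine hcont hδ.ne')
  have e2 := norm_integral_halfLine_le (ε := -δ) hN hP hμ0 hL (neg_ne_zero.2 hδ.ne')
    (fun l hl hl0 => h1 (-δ) (neg_ne_zero.2 hδ.ne') (by rwa [abs_neg, abs_of_pos hδ]) l hl hl0)
    (intervalIntegrable_halfLine hcont (neg_ne_zero.2 hδ.ne'))
  have e3 := norm_integral_arc_le (P := P) hN hδ hμ0 hμπ.le (h2 δ hδ k2)
  have e4 : ‖keyhole δ L (leftRemainder N β P)‖ ≤ gaussMoment N (P + 1) *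
      ((4 + Real.pi * √δ) / μ ^ ((P : ℝ) + 3 / 2) +
        2 / (μ * P * (2 * Real.cosh β) ^ ((P : ℝ) + 1 / 2))) := by
    rw [keyhole]
    refine (norm_sub_le _ _).trans ((add_le_add ((norm_add_le _ _).trans (add_le_add e1 e3))
      e2).trans_eq ?_)
    ring
  refine e4.trans (mul_le_mul_of_nonneg_left (add_le_add ?_ ?_) hg.le)
  · have hsq : √δ ≤ 1 / 2 := by
      rw [Real.sqrt_le_left (by norm_num)]
      norm_num
      exact k3.le
    have h7 : 4 + Real.pi * √δ ≤ 7 := by nlinarith [Real.pi_lt_d2, Real.sqrt_nonneg δ]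
    have e : (2 : ℝ) ^ ((P : ℝ) + 9 / 2) / Real.pi ^ ((P : ℝ) + 3 / 2) =
        7 / μ ^ ((P : ℝ) + 3 / 2) := by
      rw [hμpow, Real.div_rpow hπ.le zero_le_two,
        show (P : ℝ) + 9 / 2 = P + 3 / 2 + (3 : ℕ) by push_cast; ring,
        Real.rpow_add two_pos, Real.rpow_natCast]
      have : (0 : ℝ) < 2 ^ ((P : ℝ) + 3 / 2) := by positivity
      have : (0 : ℝ) < Real.pi ^ ((P : ℝ) + 3 / 2) := by positivity
      field_simp
      norm_num
    rw [e]
    gcongr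
  · have e : Real.pi * P * 2 ^ ((P : ℝ) - 5 / 2) * Real.cosh β ^ ((P : ℝ) + 1 / 2) * 2 =
        Real.pi / 4 * P * (2 * Real.cosh β) ^ ((P : ℝ) + 1 / 2) := by
      rw [Real.mul_rpow zero_le_two hch.le, show (P : ℝ) + 1 / 2 = P - 5 / 2 + (3 : ℕ) by
        push_cast; ring, Real.rpow_add two_pos, Real.rpow_natCast]
      ring
    rw [div_le_div_iff₀ (by positivity) (by positivity), mul_comm 2, e, one_mul]
    gcongr
    nlinarith

/-! ### The expansion -/

lemma OuterDecay.sub {β R C₁ C₂ : ℝ} {F G : ℂ → ℂ} (hF : OuterDecay β R C₁ F)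
    (hG : OuterDecay β R C₂ G) : OuterDecay β R (C₁ + C₂) (fun z => F z - G z) :=
  ⟨add_nonneg hF.1 hG.1, fun z hR hz hre => (norm_sub_le _ _).trans
    ((add_le_add (hF.2 z hR hz hre) (hG.2 z hR hz hre)).trans_eq (add_mul _ _ _).symm)⟩

lemma outerDecay_sum {β R C : ℝ} {F : ℕ → ℂ → ℂ} (hF : ∀ j, OuterDecay β R C (F j)) (a : ℕ → ℂ)
    (s : Finset ℕ) : OuterDecay β R (∑ j ∈ s, ‖a j‖ * C) (fun z => ∑ j ∈ s, a j * F j z) := by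
  refine ⟨Finset.sum_nonneg fun j _ => mul_nonneg (norm_nonneg _) (hF j).1, fun z hR hz hre => ?_⟩
  rw [Finset.sum_mul]
  refine norm_sum_le_of_le _ fun j _ => ?_
  rw [norm_mul, mul_assoc]
  exact mul_le_mul_of_nonneg_left ((hF j).2 z hR hz hre) (norm_nonneg _)

lemma exists_outerDecay_remainder {N β : ℝ} (hN : 0 < N) (hβ : 0 < β) (P : ℕ) :
    ∃ C, OuterDecay β (outerRadius β) C (remainder N β P) := by
  obtain ⟨C, hC⟩ := exists_outerDecay_gaussIntegrand hN hβ
  exact ⟨_, hC.sub (outerDecay_sum (outerDecay_coeffIntegrand β) _ _)⟩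

lemma differentiableOn_remainder {N β : ℝ} (hN : 0 < N) (hβ : 0 < β) (P : ℕ) :
    DifferentiableOn ℂ (remainder N β P) (wDomain β \ {(tMinus β : ℂ)}) :=
  ((differentiableOn_gaussIntegrand hN hβ).mono Set.sdiff_subset).sub
    (DifferentiableOn.fun_sum fun j _ => (differentiableOn_coeffIntegrand hβ j).const_mul _)

lemma closedBall_subset_wDomain {β ρ : ℝ} (hρc : ρ < tMinus β) (hρt : ρ ≤ tPlus β - tMinus β) :
    Metric.closedBall (tMinus β : ℂ) ρ ⊆ wDomain β := fun z hz => by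
  have h := (Complex.abs_re_le_norm (z - tMinus β)).trans (mem_closedBall_iff_norm.1 hz)
  rw [Complex.sub_re, Complex.ofReal_re] at h
  have := abs_le.1 h
  refine ⟨Or.inl (by linarith), fun hb => ?_⟩
  linarith [hb.2.1]

/-- `J` is entire, so `z ^ (-1/2) J(w(z))` is holomorphic at `t₋` and integrates to zero; only the
subtracted inverse powers contribute. -/
lemma circleIntegral_remainder {N β ρ : ℝ} (hN : 0 < N) (hβ : 0 < β) (P : ℕ) (hρ : 0 < ρ)
    (hρc : ρ < tMinus β) (hρt : ρ ≤ tPlus β - tMinus β) :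
    ∮ z in C((tMinus β : ℂ), ρ), remainder N β P z = -∑ j ∈ Finset.range (P + 1),
      (gaussMoment N j : ℂ) * ∮ z in C((tMinus β : ℂ), ρ), coeffIntegrand (phaseRoot β) j z := by
  have hsub := closedBall_subset_wDomain hρc hρt
  have hsph : Metric.sphere (tMinus β : ℂ) ρ ⊆ wDomain β \ {(tMinus β : ℂ)} := fun z hz =>
    ⟨hsub (Metric.sphere_subset_closedBall hz), fun h => by
      rw [Set.mem_singleton_iff.1 h, Metric.mem_sphere, dist_self] at hz
      linarith⟩
  have hG := differentiableOn_gaussIntegrand hN hβ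
  have hi : ∀ j, CircleIntegrable (coeffIntegrand (phaseRoot β) j) (tMinus β : ℂ) ρ := fun j =>
    ((differentiableOn_coeffIntegrand hβ j).continuousOn.mono hsph).circleIntegrable hρ.le
  have h0 : ∮ z in C((tMinus β : ℂ), ρ), gaussIntegrand N β z = 0 :=
    Complex.circleIntegral_eq_zero_of_differentiable_on_off_countable hρ.le Set.countable_empty
      (hG.continuousOn.mono hsub) fun z hz => hG.differentiableAt
        ((isOpen_wDomain hβ).mem_nhds (hsub (Metric.ball_subset_closedBall hz.1)))
  simp only [remainder]
  rw [circleIntegral.integral_sub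
    ((hG.continuousOn.mono (Metric.sphere_subset_closedBall.trans hsub)).circleIntegrable hρ.le)
    (CircleIntegrable.fun_sum _ fun j _ => circleIntegrable_const_mul (hi j) _), h0, zero_sub,
    circleIntegral.integral_fun_sum fun j _ => circleIntegrable_const_mul (hi j) _]
  simp only [circleIntegral.integral_const_mul]

lemma keyhole_eq_add {β δ L : ℝ} {F G H : ℂ → ℂ} {K : ℂ} (hβ : 0 < β)
    (hG : ContinuousOn G (leftDomain β)) (hH : ContinuousOn H (leftDomain β)) (hδ : 0 < δ)
    (hδc : δ < tMinus β) (hF : ∀ z ∈ wDomain β, F z = G z + K * H z) :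
    keyhole δ L F = keyhole δ L G + K * keyhole δ L H := by
  have hp : ∀ (γ : ℝ → ℂ) (t : ℝ), γ t ∈ wDomain β →
      pathIntegrand F γ t = pathIntegrand G γ t + K * pathIntegrand H γ t := fun γ t ht => by
    simp only [pathIntegrand, hF _ ht]
    ring
  have hδ' := neg_ne_zero.2 hδ.ne'
  have hline : ∀ ε : ℝ, ε ≠ 0 → ∫ l in (-L)..0, pathIntegrand F (halfLine ε) l =
      (∫ l in (-L)..0, pathIntegrand G (halfLine ε) l) +
        K * ∫ l in (-L)..0, pathIntegrand H (halfLine ε) l := fun ε hε => by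
    rw [← intervalIntegral.integral_const_mul, ← intervalIntegral.integral_add
      (intervalIntegrable_halfLine hG hε _ _) ((intervalIntegrable_halfLine hH hε _ _).const_mul _)]
    exact intervalIntegral.integral_congr fun l _ => hp _ _ (halfLine_mem_wDomain hβ hε l)
  have harc : ∫ θ in (Real.pi / 2)..(-(Real.pi / 2)), pathIntegrand F (arc δ) θ =
      (∫ θ in (Real.pi / 2)..(-(Real.pi / 2)), pathIntegrand G (arc δ) θ) +
        K * ∫ θ in (Real.pi / 2)..(-(Real.pi / 2)), pathIntegrand H (arc δ) θ := by
    rw [← intervalIntegral.integral_const_mul, ← intervalIntegral.integral_add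
      (intervalIntegrable_arc hG hδ hδc) ((intervalIntegrable_arc hH hδ hδc).const_mul _)]
    exact intervalIntegral.integral_congr fun θ hθ => hp _ _ (arc_mem_wDomain hβ hδ hδc hθ)
  simp only [keyhole]
  rw [hline δ hδ.ne', hline (-δ) hδ', harc]
  ring

lemma remainder_eq_leftRemainder_add {β : ℝ} (n P : ℕ) {z : ℂ} (hz : z ≠ 0) :
    remainder (bigN n) β P z = leftRemainder (bigN n) β P z +
      (2 * Real.pi * Complex.I * Complex.exp ((bigN n * phaseReal β (tMinus β) : ℝ) : ℂ)) *
        hermiteKernel (bigN n) (Real.cosh β) n z := by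
  rw [leftRemainder, cpow_mul_exp_phaseRoot n hz]
  ring

lemma bigN_pos (n : ℕ) : 0 < bigN n := by unfold bigN; positivity

/-- The truncated expansion, with the closed contour integrals still in place. -/
lemma norm_circleIntegral_remainder_add_le {β ρ : ℝ} (hβ : 0 < β) (n : ℕ) {P : ℕ} (hP : 1 ≤ P)
    (hρ : 0 < ρ) (hρc : ρ < tMinus β) (hρt : ρ ≤ tPlus β - tMinus β) :
    ‖(∮ z in C((tMinus β : ℂ), ρ), remainder (bigN n) β P z) +
      (2 * Real.pi * Complex.I * Complex.exp ((bigN n * phaseReal β (tMinus β) : ℝ) : ℂ)) *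
        (2 * Real.pi * Complex.I * ((√(bigN n) ^ n *
          physHermite n (√(bigN n) * Real.cosh β) / (n ! : ℝ) : ℝ) : ℂ))‖ ≤
      gaussMoment (bigN n) (P + 1) * (keyholeBound P β + descentBound P β) := by
  have hN := bigN_pos n
  set N := bigN n with hNdef
  set K : ℂ := 2 * Real.pi * Complex.I * Complex.exp ((N * phaseReal β (tMinus β) : ℝ) : ℂ) with hK
  set Y : ℂ := 2 * Real.pi * Complex.I * ((√N ^ n *
    physHermite n (√N * Real.cosh β) / (n ! : ℝ) : ℝ) : ℂ) with hY
  set X := ∮ z in C((tMinus β : ℂ), ρ), remainder N β P z with hX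
  obtain ⟨C, hC⟩ := exists_outerDecay_remainder hN hβ P
  have hdiff := differentiableOn_remainder hN hβ P
  have hπ := Real.pi_pos
  have hkey : ∀ b : ℝ, 0 < b → b < Real.pi / 2 → outerRadius β ≤ (gammaPlus β b).im →
      ‖X + K * Y‖ ≤ 2 * (C * (gammaPlus β b).im ^ (-(3 / 2) : ℝ) *
        (2 * (gammaPlus β b).im + Real.cosh β)) +
        gaussMoment N (P + 1) * (keyholeBound P β + descentBound P β) := by
    intro b hb0 hb hR
    set L := (gammaPlus β b).im with hL
    have hL1 : 1 ≤ L := by linarith [three_le_outerRadius β]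
    -- The width allowed for the keyhole depends on its length `L`. Hence `δ → 0` is taken at fixed
    -- `b`, and only afterwards `b → π/2`.
    obtain ⟨δ₀, hδ₀, hkb⟩ := exists_norm_keyhole_leftRemainder_le hN hβ hP hL1
    have hlim : Tendsto (fun δ => ‖X - K * keyhole δ L (hermiteKernel N (Real.cosh β) n)‖)
        (𝓝[>] 0) (𝓝 ‖X - K * (-Y)‖) := by
      have h := tendsto_keyhole_hermiteKernel (β := β) (by linarith : 0 < L) N (Real.cosh β) n
      rw [circleIntegral_hermiteKernel hN.le _ n (by linarith : 0 < L)] at h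
      exact ((h.const_mul K).const_sub X).norm
    rw [mul_neg, sub_neg_eq_add] at hlim
    refine le_of_tendsto hlim ?_
    filter_upwards [Ioo_mem_nhdsGT (lt_min (lt_min hδ₀ (tMinus_pos β)) one_pos)] with δ hδ
    have hδ0 := hδ.1
    have k1 : δ < δ₀ := hδ.2.trans_le ((min_le_left _ _).trans (min_le_left _ _))
    have k2 : δ < tMinus β := hδ.2.trans_le ((min_le_left _ _).trans (min_le_right _ _))
    have k3 : δ < 1 := hδ.2.trans_le (min_le_right _ _)
    have e1 := norm_truncated_sub_circleIntegral_le hβ hdiff hC hρ hρc hρt hδ0 k2 hb0 hb hR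
      (by rw [← hL]; linarith)
    have e2 := hkb δ hδ0 k1
    have e3 := norm_integral_remainder_le hN hβ P hb0 hb
    have hH : ContinuousOn (hermiteKernel N (Real.cosh β) n) (leftDomain β) :=
      (differentiableOn_hermiteKernel _ _ _ fun z hz =>
        Complex.slitPlane_ne_zero (leftDomain_subset hβ hz).1.1).continuousOn
    have e4 := keyhole_eq_add (L := L) hβ (continuousOn_leftRemainder hN hβ P) hH hδ0 k2
      fun z hz => remainder_eq_leftRemainder_add n P (Complex.slitPlane_ne_zero hz.1)
    rw [← hL, ← hX] at e1
    rw [← hNdef, ← hK] at e4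
    have e5 : X - K * keyhole δ L (hermiteKernel N (Real.cosh β) n) =
        -((keyhole δ L (remainder N β P) +
          ∫ θ in (-b)..b, pathIntegrand (remainder N β P) (gammaPlus β) θ) - X) +
        (keyhole δ L (leftRemainder N β P) +
          ∫ θ in (-b)..b, pathIntegrand (remainder N β P) (gammaPlus β) θ) := by
      rw [e4]
      ring
    rw [e5]
    refine (norm_add_le _ _).trans (add_le_add ((norm_neg _).trans_le e1)
      ((norm_add_le _ _).trans ((add_le_add e2 e3).trans_eq (mul_add _ _ _).symm)))
  have hT := tendsto_im_gammaPlus hβ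
  have hlim2 := ((tendsto_truncation_error C (Real.cosh β)).comp hT).add_const
    (gaussMoment N (P + 1) * (keyholeBound P β + descentBound P β))
  rw [zero_add] at hlim2
  refine ge_of_tendsto hlim2 ?_
  filter_upwards [hT.eventually (eventually_ge_atTop (outerRadius β)),
    Ioo_mem_nhdsLT (by positivity : 0 < Real.pi / 2)] with b hb hb2
  exact hkey b hb2.1 hb2.2 hb

lemma pi_rpow_three_half : Real.pi ^ (3 / 2 : ℝ) = Real.pi * √Real.pi := by
  rw [Real.sqrt_eq_rpow, show (3 / 2 : ℝ) = 1 + 1 / 2 by norm_num,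
    Real.rpow_add Real.pi_pos, Real.rpow_one]

lemma exp_bigN_mul_phaseReal (n : ℕ) (β : ℝ) :
    Real.exp (bigN n * phaseReal β (tMinus β)) *
      Real.exp (bigN n * (Real.exp (-2 * β) + 2 * β + 2) / 4) = 1 / (2 ^ n * √2) := by
  rw [← Real.exp_add, phaseReal_tMinus]
  have h1 : bigN n * (-Real.exp (-2 * β) / 4 - 1 / 2 - β / 2 - Real.log 2 / 2) +
      bigN n * (Real.exp (-2 * β) + 2 * β + 2) / 4 = -(n * Real.log 2 + Real.log 2 * (1 / 2)) := by
    unfold bigN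
    ring
  rw [h1, Real.exp_neg, Real.exp_add, Real.exp_nat_mul, Real.exp_log two_pos,
    ← Real.rpow_def_of_pos two_pos, ← Real.sqrt_eq_rpow, one_div]

lemma prefactor_pos {β : ℝ} (hβ : 0 < β) (n : ℕ) : 0 < prefactor n β := by
  have := Real.sinh_pos_iff.2 hβ
  have := bigN_pos n
  have := Real.pi_pos
  unfold prefactor
  positivity

/-- The first bracket normalizes the residues to `A_j / N ^ j`, the second is the modulus of the
constant in front of the Hermite polynomial. Their product with `prefactor` being `1` identifies the
leading factor of the expansion. -/
lemma prefactor_mul {β : ℝ} (hβ : 0 < β) (n : ℕ) :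
    (√(Real.sinh β) / (2 * Real.pi ^ (3 / 2 : ℝ)) * √(bigN n)) *
      (4 * Real.pi ^ 2 * Real.exp (bigN n * phaseReal β (tMinus β)) *
        (√(bigN n) ^ n / (n ! : ℝ))) * prefactor n β = 1 := by
  have hN := bigN_pos n
  have hsh := Real.sinh_pos_iff.2 hβ
  have hπ := Real.pi_pos
  have hexp := exp_bigN_mul_phaseReal n β
  have hpow : bigN n ^ (((n : ℝ) + 1) / 2) = √(bigN n) ^ (n + 1) := by
    rw [Real.sqrt_eq_rpow, ← Real.rpow_natCast, ← Real.rpow_mul hN.le]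
    congr 1
    push_cast
    ring
  have hsq : √(2 * Real.pi * Real.sinh β) = √2 * √Real.pi * √(Real.sinh β) := by
    rw [Real.sqrt_mul (by positivity), Real.sqrt_mul zero_le_two]
  rw [prefactor, hpow, hsq, pi_rpow_three_half]
  generalize Real.exp (bigN n * phaseReal β (tMinus β)) = e₁ at *
  generalize Real.exp (bigN n * (Real.exp (-2 * β) + 2 * β + 2) / 4) = e₂ at *
  have h2 := Real.mul_self_sqrt (zero_le_two (α := ℝ))
  have hπ2 := Real.mul_self_sqrt hπ.le
  have hs2 : √2 ≠ 0 := (Real.sqrt_pos.2 two_pos).ne'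
  have hsπ : √Real.pi ≠ 0 := (Real.sqrt_pos.2 hπ).ne'
  have hsN : √(bigN n) ≠ 0 := (Real.sqrt_pos.2 hN).ne'
  have hss : √(Real.sinh β) ≠ 0 := (Real.sqrt_pos.2 hsh).ne'
  have hf : (n ! : ℝ) ≠ 0 := by exact_mod_cast Nat.factorial_ne_zero n
  calc _ = 2 * Real.pi * (e₁ * e₂) * 2 ^ n / ((√Real.pi * √Real.pi) * √2) := by
        field_simp
        ring
    _ = 1 := by
        rw [hexp, hπ2]
        field_simp
        linear_combination -h2

lemma mul_gaussMoment {N : ℝ} (hN : 0 < N) (c : ℝ) (j : ℕ) :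
    c * √N * gaussMoment N j = c * Real.Gamma ((j : ℝ) + 1 / 2) / N ^ j := by
  have h : √N * N ^ (-((j : ℝ) + 1 / 2)) = (N ^ j)⁻¹ := by
    rw [Real.sqrt_eq_rpow, ← Real.rpow_add hN, ← Real.rpow_natCast, ← Real.rpow_neg hN.le]
    congr 1
    ring
  rw [gaussMoment, div_eq_mul_inv (c * _) (N ^ j), ← h]
  ring

/-- The keyhole and the descent path account for the first three terms of `constC`; its last term is
nonnegative slack. -/
lemma keyholeBound_add_descentBound_le {β : ℝ} (hβ : 0 < β) (P : ℕ) :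
    keyholeBound P β + descentBound P β ≤ constC P β := by
  have h1 : 0 < Real.tanh β := by
    rw [Real.tanh_eq_sinh_div_cosh]
    exact div_pos (Real.sinh_pos_iff.2 hβ) (Real.cosh_pos β)
  have hπ := Real.pi_pos
  rw [constC, keyholeBound, descentBound, mul_add]
  have : 0 ≤ 2 / Real.tanh β *
      (2 ^ (-(P : ℝ)) * Real.pi / (3 * Real.exp ((2 * (P : ℝ) + 5 / 2) * β))) := by positivity
  linarith

/-- Multiplying the contour estimate by `√(sinh β) √N / (2 π ^ (3/2))` turns moments times residues
into `A_j / N ^ j` and the Hermite term into minus its quotient by `prefactor`. -/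
lemma abs_sum_coeffA_sub_le {β : ℝ} (hβ : 0 < β) {p : ℕ} (hp : 1 ≤ p) (n : ℕ) :
    |∑ j ∈ Finset.range (p + 1), coeffA j (coth β) / bigN n ^ j -
      physHermite n (√(bigN n) * Real.cosh β) / prefactor n β| ≤
      √(Real.sinh β) / (2 * Real.pi ^ (3 / 2 : ℝ)) *
        (constC p β * Real.Gamma ((p : ℝ) + 3 / 2) / bigN n) / bigN n ^ p := by
  obtain ⟨ρ, hρ, hρc, hρt, hA⟩ := exists_circleIntegral_coeffIntegrand hβ
  have hmain := norm_circleIntegral_remainder_add_le hβ n hp hρ hρc hρt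
  have hN := bigN_pos n
  have hπ := Real.pi_pos
  have hpre := prefactor_pos hβ n
  have hpm := prefactor_mul hβ n
  set N := bigN n with hNdef
  set c := √(Real.sinh β) / (2 * Real.pi ^ (3 / 2 : ℝ)) with hc
  have hc0 : 0 ≤ c := by positivity
  set H := physHermite n (√N * Real.cosh β) with hH
  rw [circleIntegral_remainder hN hβ p hρ hρc hρt] at hmain
  have hX : ((c * √N : ℝ) : ℂ) * -∑ j ∈ Finset.range (p + 1), (gaussMoment N j : ℂ) *
      (∮ z in C((tMinus β : ℂ), ρ), coeffIntegrand (phaseRoot β) j z) =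
      ((∑ j ∈ Finset.range (p + 1), coeffA j (coth β) / N ^ j : ℝ) : ℂ) := by
    rw [← Finset.sum_neg_distrib, Finset.mul_sum, Complex.ofReal_sum]
    refine Finset.sum_congr rfl fun j _ => ?_
    have h1 := congrArg Complex.ofReal (mul_gaussMoment hN c j)
    have h2 := hA j
    rw [← div_mul_eq_mul_div, ← hc] at h2
    rw [Complex.ofReal_div, ← h2]
    push_cast at h1 ⊢
    linear_combination -(∮ z in C((tMinus β : ℂ), ρ), coeffIntegrand (phaseRoot β) j z) * h1
  have hY : ((c * √N : ℝ) : ℂ) *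
      ((2 * Real.pi * Complex.I * Complex.exp ((N * phaseReal β (tMinus β) : ℝ) : ℂ)) *
        (2 * Real.pi * Complex.I * ((√N ^ n * H / (n ! : ℝ) : ℝ) : ℂ))) =
      ((-(H / prefactor n β) : ℝ) : ℂ) := by
    have h1 : H / prefactor n β = (c * √N) * (4 * Real.pi ^ 2 *
        Real.exp (N * phaseReal β (tMinus β)) * (√N ^ n / (n ! : ℝ))) * H := by
      rw [div_eq_iff hpre.ne']
      linear_combination -H * hpm
    rw [h1, ← Complex.ofReal_exp]
    push_cast
    linear_combination (c * √N * (4 * Real.pi ^ 2 * Complex.exp (N * phaseReal β (tMinus β)) *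
      (√N ^ n / (n ! : ℂ))) * H) * Complex.I_sq
  have h1 := mul_le_mul_of_nonneg_left hmain (by positivity : 0 ≤ c * √N)
  have h2 : ‖((c * √N : ℝ) : ℂ)‖ = c * √N := by
    rw [Complex.norm_real, Real.norm_of_nonneg (by positivity)]
  rw [← h2, ← norm_mul, mul_add, hX, hY, ← Complex.ofReal_add, Complex.norm_real,
    Real.norm_eq_abs, ← sub_eq_add_neg, h2, ← mul_assoc, mul_gaussMoment hN] at h1
  refine h1.trans ?_
  have hG : 0 ≤ Real.Gamma ((p : ℝ) + 3 / 2) := (Real.Gamma_pos_of_pos (by positivity)).le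
  have e : ((p + 1 : ℕ) : ℝ) + 1 / 2 = p + 3 / 2 := by push_cast; ring
  rw [e]
  calc _ ≤ c * Real.Gamma ((p : ℝ) + 3 / 2) / N ^ (p + 1) * constC p β := by
        gcongr
        exact keyholeBound_add_descentBound_le hβ p
    _ = _ := by
        rw [pow_succ]
        field_simp

/-- The expansion is carried one term further than stated. The extra term gives `|A_p| / N ^ p`, and
the true remainder is smaller by a factor `1 / N`, which is why the error constant tends to `|A_p|`.
-/
lemma exists_hermite_expansion {β : ℝ} (hβ : 0 < β) {p : ℕ} (hp : 1 ≤ p) (n : ℕ) :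
    ∃ ε : ℝ, physHermite n (√(bigN n) * Real.cosh β) = prefactor n β *
        (∑ j ∈ Finset.range p, coeffA j (coth β) / bigN n ^ j + ε) ∧
      |ε| ≤ constCtilde p n β / bigN n ^ p := by
  have h := abs_sum_coeffA_sub_le hβ hp n
  have hpre := prefactor_pos hβ n
  have hN := bigN_pos n
  refine ⟨physHermite n (√(bigN n) * Real.cosh β) / prefactor n β -
    ∑ j ∈ Finset.range p, coeffA j (coth β) / bigN n ^ j, ?_, ?_⟩
  · rw [add_sub_cancel, mul_div_cancel₀ _ hpre.ne']
  · rw [Finset.sum_range_succ] at h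
    set S := ∑ j ∈ Finset.range p, coeffA j (coth β) / bigN n ^ j
    set H := physHermite n (√(bigN n) * Real.cosh β) / prefactor n β
    rw [constCtilde, add_div]
    have e : H - S = coeffA p (coth β) / bigN n ^ p -
        (S + coeffA p (coth β) / bigN n ^ p - H) := by ring
    rw [e]
    refine (abs_sub _ _).trans (add_le_add (le_of_eq ?_) h)
    rw [abs_div, abs_of_pos (pow_pos hN p)]

lemma tendsto_constCtilde (p : ℕ) (β : ℝ) :
    Tendsto (fun n : ℕ => constCtilde p n β) atTop (𝓝 |coeffA p (coth β)|) := by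
  have hN : Tendsto bigN atTop atTop :=
    tendsto_atTop_add_const_right _ _ (tendsto_natCast_atTop_atTop.const_mul_atTop two_pos)
  have h := ((hN.const_div_atTop (constC p β * Real.Gamma ((p : ℝ) + 3 / 2))).const_mul
    (√(Real.sinh β) / (2 * Real.pi ^ (3 / 2 : ℝ)))).const_add |coeffA p (coth β)|
  rw [mul_zero, add_zero] at h
  exact h

end HermiteOuter

end

/-! ### Assembly of the theorem. -/

theorem theorem1 :
    -- each `A_j` is a polynomial of degree `3 j` with rational coefficients
    (∀ j : ℕ, ∃ q : Polynomial ℚ, q.degree = ((3 * j : ℕ) : WithBot ℕ) ∧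
      ∀ t : ℝ, HermiteOuter.coeffA j t = Polynomial.aeval t q) ∧
    ∀ β : ℝ, 0 < β →
      -- the branch `w` exists, it is unique, and `A_j (coth β)` is its contour integral
      (∃ w : ℂ → ℂ, HermiteOuter.IsPhaseRoot β w) ∧
      (∀ w₁ w₂ : ℂ → ℂ, HermiteOuter.IsPhaseRoot β w₁ → HermiteOuter.IsPhaseRoot β w₂ →
        Set.EqOn w₁ w₂ (HermiteOuter.wDomain β)) ∧
      (∀ w : ℂ → ℂ, HermiteOuter.IsPhaseRoot β w →
        ∀ δ : ℝ, 0 < δ → δ < HermiteOuter.tMinus β → ∀ j : ℕ,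
          HermiteOuter.ContourIntegrable β δ (HermiteOuter.coeffIntegrand w j) ∧
          HermiteOuter.contourCoeff β δ w j =
            (HermiteOuter.coeffA j (HermiteOuter.coth β) : ℂ)) ∧
      -- the expansion with its error bound, and the limit of the error constant
      ∀ p : ℕ, 1 ≤ p →
        (∀ n : ℕ, ∃ ε : ℝ,
          HermiteOuter.physHermite n (√(HermiteOuter.bigN n) * Real.cosh β) =
            HermiteOuter.prefactor n β *
              (∑ j ∈ Finset.range p,
                HermiteOuter.coeffA j (HermiteOuter.coth β) / HermiteOuter.bigN n ^ j + ε) ∧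
          |ε| ≤ HermiteOuter.constCtilde p n β / HermiteOuter.bigN n ^ p) ∧
        Filter.Tendsto (fun n : ℕ => HermiteOuter.constCtilde p n β) Filter.atTop
          (nhds |HermiteOuter.coeffA p (HermiteOuter.coth β)|) := by
  refine ⟨HermiteOuter.exists_polynomial_coeffA, fun β hβ =>
    ⟨⟨_, HermiteOuter.isPhaseRoot_phaseRoot hβ⟩, fun w₁ w₂ h₁ h₂ =>
      (h₁.eqOn_phaseRoot hβ).trans (h₂.eqOn_phaseRoot hβ).symm,
    fun w hw δ hδ hδc j => hw.contourCoeff_eq hβ hδ hδc j,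
    fun p hp => ⟨fun n => HermiteOuter.exists_hermite_expansion hβ hp n,
      HermiteOuter.tendsto_constCtilde p β⟩⟩⟩
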